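/- Let $\mathcal{O}=\mathbb{C}\{x_0,\dots,x_n\}$ be the ring of germs at $0$ of holomorphic functions on $\mathbb{C}^{n+1}$, with maximal ideal $\mathfrak{m}$, and let $f\in\mathfrak{m}^2$ be a reduced equation (that is, $(f)$ is a radical ideal) of a hypersurface germ $D=\{f=0\}$ with an isolated singularity at $0$ (that is, in some neighbourhood of $0$ the only common zero of $f,\partial f/\partial x_0,\dots,\partial f/\partial x_n$ is $0$). Call $D$ quasihomogeneous if in suitable holomorphic coordinates at $0$ it is defined by a polynomial that is weighted homogeneous with respect to positive integer weights. Let $\Omega^p(*D)$ be the germs at $0$ of meromorphic $p$-forms with poles along $D$, let $\Omega^p(D)=\frac1f\Omega^p$ where $\Omega^p$ are the germs of holomorphic $p$-forms, and let $$\Omega^p(\log D)=\{\omega\in\Omega^p(D) : d\omega\in\Omega^{p+1}(D)\}\subseteq\Omega^p(*D)$$ be the logarithmic $p$-forms along $D$. These form a complex $\Omega^\bullet(\log D)$ under $d$, with cohomology $\mathcal{H}^p(\Omega^\bullet(\log D))$ (the stalk at $0$). Put $dx=dx_0\wedge\dots\wedge dx_n$. Suppose that $D$ is not quasihomogeneous.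 Then: (i) for every unit $u\in\mathcal{O}^*$, the class of $\frac{u\,dx}{f}$ in $\mathcal{H}^{n+1}(\Omega^\bullet(\log D))$ is nonzero; (ii) $d\,\Omega^n(\log D)\subseteq\mathfrak{m}\,\Omega^{n+1}(\log D)$. -/

import Mathlib

open Filter Topology

noncomputable section

namespace LogSing

/-! ### The local ring of germs of holomorphic functions at the origin of `ℂⁿ⁺¹` -/

/-- The coordinate space `ℂⁿ⁺¹`, with coordinates `x₀, …, xₙ`. -/
abbrev Space (n : ℕ) : Type := Fin (n + 1) → ℂ

/-- Functions on `ℂⁿ⁺¹` that are holomorphic (analytic) near the origin. -/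
def holFun (n : ℕ) : Subalgebra ℂ (Space n → ℂ) where
  carrier := {F | AnalyticAt ℂ F 0}
  mul_mem' := fun hF hG => hF.mul hG
  add_mem' := fun hF hG => hF.add hG
  algebraMap_mem' := fun _ => analyticAt_const

/-- The ideal of those functions which vanish in a neighbourhood of the origin. -/
def nullGerm (n : ℕ) : Ideal (holFun n) where
  carrier := {F | (F : Space n → ℂ) =ᶠ[𝓝 0] 0}
  add_mem' := fun {F G} hF hG => by
    filter_upwards [hF, hG] with x h1 h2
    simp [h1, h2]
  zero_mem' := EventuallyEq.rfl
  smul_mem' := fun c F hF => by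
    filter_upwards [hF] with x h
    simp [h]

/-- The local ring `𝒪 = ℂ{x₀, …, xₙ}` of germs at `0` of holomorphic functions on `ℂⁿ⁺¹`. -/
def Hol (n : ℕ) : Type := holFun n ⧸ nullGerm n

instance (n : ℕ) : CommRing (Hol n) := inferInstanceAs (CommRing (holFun n ⧸ nullGerm n))

instance (n : ℕ) : Algebra ℂ (Hol n) := inferInstanceAs (Algebra ℂ (holFun n ⧸ nullGerm n))

variable {n : ℕ}

/-- The germ at `0` of a function that is holomorphic near `0`. -/
def germ (n : ℕ) : holFun n →ₐ[ℂ] Hol n := Ideal.Quotient.mkₐ ℂ (nullGerm n)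

lemma germ_surjective : Function.Surjective (germ n) := Ideal.Quotient.mk_surjective

lemma germ_eq_zero_iff {F : holFun n} : germ n F = 0 ↔ (F : Space n → ℂ) =ᶠ[𝓝 0] 0 :=
  Ideal.Quotient.eq_zero_iff_mem

lemma germ_eq_iff {F G : holFun n} :
    germ n F = germ n G ↔ (F : Space n → ℂ) =ᶠ[𝓝 0] (G : Space n → ℂ) := by
  rw [← sub_eq_zero, ← map_sub, germ_eq_zero_iff]
  constructor
  · intro h
    filter_upwards [h] with x hx
    simpa [sub_eq_zero] using hx
  · intro h
    filter_upwards [h] with x hx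
    simp [hx]

/-- The value of a germ at the origin. -/
def value (n : ℕ) : Hol n →ₐ[ℂ] ℂ :=
  Ideal.Quotient.liftₐ (nullGerm n) ((Pi.evalAlgHom ℂ (fun _ : Space n => ℂ) 0).comp (holFun n).val)
    (fun _ hF => EventuallyEq.eq_of_nhds hF)

lemma value_germ (F : holFun n) : value n (germ n F) = (F : Space n → ℂ) 0 := rfl

/-- The ideal `𝔪` of germs vanishing at the origin, which is the maximal ideal of `𝒪`. -/
def 𝔪 (n : ℕ) : Ideal (Hol n) := RingHom.ker (value n)

/-- The partial derivative `∂F/∂xᵢ` of a function that is holomorphic near `0`. -/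
def pderivFun (i : Fin (n + 1)) (F : holFun n) : holFun n :=
  ⟨fun x => fderiv ℂ (F : Space n → ℂ) x (Pi.single i 1),
    ((ContinuousLinearMap.apply ℂ ℂ (Pi.single i 1 : Space n)).analyticAt _).comp
      (AnalyticAt.fderiv F.2)⟩

lemma pderivFun_congr (i : Fin (n + 1)) {F G : holFun n} (h : germ n F = germ n G) :
    germ n (pderivFun i F) = germ n (pderivFun i G) := by
  rw [germ_eq_iff] at h ⊢
  filter_upwards [h.fderiv (𝕜 := ℂ)] with x hx
  simp [pderivFun, hx]

lemma eventually_differentiableAt (F : holFun n) :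
    ∀ᶠ x in 𝓝 (0 : Space n), DifferentiableAt ℂ (F : Space n → ℂ) x :=
  (AnalyticAt.eventually_analyticAt F.2).mono fun _ h => h.differentiableAt

/-- The partial derivative `∂ᵢ = ∂/∂xᵢ` on germs, as a function. -/
def pderivGerm (i : Fin (n + 1)) : Hol n → Hol n :=
  Quotient.lift (s := Submodule.quotientRel (nullGerm n)) (fun F => germ n (pderivFun i F))
    (fun _ _ h => pderivFun_congr i (Quotient.sound h))

lemma pderivGerm_germ (i : Fin (n + 1)) (F : holFun n) :
    pderivGerm i (germ n F) = germ n (pderivFun i F) := rfl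

/-- The partial derivative `∂ᵢ = ∂/∂xᵢ`, as a `ℂ`-linear derivation of `𝒪`. -/
def pderiv (i : Fin (n + 1)) : Derivation ℂ (Hol n) (Hol n) :=
  Derivation.mk'
    { toFun := pderivGerm i
      map_add' := by
        intro a b
        obtain ⟨F, rfl⟩ := germ_surjective a
        obtain ⟨G, rfl⟩ := germ_surjective b
        rw [← map_add, pderivGerm_germ, pderivGerm_germ, pderivGerm_germ, ← map_add, germ_eq_iff]
        filter_upwards [eventually_differentiableAt F, eventually_differentiableAt G] with x h1 h2
        simp [pderivFun, fderiv_add h1 h2]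
      map_smul' := by
        intro c a
        obtain ⟨F, rfl⟩ := germ_surjective a
        rw [← map_smul, pderivGerm_germ, pderivGerm_germ, RingHom.id_apply, ← map_smul,
          germ_eq_iff]
        filter_upwards [eventually_differentiableAt F] with x h1
        simp [pderivFun, fderiv_const_smul h1 c] }
    (by
      intro a b
      obtain ⟨F, rfl⟩ := germ_surjective a
      obtain ⟨G, rfl⟩ := germ_surjective b
      change pderivGerm i (germ n F * germ n G) =
        germ n F • pderivGerm i (germ n G) + germ n G • pderivGerm i (germ n F)
      rw [← map_mul, pderivGerm_germ, pderivGerm_germ, pderivGerm_germ, smul_eq_mul, smul_eq_mul,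
        ← map_mul, ← map_mul, ← map_add, germ_eq_iff]
      filter_upwards [eventually_differentiableAt F, eventually_differentiableAt G] with x h1 h2
      simp [pderivFun, fderiv_mul h1 h2])

lemma pderiv_germ (i : Fin (n + 1)) (F : holFun n) :
    pderiv i (germ n F) = germ n (pderivFun i F) := rfl

lemma pderiv_comm (i j : Fin (n + 1)) (a : Hol n) :
    pderiv i (pderiv j a) = pderiv j (pderiv i a) := by
  obtain ⟨F, rfl⟩ := germ_surjective a
  rw [pderiv_germ, pderiv_germ, pderiv_germ, pderiv_germ, germ_eq_iff]
  filter_upwards [AnalyticAt.eventually_analyticAt F.2] with x hx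
  have hs : IsSymmSndFDerivAt ℂ (F : Space n → ℂ) x :=
    ContDiffAt.isSymmSndFDerivAt_of_omega hx.contDiffAt
  have hd : DifferentiableAt ℂ (fderiv ℂ (F : Space n → ℂ)) x := hx.fderiv.differentiableAt
  simp only [pderivFun]
  rw [fderiv_clm_apply hd (differentiableAt_const _), fderiv_clm_apply hd (differentiableAt_const _)]
  simpa using hs (Pi.single i 1) (Pi.single j 1)

/-! ### Isolated hypersurface singularities and quasihomogeneity -/

/-- `f ∈ 𝔪²` is a reduced equation of a hypersurface germ `D = {f = 0}` in `(ℂⁿ⁺¹, 0)` with an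
isolated singularity: near `0`, the origin is the only point of `D` at which all partial
derivatives of `f` vanish. -/
structure IsIsolatedSingularity (f : Hol n) : Prop where
  mem_sq : f ∈ 𝔪 n ^ 2
  reduced : (Ideal.span {f}).IsRadical
  isolated : ∃ F : holFun n, germ n F = f ∧
    ∀ᶠ x in 𝓝 (0 : Space n), (F : Space n → ℂ) x = 0 → fderiv ℂ (F : Space n → ℂ) x = 0 → x = 0

/-- `y₀, …, yₙ` is a system of holomorphic coordinates on `(ℂⁿ⁺¹, 0)`: the `yᵢ` vanish at the
origin and their Jacobian matrix at the origin is invertible. -/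
def IsCoordinateSystem (y : Fin (n + 1) → Hol n) : Prop :=
  (∀ i, y i ∈ 𝔪 n) ∧ (Matrix.of fun i j => value n (pderiv j (y i))).det ≠ 0

/-- The germ `D = {f = 0}` is quasihomogeneous: in suitable holomorphic coordinates `y₀, …, yₙ`, it
is defined by a polynomial that is weighted homogeneous with respect to positive integer weights.
Two equations define the same (reduced) germ when they differ by a unit of `𝒪`. -/
def IsQuasihomogeneous (f : Hol n) : Prop :=
  ∃ y : Fin (n + 1) → Hol n, IsCoordinateSystem y ∧
    ∃ w : Fin (n + 1) → ℕ, (∀ i, 0 < w i) ∧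
      ∃ (r : ℕ) (g : MvPolynomial (Fin (n + 1)) ℂ), g.IsWeightedHomogeneous w r ∧
        Associated f (MvPolynomial.aeval y g)

/-! ### Meromorphic functions with poles along `D` -/

/-- The ring `𝒪(*D) = 𝒪[1/f]` of germs of meromorphic functions with poles along `D`. -/
def Mero (f : Hol n) : Type := Localization.Away f

instance (f : Hol n) : CommRing (Mero f) := inferInstanceAs (CommRing (Localization.Away f))

instance (f : Hol n) : Algebra (Hol n) (Mero f) :=
  inferInstanceAs (Algebra (Hol n) (Localization.Away f))

instance (f : Hol n) : IsLocalization.Away f (Mero f) :=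
  inferInstanceAs (IsLocalization.Away f (Localization.Away f))

instance (f : Hol n) : Algebra ℂ (Mero f) :=
  ((algebraMap (Hol n) (Mero f)).comp (algebraMap ℂ (Hol n))).toAlgebra

instance (f : Hol n) : IsScalarTower ℂ (Hol n) (Mero f) :=
  IsScalarTower.of_algebraMap_eq fun _ => rfl

section Localization

set_option linter.unusedSectionVars false

variable {A : Type} [CommRing A] [Algebra ℂ A] (f : A) (B : Type) [CommRing B] [Algebra A B]
  [Algebra ℂ B] [IsScalarTower ℂ A B] (d : Derivation ℂ A A)

/-- The ring homomorphism `a ↦ a + ε d(a)` from `A` to the dual numbers over `B = A[1/f]`. -/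
def dualHom : A →+* TrivSqZeroExt B B where
  toFun a := TrivSqZeroExt.inl (algebraMap A B a) + TrivSqZeroExt.inr (algebraMap A B (d a))
  map_one' := by ext <;> simp
  map_zero' := by ext <;> simp
  map_add' a b := by ext <;> simp [Algebra.smul_def]
  map_mul' a b := by
    ext
    · simp
    · simp only [TrivSqZeroExt.snd_add, TrivSqZeroExt.snd_inl, TrivSqZeroExt.snd_inr,
        TrivSqZeroExt.snd_mul, TrivSqZeroExt.fst_add, TrivSqZeroExt.fst_inl,
        TrivSqZeroExt.fst_inr, Derivation.leibniz, map_add, map_mul, smul_eq_mul, zero_add,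
        add_zero, MulOpposite.smul_eq_mul_unop, MulOpposite.unop_op]
      ring

lemma fst_dualHom (a : A) : (dualHom B d a).fst = algebraMap A B a := by simp [dualHom]

lemma snd_dualHom (a : A) : (dualHom B d a).snd = algebraMap A B (d a) :=
  (congrArg (· + algebraMap A B (d a)) rfl).trans (zero_add _)

lemma isUnit_dualHom [IsLocalization.Away f B] : IsUnit (dualHom B d f) := by
  rw [TrivSqZeroExt.isUnit_iff_isUnit_fst, fst_dualHom]
  exact IsLocalization.Away.algebraMap_isUnit f

/-- The ring homomorphism `a ↦ a + ε d(a)` on `B = A[1/f]`. -/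
def dualLift [IsLocalization.Away f B] : B →+* TrivSqZeroExt B B :=
  IsLocalization.Away.lift f (isUnit_dualHom f B d)

lemma dualLift_algebraMap [IsLocalization.Away f B] (a : A) : dualLift f B d (algebraMap A B a) = dualHom B d a :=
  IsLocalization.Away.lift_eq f (isUnit_dualHom f B d) a

lemma fst_dualLift [IsLocalization.Away f B] (r : B) : (dualLift f B d r).fst = r := by
  have h : ((TrivSqZeroExt.fstHom ℂ B B).toRingHom.comp
      (dualLift f B d)) = RingHom.id _ := by
    apply IsLocalization.ringHom_ext (Submonoid.powers f)
    ext a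
    simp [dualLift_algebraMap, fst_dualHom]
  exact congrArg (fun φ => φ r) h

/-- The extension of a derivation `d` of `A` to `B = A[1/f]`, given by the quotient rule; it is the
unique derivation of `B = A[1/f]` that extends `d`, see `locDer_algebraMap` and `locDer_unique`. -/
def locDer [IsLocalization.Away f B] : Derivation ℂ B B :=
  Derivation.mk'
    { toFun := fun r => (dualLift f B d r).snd
      map_add' := fun a b => by rw [map_add, TrivSqZeroExt.snd_add]
      map_smul' := fun c a => by
        have h : dualLift f B d (algebraMap ℂ B c) = TrivSqZeroExt.inl (algebraMap ℂ B c) := by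
          rw [IsScalarTower.algebraMap_apply ℂ A B, dualLift_algebraMap]
          apply TrivSqZeroExt.ext
          · rw [fst_dualHom, TrivSqZeroExt.fst_inl, ← IsScalarTower.algebraMap_apply]
          · rw [snd_dualHom, TrivSqZeroExt.snd_inl, Derivation.map_algebraMap, map_zero]
        rw [Algebra.smul_def, map_mul, h, TrivSqZeroExt.snd_mul]
        simp [Algebra.smul_def] }
    (fun a b => by
      change (dualLift f B d (a * b)).snd = _ • (dualLift f B d b).snd + _ • (dualLift f B d a).snd
      rw [map_mul, TrivSqZeroExt.snd_mul, fst_dualLift, fst_dualLift]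
      simp [mul_comm])

lemma locDer_algebraMap [IsLocalization.Away f B] (a : A) : locDer f B d (algebraMap A B a) = algebraMap A B (d a) := by
  change (dualLift f B d (algebraMap A B a)).snd = _
  rw [dualLift_algebraMap, snd_dualHom]

variable {B} in
lemma locDer_unique [IsLocalization.Away f B] {D E : Derivation ℂ B B}
    (h : ∀ a : A, D (algebraMap A B a) = E (algebraMap A B a)) : D = E := by
  ext r
  obtain ⟨k, a, hr⟩ := IsLocalization.Away.surj f r
  have hu : IsUnit (algebraMap A B f ^ k) :=
    (IsLocalization.Away.algebraMap_isUnit f).pow k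
  have h1 := congrArg D hr
  have h2 := congrArg E hr
  have h3 := h (f ^ k)
  rw [map_pow] at h3
  rw [Derivation.leibniz] at h1 h2
  rw [h, ← h2, h3] at h1
  have h4 := add_left_cancel h1
  simpa using hu.mul_left_cancel h4

end Localization

/-- The partial derivative `∂ᵢ` on `𝒪(*D)`. -/
def mderiv (f : Hol n) (i : Fin (n + 1)) : Derivation ℂ (Mero f) (Mero f) := locDer f (Mero f) (pderiv i)

lemma mderiv_comm (f : Hol n) (i j : Fin (n + 1)) (r : Mero f) :
    mderiv f i (mderiv f j r) = mderiv f j (mderiv f i r) := by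
  have h : ⁅mderiv f i, mderiv f j⁆ = 0 := by
    apply locDer_unique f
    intro a
    rw [Derivation.commutator_apply]
    simp only [mderiv, locDer_algebraMap, pderiv_comm i j, sub_self, Derivation.zero_apply]
  have h' := congrArg (fun D => D r) h
  simpa [Derivation.commutator_apply, sub_eq_zero] using h'

/-- The derivative `∑ vᵢ ∂ᵢ` on `𝒪(*D)` in the direction of a constant vector `v`. -/
def dirDeriv (f : Hol n) : Space n →ₗ[ℂ] Mero f →ₗ[ℂ] Mero f :=
  Fintype.linearCombination ℂ fun i => (mderiv f i : Mero f →ₗ[ℂ] Mero f)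

lemma dirDeriv_apply (f : Hol n) (v : Space n) (r : Mero f) :
    dirDeriv f v r = ∑ i, v i • mderiv f i r := by
  simp [dirDeriv, Fintype.linearCombination_apply]

/-! ### Meromorphic and logarithmic differential forms -/

/-- The module `Ω^p(*D)` of germs of meromorphic `p`-forms with poles along `D`: alternating
`p`-linear maps from the tangent space `ℂⁿ⁺¹` to `𝒪(*D)`. -/
abbrev MeroForm (f : Hol n) (p : ℕ) : Type := Space n [⋀^Fin p]→ₗ[ℂ] Mero f

instance (f : Hol n) (p : ℕ) : IsScalarTower ℂ (Hol n) (MeroForm f p) :=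
  ⟨fun c a ω => by ext v; simp⟩

/-- The bilinear map `(v, ω) ↦ ∂ω/∂v`, the directional derivative of the coefficients. -/
def formDeriv (f : Hol n) (p : ℕ) : Space n →ₗ[ℂ] MeroForm f p →ₗ[ℂ] MeroForm f p :=
  LinearMap.mk₂ ℂ (fun v ω => (dirDeriv f v).compAlternatingMap ω)
    (fun _ _ _ => by ext; simp) (fun _ _ _ => by ext; simp)
    (fun _ _ _ => by ext; simp) (fun _ _ _ => by ext; simp)

/-- The exterior derivative `d : Ω^p(*D) → Ω^{p+1}(*D)`, with
`(dω)(v₀, …, v_p) = ∑ᵢ (-1)ⁱ ∂_{vᵢ} (ω(v₀, …, v̂ᵢ, …, v_p))`. -/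
def extD (f : Hol n) (p : ℕ) : MeroForm f p →ₗ[ℂ] MeroForm f (p + 1) :=
  AlternatingMap.alternatizeUncurryFinLM ∘ₗ (formDeriv f p).flip

lemma extD_apply (f : Hol n) (p : ℕ) (ω : MeroForm f p) (v : Fin (p + 1) → Space n) :
    extD f p ω v = ∑ i : Fin (p + 1), (-1) ^ (i : ℕ) • dirDeriv f (v i) (ω (i.removeNth v)) :=
  AlternatingMap.alternatizeUncurryFin_apply _ _

lemma dirDeriv_comm (f : Hol n) (v w : Space n) (r : Mero f) :
    dirDeriv f v (dirDeriv f w r) = dirDeriv f w (dirDeriv f v r) := by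
  simp only [dirDeriv_apply, map_sum, Derivation.map_smul]
  rw [Finset.sum_comm]
  refine Finset.sum_congr rfl fun i _ => Finset.sum_congr rfl fun j _ => ?_
  rw [mderiv_comm, smul_comm]

lemma extD_extD (f : Hol n) (p : ℕ) (ω : MeroForm f p) : extD f (p + 1) (extD f p ω) = 0 := by
  let g : Space n →ₗ[ℂ] Space n →ₗ[ℂ] MeroForm f p :=
    LinearMap.mk₂ ℂ (fun v w => formDeriv f p v (formDeriv f p w ω))
      (fun _ _ _ => by simp) (fun _ _ _ => by simp) (fun _ _ _ => by simp) (fun _ _ _ => by simp)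
  have key := AlternatingMap.alternatizeUncurryFin_alternatizeUncurryFinLM_comp_of_symmetric
    (f := g) (fun v w => AlternatingMap.ext fun u => dirDeriv_comm f v w (ω u))
  rw [← key]
  ext v
  rw [extD_apply, AlternatingMap.alternatizeUncurryFin_apply]
  refine Finset.sum_congr rfl fun i _ => ?_
  congr 1
  rw [extD_apply, map_sum, LinearMap.comp_apply, AlternatingMap.alternatizeUncurryFinLM_apply,
    AlternatingMap.alternatizeUncurryFin_apply]
  refine Finset.sum_congr rfl fun j _ => ?_
  rw [map_zsmul]
  rfl

/-- The submodule `Ω^p ⊆ Ω^p(*D)` of holomorphic `p`-forms. -/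
def holForms (f : Hol n) (p : ℕ) : Submodule (Hol n) (MeroForm f p) where
  carrier := {ω | ∀ v, ω v ∈ LinearMap.range (Algebra.linearMap (Hol n) (Mero f))}
  add_mem' h1 h2 v := Submodule.add_mem _ (h1 v) (h2 v)
  zero_mem' _ := Submodule.zero_mem _
  smul_mem' a _ h v := Submodule.smul_mem _ a (h v)

/-- The submodule `Ω^p(D) = (1/f) Ω^p` of forms with at most a simple pole along `D`. -/
def simplePoleForms (f : Hol n) (p : ℕ) : Submodule (Hol n) (MeroForm f p) :=
  (holForms f p).comap (LinearMap.lsmul (Hol n) (MeroForm f p) f)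

lemma mem_simplePoleForms {f : Hol n} {p : ℕ} {ω : MeroForm f p} :
    ω ∈ simplePoleForms f p ↔ f • ω ∈ holForms f p := Iff.rfl

lemma dirDeriv_smul (f : Hol n) (v : Space n) (a : Hol n) (r : Mero f) :
    dirDeriv f v (a • r) = a • dirDeriv f v r + (∑ i, v i • pderiv i a) • r := by
  simp only [dirDeriv_apply, Finset.smul_sum, Finset.sum_smul, ← Finset.sum_add_distrib]
  refine Finset.sum_congr rfl fun i _ => ?_
  rw [Algebra.smul_def a r, Derivation.leibniz, mderiv, locDer_algebraMap, smul_add, smul_eq_mul,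
    smul_eq_mul, ← Algebra.smul_def, smul_comm, smul_assoc, mul_comm r, ← Algebra.smul_def]

/-- The module `Ω^p(log D) = Ω^p(D) ∩ d⁻¹ Ω^{p+1}(D)` of logarithmic `p`-forms along `D`. -/
def logForms (f : Hol n) (p : ℕ) : Submodule (Hol n) (MeroForm f p) where
  carrier := {ω | ω ∈ simplePoleForms f p ∧ extD f p ω ∈ simplePoleForms f (p + 1)}
  add_mem' h1 h2 := ⟨Submodule.add_mem _ h1.1 h2.1, by
    rw [map_add]; exact Submodule.add_mem _ h1.2 h2.2⟩
  zero_mem' := ⟨Submodule.zero_mem _, by rw [map_zero]; exact Submodule.zero_mem _⟩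
  smul_mem' a ω h := ⟨Submodule.smul_mem _ a h.1, fun v => by
    have e : (f • extD f p (a • ω)) v = a • (f • extD f p ω) v +
        ∑ i : Fin (p + 1), (-1) ^ (i : ℕ) •
          ((∑ j, v i j • pderiv j a) • (f • ω) (i.removeNth v)) := by
      simp only [AlternatingMap.smul_apply, extD_apply, dirDeriv_smul, smul_add,
        Finset.sum_add_distrib, Finset.smul_sum]
      congr 1
      · refine Finset.sum_congr rfl fun i _ => ?_
        rw [smul_comm _ a, smul_comm f a]
      · refine Finset.sum_congr rfl fun i _ => ?_
        rw [smul_comm f, smul_comm f]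
    change (f • extD f p (a • ω)) v ∈ _
    rw [e]
    refine Submodule.add_mem _ (Submodule.smul_mem _ a (h.2 v)) (Submodule.sum_mem _ fun i _ => ?_)
    exact zsmul_mem (Submodule.smul_mem _ _ (h.1 _)) _⟩

lemma mem_logForms {f : Hol n} {p : ℕ} {ω : MeroForm f p} :
    ω ∈ logForms f p ↔ ω ∈ simplePoleForms f p ∧ extD f p ω ∈ simplePoleForms f (p + 1) := Iff.rfl

lemma extD_mem_logForms {f : Hol n} {p : ℕ} {ω : MeroForm f p} (h : ω ∈ logForms f p) :
    extD f p ω ∈ logForms f (p + 1) :=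
  ⟨h.2, by rw [extD_extD]; exact Submodule.zero_mem _⟩

/-! ### The logarithmic de Rham complex and its cohomology -/

/-- The differential `d : Ω^p(log D) → Ω^{p+1}(log D)` of the logarithmic de Rham complex. -/
def logD (f : Hol n) (p : ℕ) : logForms f p →ₗ[ℂ] logForms f (p + 1) where
  toFun ω := ⟨extD f p ω, extD_mem_logForms ω.2⟩
  map_add' ω η := Subtype.ext (map_add (extD f p) (ω : MeroForm f p) η)
  map_smul' c ω := Subtype.ext (map_smul (extD f p) c (ω : MeroForm f p))

lemma logD_logD (f : Hol n) (p : ℕ) (ω : logForms f p) : logD f (p + 1) (logD f p ω) = 0 :=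
  Subtype.ext (extD_extD f p ω)

instance (f : Hol n) (p : ℕ) : AddCommGroup (logForms f p) :=
  { (inferInstance : AddCommMonoid (logForms f p)), (inferInstance : AddCommGroup (logForms f p)) with }

/-- The closed logarithmic `p`-forms. -/
def logCocycles (f : Hol n) (p : ℕ) : Submodule ℂ (logForms f p) := LinearMap.ker (logD f p)

/-- The exact logarithmic `p`-forms, that is, the image of `d : Ω^{p-1}(log D) → Ω^p(log D)`, which
is zero if `p = 0`. -/
def logCoboundaries (f : Hol n) : (p : ℕ) → Submodule ℂ (logForms f p)
  | 0 => ⊥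
  | p + 1 => LinearMap.range (logD f p)

/-- The (stalk at the origin of the) cohomology `ℋ^p(Ω^•(log D))`. -/
abbrev LogCohomology (f : Hol n) (p : ℕ) : Type :=
  logCocycles f p ⧸ (logCoboundaries f p).submoduleOf (logCocycles f p)

/-- The class in `ℋ^p(Ω^•(log D))` of a closed logarithmic `p`-form. -/
def logClass (f : Hol n) (p : ℕ) : logCocycles f p →ₗ[ℂ] LogCohomology f p :=
  Submodule.mkQ _

/-- The volume form `dx = dx₀ ∧ ⋯ ∧ dxₙ`. -/
def volForm (f : Hol n) : MeroForm f (n + 1) :=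
  (Algebra.linearMap ℂ (Mero f)).compAlternatingMap (Pi.basisFun ℂ (Fin (n + 1))).det

/-- The form `u dx / f`. -/
def volOver (f u : Hol n) : MeroForm f (n + 1) :=
  (IsLocalization.mk' (Mero f) u (⟨f, Submonoid.mem_powers f⟩ : Submonoid.powers f)) • volForm f

lemma form_eq_zero_of_top (f : Hol n) (ω : MeroForm f (n + 2)) : ω = 0 := by
  refine Module.Basis.ext_alternating (Pi.basisFun ℂ (Fin (n + 1))) fun v hv => ?_
  have := Fintype.card_le_of_injective v hv
  simp at this

lemma volOver_mem (f u : Hol n) : volOver f u ∈ logForms f (n + 1) := by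
  refine ⟨fun v => ⟨((Pi.basisFun ℂ (Fin (n + 1))).det v) • u, ?_⟩, ?_⟩
  · have h : f • IsLocalization.mk' (Mero f) u (⟨f, Submonoid.mem_powers f⟩ : Submonoid.powers f) =
        algebraMap (Hol n) (Mero f) u := by
      rw [Algebra.smul_def]
      exact IsLocalization.mk'_spec' (Mero f) u ⟨f, Submonoid.mem_powers f⟩
    change _ = f • (IsLocalization.mk' (Mero f) u (⟨f, Submonoid.mem_powers f⟩ :
      Submonoid.powers f) • algebraMap ℂ (Mero f) ((Pi.basisFun ℂ (Fin (n + 1))).det v))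
    rw [← smul_assoc, h, Algebra.linearMap_apply, Algebra.smul_def, map_mul,
      ← IsScalarTower.algebraMap_apply, smul_eq_mul, mul_comm]
  · rw [form_eq_zero_of_top f (extD f (n + 1) (volOver f u))]
    exact Submodule.zero_mem _

/-- The form `u dx / f` as a closed logarithmic `(n+1)`-form. -/
def volCocycle (f u : Hol n) : logCocycles f (n + 1) :=
  ⟨⟨volOver f u, volOver_mem f u⟩, Subtype.ext (form_eq_zero_of_top f _)⟩

end LogSing

end

/-! A logarithmic `n`-form is the contraction of `dx / f` with a holomorphic vector field `η`; being
logarithmic means `η f = h f` for some `h`, and then `dω = (div η - h) dx / f`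
(`exists_vectorField_of_mem_logForms`). Both claims follow once `div η - h` is known to vanish at
`0` for all such `η`. The contrapositive is proved (`value_eq_divergence`): a field with `h(0) ≠ div
η(0)` forces `f` to be quasihomogeneous.

Because the singularity is isolated, the Tjurina ideal contains a power of `𝔪`
(`exists_pow_le_tjurina`, a form of Rückert's Nullstellensatz obtained from Weierstrass division and
resultants). Hence `η` vanishes at `0`, and `f` is finitely determined. The second fact avoids any
convergent normal form for `η`: it suffices to work in the finite-dimensional space `𝒪 / 𝔪^N`. The
generalized eigenspaces of `η` there behave like a grading. Some coordinates are generalized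
eigenvectors, with complex eigenvalues `wᵢ` whose sum is the trace of the linear part of `η`, that
is, `div η(0)`. A unit multiple of `f` is a generalized eigenvector for `c = h(0)`, hence modulo
`𝔪^N` a polynomial that is weighted homogeneous of degree `c`. Finite determinacy
(`exists_coordinate_change`, an application of the implicit function theorem) turns the congruence
into an equality up to a unit and a change of coordinates (`exists_complex_weights`).

The complex weights must become positive integers. The splitting lemma `exists_splitting` separates
a nondegenerate quadratic form in variables `P`, whose weights sum to `|P| c / 2`, from a polynomial
`g` of order at least three in the others. As `c ≠ ∑ wᵢ`, some `ℚ`-linear `φ : ℂ → ℚ` has `φ (c - ∑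
wᵢ) ≠ 0`. An isolated singularity contains a monomial `xᵢᵃ x_k` for every `i`, here with `a ≥ 2`
outside `P`, so `a φ(wᵢ) + φ(w_k) = φ(c)`. If `φ(c)` were `0`, these relations would give `φ(wᵢ) =
0` outside `P`, and then `φ (c - ∑ wᵢ) = 0`. So one may divide by `φ(c)`, and the relations make the
weights positive (`isQuasihomogeneous_of_complex_weights`). -/

noncomputable section

namespace LogSing

/-! ### Analyticity of composition operators on spaces of continuous functions -/

section Superposition

variable {K E F : Type*} [TopologicalSpace K] [CompactSpace K] [NormedAddCommGroup E]
  [NormedSpace ℂ E] [NormedAddCommGroup F] [NormedSpace ℂ F]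

/-- The multilinear map on spaces of continuous functions obtained by applying `p` pointwise. -/
def pointwiseMultilinear (K : Type*) [TopologicalSpace K] [CompactSpace K] {k : ℕ}
    (p : E [×k]→L[ℂ] F) : C(K, E) [×k]→L[ℂ] C(K, F) :=
  MultilinearMap.mkContinuous
    { toFun := fun u => ⟨fun x => p fun i => u i x, by fun_prop⟩
      map_update_add' := by
        intro _ u i a b
        ext x
        have h : ∀ c : C(K, E), (fun j => (Function.update u i c) j x) =
            Function.update (fun j => u j x) i (c x) := fun c => by
          ext j
          by_cases hj : j = i
          · subst hj; simp
          · simp [hj]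
        simp [h]
      map_update_smul' := by
        intro _ u i a b
        ext x
        have h : ∀ c : C(K, E), (fun j => (Function.update u i c) j x) =
            Function.update (fun j => u j x) i (c x) := fun c => by
          ext j
          by_cases hj : j = i
          · subst hj; simp
          · simp [hj]
        simp [h] } ‖p‖ (by
    intro u
    rw [ContinuousMap.norm_le _ (by positivity)]
    intro x
    refine (p.le_opNorm _).trans ?_
    exact mul_le_mul_of_nonneg_left
      (Finset.prod_le_prod (fun _ _ => norm_nonneg _) fun i _ => (u i).norm_coe_le_norm x)
      (norm_nonneg _))

lemma norm_pointwiseMultilinear_le {k : ℕ} (p : E [×k]→L[ℂ] F) :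
    ‖pointwiseMultilinear K p‖ ≤ ‖p‖ :=
  MultilinearMap.mkContinuous_norm_le _ (norm_nonneg _) _

/-- If `f` has a convergent power series on a ball about `0`, then `u ↦ f ∘ u` is given by a
convergent power series on the corresponding ball of continuous functions. -/
lemma exists_superposition [CompleteSpace F] {f : E → F} {p : FormalMultilinearSeries ℂ E F}
    {r : ENNReal} (hf : HasFPowerSeriesOnBall f p 0 r) :
    ∃ G : C(K, E) → C(K, F), AnalyticOnNhd ℂ G (Metric.eball 0 r) ∧
      ∀ u ∈ Metric.eball (0 : C(K, E)) r, ∀ x, G u x = f (u x) := by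
  -- Applying each term of `p` pointwise does not increase norms, so the radius of convergence does
  -- not shrink.
  let q : FormalMultilinearSeries ℂ C(K, E) C(K, F) := fun k => pointwiseMultilinear K (p k)
  have hq : r ≤ q.radius := hf.r_le.trans
    (FormalMultilinearSeries.radius_le_of_le fun {k} => norm_pointwiseMultilinear_le (p k))
  have hG : HasFPowerSeriesOnBall q.sum q 0 r :=
    (q.hasFPowerSeriesOnBall (hf.r_pos.trans_le hq)).mono hf.r_pos hq
  refine ⟨q.sum, hG.analyticOnNhd, fun u hu x => ?_⟩
  have h1 := q.hasSum (Metric.eball_subset_eball hq hu)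
  have h2 := h1.mapL (ContinuousMap.evalCLM ℂ x)
  have h3 : u x ∈ Metric.eball (0 : E) r := by
    simp only [Metric.mem_eball, edist_zero_right] at hu ⊢
    refine lt_of_le_of_lt ?_ hu
    exact enorm_le_iff_norm_le.2 (u.norm_coe_le_norm x)
  have h4 := hf.hasSum h3
  rw [zero_add] at h4
  exact h2.unique h4

end Superposition

/-! ### Division by a generic monic polynomial -/

section Division

lemma continuousOn_extend_sphere {r : ℝ} (u : C(Metric.sphere (0 : ℂ) r, ℂ)) :
    ContinuousOn (Function.extend Subtype.val u 0) (Metric.sphere (0 : ℂ) r) := by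
  rw [continuousOn_iff_continuous_domRestrict]
  convert u.continuous using 1
  ext x
  exact Subtype.val_injective.extend_apply u 0 x

/-- The Cauchy integral over a circle about the origin, as a functional on continuous functions. -/
lemma exists_cauchy_functional {r : ℝ} (hr : 0 < r) :
    ∃ Λ : C(Metric.sphere (0 : ℂ) r, ℂ) →L[ℂ] ℂ, ∀ (f : ℂ → ℂ) (w : ℂ)
      (v : C(Metric.sphere (0 : ℂ) r, ℂ)), DifferentiableOn ℂ f (Metric.closedBall 0 r) →
      w ∈ Metric.ball (0 : ℂ) r → (∀ ζ, v ζ = ((ζ : ℂ) - w)⁻¹ * f ζ) → Λ v = f w := by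
  have hci : ∀ u : C(Metric.sphere (0 : ℂ) r, ℂ),
      CircleIntegrable (Function.extend Subtype.val u 0) 0 r := fun u =>
    (continuousOn_extend_sphere u).circleIntegrable hr.le
  have hval : ∀ (u : C(Metric.sphere (0 : ℂ) r, ℂ)) (z : ℂ) (hz : z ∈ Metric.sphere (0 : ℂ) r),
      Function.extend Subtype.val u 0 z = u ⟨z, hz⟩ := fun u z hz =>
    Subtype.val_injective.extend_apply u 0 ⟨z, hz⟩
  let Λ₀ : C(Metric.sphere (0 : ℂ) r, ℂ) →ₗ[ℂ] ℂ :=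
    { toFun := fun u => (2 * Real.pi * Complex.I : ℂ)⁻¹ •
        ∮ z in C(0, r), Function.extend Subtype.val u 0 z
      map_add' := fun u v => by
        rw [← smul_add, ← circleIntegral.integral_add (hci u) (hci v)]
        congr 1
        refine circleIntegral.integral_congr hr.le fun z hz => ?_
        change Function.extend Subtype.val (⇑(u + v)) 0 z =
          Function.extend Subtype.val (⇑u) 0 z + Function.extend Subtype.val (⇑v) 0 z
        rw [hval _ z hz, hval _ z hz, hval _ z hz]
        rfl
      map_smul' := fun c u => by
        rw [RingHom.id_apply, smul_comm c, ← circleIntegral.integral_smul c]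
        congr 1
        refine circleIntegral.integral_congr hr.le fun z hz => ?_
        change Function.extend Subtype.val (⇑(c • u)) 0 z = c • Function.extend Subtype.val (⇑u) 0 z
        rw [hval _ z hz, hval _ z hz]
        rfl }
  refine ⟨Λ₀.mkContinuous r fun u => ?_, fun f w v hf hw hv => ?_⟩
  · exact circleIntegral.norm_two_pi_i_inv_smul_integral_le_of_norm_le_const hr.le fun z hz => by
      rw [hval u z hz]; exact u.norm_coe_le_norm _
  · have key := Complex.two_pi_I_inv_smul_circleIntegral_sub_inv_smul_of_differentiable_on_off_countable
      (s := ∅) Set.countable_empty hw hf.continuousOn (fun x hx =>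
        (hf x (Metric.ball_subset_closedBall hx.1)).differentiableAt
          (Metric.closedBall_mem_nhds_of_mem hx.1))
    rw [← key]
    change (2 * Real.pi * Complex.I : ℂ)⁻¹ • (∮ z in C(0, r), Function.extend Subtype.val v 0 z) = _
    congr 1
    refine circleIntegral.integral_congr hr.le fun z hz => ?_
    simp [hval _ z hz, hv]

/-- The restriction of a holomorphic function of `(x, ζ)` to a small circle in the `ζ`-direction
depends analytically on `x`. -/
lemma exists_circle_restriction {E : Type*} [NormedAddCommGroup E] [NormedSpace ℂ E]
    [FiniteDimensional ℂ E] {F : E × ℂ → ℂ} (hF : AnalyticAt ℂ F 0) :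
    ∃ r : ℝ, 0 < r ∧ ∃ G : E → C(Metric.sphere (0 : ℂ) r, ℂ), AnalyticAt ℂ G 0 ∧
      ∀ᶠ x in 𝓝 (0 : E), (∀ ζ, G x ζ = F (x, (ζ : ℂ))) ∧
        DifferentiableOn ℂ (fun ζ => F (x, ζ)) (Metric.closedBall 0 r) := by
  obtain ⟨p, R, hp⟩ := hF
  obtain ⟨r, hr0, hrR⟩ := ENNReal.lt_iff_exists_nnreal_btwn.1 hp.r_pos
  have hr : (0 : ℝ) < r := by exact_mod_cast hr0
  obtain ⟨H, hH, hHv⟩ := exists_superposition (K := Metric.sphere (0 : ℂ) (r : ℝ)) hp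
  -- The map sending `x` to the loop `ζ ↦ (x, ζ)` is affine, hence analytic; composing it with
  -- superposition by `F` gives the restriction.
  let i₀ : C(Metric.sphere (0 : ℂ) (r : ℝ), E × ℂ) := ⟨fun ζ => (0, (ζ : ℂ)), by fun_prop⟩
  let L : E →ₗ[ℂ] C(Metric.sphere (0 : ℂ) (r : ℝ), E × ℂ) :=
    { toFun := fun x => ContinuousMap.const _ (x, 0)
      map_add' := fun x y => by ext <;> simp
      map_smul' := fun c x => by ext <;> simp }
  let i : E → C(Metric.sphere (0 : ℂ) (r : ℝ), E × ℂ) := fun x => L.toContinuousLinearMap x + i₀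
  have hi : AnalyticAt ℂ i 0 := (L.toContinuousLinearMap.analyticAt 0).add analyticAt_const
  have hi0 : i 0 = i₀ := by simp [i]
  have hiv : ∀ x ζ, i x ζ = (x, (ζ : ℂ)) := fun x ζ => by simp [i, L, i₀]
  have hmem : i 0 ∈ Metric.eball (0 : C(Metric.sphere (0 : ℂ) (r : ℝ), E × ℂ)) R := by
    rw [Metric.mem_eball, edist_zero_right, hi0]
    refine lt_of_le_of_lt ?_ hrR
    have : ‖i₀‖ ≤ r := (ContinuousMap.norm_le _ r.2).2 fun ζ => by
      have h2 : ‖(ζ : ℂ)‖ = r := by simp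
      simp [i₀, Prod.norm_def, h2]
    rw [← ofReal_norm]
    exact (ENNReal.ofReal_le_ofReal this).trans (by simp)
  refine ⟨r, hr, H ∘ i, (hH _ hmem).comp hi, ?_⟩
  have hev : ∀ᶠ x in 𝓝 (0 : E), i x ∈ Metric.eball (0 : C(_, E × ℂ)) R :=
    hi.continuousAt.eventually (Metric.isOpen_eball.mem_nhds hmem)
  have hev2 : ∀ᶠ x in 𝓝 (0 : E), x ∈ Metric.eball (0 : E) R := Metric.eball_mem_nhds _ hp.r_pos
  filter_upwards [hev, hev2] with x hx hx2
  refine ⟨fun ζ => by rw [Function.comp_apply, hHv _ hx, hiv], fun ζ hζ => ?_⟩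
  have h1 : (x, ζ) ∈ Metric.eball (0 : E × ℂ) R := by
    rw [Metric.mem_eball, Prod.edist_eq, max_lt_iff]
    refine ⟨hx2, lt_of_le_of_lt ?_ hrR⟩
    have : ‖ζ‖ ≤ r := by simpa using hζ
    change edist ζ 0 ≤ _
    rw [edist_zero_right, ← ofReal_norm]
    exact (ENNReal.ofReal_le_ofReal this).trans (by simp)
  have h2 : DifferentiableAt ℂ F (x, ζ) := (hp.analyticOnNhd _ h1).differentiableAt
  exact (h2.comp ζ (by fun_prop : DifferentiableAt ℂ (fun ζ : ℂ => (x, ζ)) ζ)).differentiableWithinAt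

/-- The monic polynomial `z ^ d + ∑ i < d, c i * z ^ i`. -/
def monicPoly {d : ℕ} (c : Fin d → ℂ) (z : ℂ) : ℂ := z ^ d + ∑ i, c i * z ^ (i : ℕ)

/-- Division of a holomorphic function by the generic monic polynomial of degree `d`. -/
lemma exists_generic_division {E : Type*} [NormedAddCommGroup E] [NormedSpace ℂ E]
    [FiniteDimensional ℂ E] {F : E × ℂ → ℂ} (hF : AnalyticAt ℂ F 0) (d : ℕ) :
    ∃ (Q : (E × (Fin d → ℂ)) × ℂ → ℂ) (R : Fin d → E × (Fin d → ℂ) → ℂ),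
      AnalyticAt ℂ Q 0 ∧ (∀ i, AnalyticAt ℂ (R i) 0) ∧
      ∀ᶠ w in 𝓝 (0 : (E × (Fin d → ℂ)) × ℂ),
        F (w.1.1, w.2) = Q w * monicPoly w.1.2 w.2 + ∑ i, R i w.1 * w.2 ^ (i : ℕ) := by
  obtain ⟨r, hr, G, hG, hGv⟩ := exists_circle_restriction hF
  obtain ⟨Λ, hΛ⟩ := exists_cauchy_functional hr
  let Z : C(Metric.sphere (0 : ℂ) r, ℂ) := ⟨fun ζ => ζ, continuous_subtype_val⟩
  have hZu : ∀ w ∈ Metric.ball (0 : ℂ) r, IsUnit (Z - algebraMap ℂ _ w) := fun w hw => by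
    rw [ContinuousMap.isUnit_iff_forall_ne_zero]
    intro ζ h
    have h1 : (ζ : ℂ) = w := by simpa [Z, sub_eq_zero] using h
    have h2 : ‖(ζ : ℂ)‖ = r := by simp
    rw [h1] at h2
    simp only [Metric.mem_ball, dist_zero_right] at hw
    exact hw.ne h2
  have hZ0 : IsUnit Z := by simpa using hZu 0 (Metric.mem_ball_self hr)
  let P : (Fin d → ℂ) → C(Metric.sphere (0 : ℂ) r, ℂ) := fun c => Z ^ d + ∑ i, c i • Z ^ (i : ℕ)
  have hP : AnalyticAt ℂ P 0 := by
    refine analyticAt_const.add ?_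
    refine Finset.analyticAt_fun_sum _ fun i _ => ?_
    exact ((ContinuousLinearMap.proj (R := ℂ) (φ := fun _ : Fin d => ℂ) i).analyticAt 0).smul
      analyticAt_const
  have hP0 : IsUnit (P 0) := by simpa [P] using hZ0.pow d
  have hPv : ∀ c ζ, P c ζ = monicPoly c (ζ : ℂ) := fun c ζ => by
    simp [P, monicPoly, Z, ContinuousMap.sum_apply]
  -- the quotient `F / P` on the circle
  let q : E × (Fin d → ℂ) → C(Metric.sphere (0 : ℂ) r, ℂ) := fun v =>
    G v.1 * Ring.inverse (P v.2)
  have hq : AnalyticAt ℂ q 0 := by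
    have h1 : AnalyticAt ℂ (fun v : E × (Fin d → ℂ) => G v.1) 0 := hG.comp_of_eq analyticAt_fst rfl
    have h2 : AnalyticAt ℂ (fun v : E × (Fin d → ℂ) => P v.2) 0 := hP.comp_of_eq analyticAt_snd rfl
    exact h1.mul ((analyticOnNhd_inverse _ hP0).comp_of_eq h2 rfl)
  -- the quotient of the difference of two values of the polynomial
  let D : Fin d → (Fin d → ℂ) → C(Metric.sphere (0 : ℂ) r, ℂ) := fun i c =>
    Z ^ (d - 1 - i) + ∑ j : Fin d, if i < j then c j • Z ^ ((j : ℕ) - 1 - i) else 0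
  have hD : ∀ i, AnalyticAt ℂ (D i) 0 := fun i => by
    refine analyticAt_const.add ?_
    refine Finset.analyticAt_fun_sum _ fun j _ => ?_
    split_ifs
    · exact ((ContinuousLinearMap.proj (R := ℂ) (φ := fun _ : Fin d => ℂ) j).analyticAt 0).smul
        analyticAt_const
    · exact analyticAt_const
  -- The difference quotient of the polynomial at `ζ` and `z` is a polynomial in `z` of degree less
  -- than `d`; its coefficients `D i c` are functions of `ζ`.
  have hDv : ∀ (c : Fin d → ℂ) (z : ℂ), P c = algebraMap ℂ _ (monicPoly c z) +
      (Z - algebraMap ℂ _ z) * ∑ i : Fin d, z ^ (i : ℕ) • D i c := by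
    intro c z
    ext ζ
    have hgeom : ∀ k : ℕ, (ζ : ℂ) ^ k - z ^ k =
        ((ζ : ℂ) - z) * ∑ i ∈ Finset.range k, z ^ i * (ζ : ℂ) ^ (k - 1 - i) := fun k => by
      rw [← neg_sub (z ^ k), ← (Commute.all z (ζ : ℂ)).mul_geom_sum₂ k]; ring
    have hsum : (∑ i : Fin d, z ^ (i : ℕ) • D i c) ζ =
        ∑ i ∈ Finset.range d, z ^ i * (ζ : ℂ) ^ (d - 1 - i) +
          ∑ j : Fin d, c j * ∑ i ∈ Finset.range j, z ^ i * (ζ : ℂ) ^ ((j : ℕ) - 1 - i) := by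
      simp only [D, ContinuousMap.sum_apply, ContinuousMap.smul_apply, ContinuousMap.add_apply,
        ContinuousMap.pow_apply, smul_eq_mul, mul_add, Finset.sum_add_distrib, Finset.mul_sum]
      congr 1
      · rw [Finset.sum_range]; rfl
      · rw [Finset.sum_comm]
        refine Finset.sum_congr rfl fun j _ => ?_
        have hs : Finset.range (j : ℕ) = (Finset.range d).filter (· < (j : ℕ)) := by
          ext k
          have := j.2
          simp only [Finset.mem_range, Finset.mem_filter]
          omega
        rw [hs, Finset.sum_filter, Finset.sum_range]
        refine Finset.sum_congr rfl fun i _ => ?_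
        by_cases h : i < j
        · have h' : (i : ℕ) < j := h
          simp only [h, h', if_true, ContinuousMap.smul_apply, ContinuousMap.pow_apply, smul_eq_mul]
          simp only [Z, ContinuousMap.coe_mk]
          ring
        · have h' : ¬ (i : ℕ) < j := h
          simp [h, h']
    have hb : ((Z - algebraMap ℂ _ z) * ∑ i : Fin d, z ^ (i : ℕ) • D i c) ζ =
        ((ζ : ℂ) - z) * (∑ i : Fin d, z ^ (i : ℕ) • D i c) ζ := by
      simp [Z]
    rw [hPv, ContinuousMap.add_apply, hb, hsum, mul_add, ← hgeom]
    have : ∀ j : Fin d, ((ζ : ℂ) - z) * (c j * ∑ i ∈ Finset.range j, z ^ i * (ζ : ℂ) ^ ((j : ℕ) - 1 - i))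
        = c j * (ζ : ℂ) ^ (j : ℕ) - c j * z ^ (j : ℕ) := fun j => by
      rw [mul_left_comm, ← hgeom]; ring
    rw [Finset.mul_sum, Finset.sum_congr rfl fun j _ => this j, Finset.sum_sub_distrib]
    simp [monicPoly]
    ring
  -- Multiply `hDv` by `q / (ζ - z)` and integrate: the left side is the Cauchy formula for `F`, the
  -- first term on the right is the quotient times the polynomial, and the difference quotient gives
  -- a remainder of degree less than `d` in `z`.
  refine ⟨fun w => Λ (q w.1 * Ring.inverse (Z - algebraMap ℂ _ w.2)),
    fun i v => Λ (q v * D i v.2), ?_, ?_, ?_⟩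
  · have h1 : AnalyticAt ℂ (fun w : (E × (Fin d → ℂ)) × ℂ => q w.1) 0 :=
      hq.comp_of_eq analyticAt_fst rfl
    have h2 : AnalyticAt ℂ (fun w : (E × (Fin d → ℂ)) × ℂ =>
        Z - algebraMap ℂ C(Metric.sphere (0 : ℂ) r, ℂ) w.2) 0 :=
      analyticAt_const.sub (((Algebra.linearMap ℂ
        C(Metric.sphere (0 : ℂ) r, ℂ)).toContinuousLinearMap.analyticAt _).comp_of_eq
          analyticAt_snd rfl)
    refine (Λ.analyticAt _).comp (h1.mul ((analyticOnNhd_inverse _ ?_).comp_of_eq h2 rfl))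
    exact hZu 0 (Metric.mem_ball_self hr)
  · intro i
    exact (Λ.analyticAt _).comp (hq.mul ((hD i).comp_of_eq analyticAt_snd rfl))
  · have e1 : ∀ᶠ w in 𝓝 (0 : (E × (Fin d → ℂ)) × ℂ), IsUnit (P w.1.2) := by
      have hc : ContinuousAt (fun w : (E × (Fin d → ℂ)) × ℂ => P w.1.2) 0 :=
        hP.continuousAt.comp_of_eq (by fun_prop) rfl
      exact hc.eventually (Units.isOpen.mem_nhds hP0)
    have e2 : ∀ᶠ w in 𝓝 (0 : (E × (Fin d → ℂ)) × ℂ), w.2 ∈ Metric.ball (0 : ℂ) r :=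
      (continuous_snd.tendsto (0 : (E × (Fin d → ℂ)) × ℂ)).eventually (Metric.ball_mem_nhds _ hr)
    have e3 := ((continuous_fst.comp continuous_fst).tendsto
      (0 : (E × (Fin d → ℂ)) × ℂ)).eventually hGv
    filter_upwards [e1, e2, e3] with w h1 h2 h3
    have hGq : G w.1.1 = q w.1 * P w.1.2 := by
      simp only [q]
      rw [mul_assoc, Ring.inverse_mul_cancel _ h1, mul_one]
    have hu := hZu _ h2
    have hF' : Λ (G w.1.1 * Ring.inverse (Z - algebraMap ℂ _ w.2)) = F (w.1.1, w.2) := by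
      refine hΛ (fun ζ => F (w.1.1, ζ)) w.2 _ h3.2 h2 fun ζ => ?_
      have hinv := congrArg (fun u : C(Metric.sphere (0 : ℂ) r, ℂ) => u ζ) (Ring.mul_inverse_cancel _ hu)
      have hζ : (ζ : ℂ) - w.2 ≠ 0 := fun h => by simp [Z, h] at hinv
      have h5 : Ring.inverse (Z - algebraMap ℂ _ w.2) ζ = ((ζ : ℂ) - w.2)⁻¹ :=
        eq_inv_of_mul_eq_one_right (by simpa [Z] using hinv)
      rw [ContinuousMap.mul_apply, h5, mul_comm]
      exact congrArg _ (h3.1 ζ)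
    rw [← hF', hGq, hDv w.1.2 w.2]
    have hexp : q w.1 * (algebraMap ℂ _ (monicPoly w.1.2 w.2) +
        (Z - algebraMap ℂ _ w.2) * ∑ i : Fin d, w.2 ^ (i : ℕ) • D i w.1.2) *
          Ring.inverse (Z - algebraMap ℂ _ w.2) =
        monicPoly w.1.2 w.2 • (q w.1 * Ring.inverse (Z - algebraMap ℂ _ w.2)) +
          ∑ i : Fin d, w.2 ^ (i : ℕ) • (q w.1 * D i w.1.2) := by
      have hc := Ring.mul_inverse_cancel _ hu
      have : ∑ i : Fin d, w.2 ^ (i : ℕ) • (q w.1 * D i w.1.2) =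
          q w.1 * ∑ i : Fin d, w.2 ^ (i : ℕ) • D i w.1.2 := by
        rw [Finset.mul_sum]
        simp
      rw [this, Algebra.smul_def]
      linear_combination (q w.1 * ∑ i : Fin d, w.2 ^ (i : ℕ) • D i w.1.2) * hc
    rw [hexp, map_add, map_smul, map_sum, smul_eq_mul, mul_comm]
    congr 1
    refine Finset.sum_congr rfl fun i _ => ?_
    rw [map_smul, smul_eq_mul, mul_comm]

end Division

/-! ### Weierstrass preparation and division -/

section Preparation

/-- Once the lower coefficients vanish, dividing by `z ^ i` and letting `z → 0` isolates `a i`,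
while the right side still has the factor `z ^ (d - i)`. Only continuity of `k` is needed. -/
lemma eq_zero_of_sum_eq_mul_pow {d : ℕ} {a : Fin d → ℂ} {k : ℂ → ℂ} (hk : ContinuousAt k 0)
    (h : ∀ᶠ z in 𝓝 (0 : ℂ), ∑ i, a i * z ^ (i : ℕ) = k z * z ^ d) : a = 0 := by
  suffices H : ∀ m : ℕ, ∀ i : Fin d, (i : ℕ) = m → a i = 0 from funext fun i => H i i rfl
  intro m
  induction m using Nat.strong_induction_on with
  | _ m ih =>
    intro i hi
    have hT : ContinuousAt (fun z : ℂ =>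
        a i + z * ∑ j : Fin d, (if i < j then a j * z ^ ((j : ℕ) - i - 1) else 0)) 0 := by
      refine continuousAt_const.add (continuousAt_id.mul ?_)
      refine tendsto_finsetSum _ fun j _ => ?_
      split_ifs
      · exact ((continuous_const.mul (continuous_pow _)).tendsto _)
      · exact tendsto_const_nhds
    have hK : ContinuousAt (fun z : ℂ => k z * z ^ (d - i)) 0 :=
      hk.mul (continuous_pow _).continuousAt
    have hev : (fun z : ℂ => a i + z * ∑ j : Fin d,
        (if i < j then a j * z ^ ((j : ℕ) - i - 1) else 0)) =ᶠ[𝓝[≠] 0]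
        fun z : ℂ => k z * z ^ (d - i) := by
      filter_upwards [h.filter_mono nhdsWithin_le_nhds, self_mem_nhdsWithin] with z hz hz0
      have hz0 : z ≠ 0 := hz0
      apply mul_left_cancel₀ (pow_ne_zero (i : ℕ) hz0)
      have e : z ^ (i : ℕ) * (k z * z ^ (d - i)) = k z * z ^ d := by
        rw [mul_left_comm, ← pow_add, Nat.add_sub_cancel' i.2.le]
      have e2 : z ^ (i : ℕ) * a i = ∑ j, if j = i then z ^ (i : ℕ) * a i else 0 := by simp
      rw [e, ← hz, mul_add, Finset.mul_sum, Finset.mul_sum, e2, ← Finset.sum_add_distrib]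
      refine Finset.sum_congr rfl fun j _ => ?_
      rcases lt_trichotomy i j with hij | hij | hij
      · rw [if_pos hij, if_neg hij.ne', zero_add]
        have : (j : ℕ) = i + (1 + ((j : ℕ) - i - 1)) := by
          have : (i : ℕ) < j := hij
          omega
        conv_rhs => rw [this, pow_add, pow_add, pow_one]
        ring
      · subst hij
        simp [mul_comm]
      · rw [if_neg hij.asymm, if_neg hij.ne, ih j (hi ▸ hij) j rfl]
        simp
    have := tendsto_nhds_unique ((hT.tendsto.mono_left nhdsWithin_le_nhds).congr' hev)
      (hK.tendsto.mono_left nhdsWithin_le_nhds)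
    simpa [Nat.sub_ne_zero_of_lt i.2] using this

/-- The Weierstrass preparation and division theorems. -/
theorem exists_weierstrass {E : Type*} [NormedAddCommGroup E] [NormedSpace ℂ E]
    [FiniteDimensional ℂ E] {g : E × ℂ → ℂ} (hg : AnalyticAt ℂ g 0)
    (hg0 : ¬ ∀ᶠ z in 𝓝 (0 : ℂ), g (0, z) = 0) :
    ∃ (d : ℕ) (c : E → Fin d → ℂ), AnalyticAt ℂ c 0 ∧ c 0 = 0 ∧
      (∃ q : E × ℂ → ℂ, AnalyticAt ℂ q 0 ∧ q 0 ≠ 0 ∧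
        ∀ᶠ w in 𝓝 (0 : E × ℂ), g w = q w * monicPoly (c w.1) w.2) ∧
      ∀ F : E × ℂ → ℂ, AnalyticAt ℂ F 0 → ∃ (q : E × ℂ → ℂ) (r : Fin d → E → ℂ),
        AnalyticAt ℂ q 0 ∧ (∀ i, AnalyticAt ℂ (r i) 0) ∧
        ∀ᶠ w in 𝓝 (0 : E × ℂ), F w = q w * monicPoly (c w.1) w.2 +
          ∑ i, r i w.1 * w.2 ^ (i : ℕ) := by
  have := FiniteDimensional.complete ℂ E
  have hgz : AnalyticAt ℂ (fun z : ℂ => g (0, z)) 0 :=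
    hg.comp_of_eq (analyticAt_const.prod analyticAt_id) rfl
  obtain ⟨d, h, hh, hh0, hgh⟩ := (hgz.exists_eventuallyEq_pow_smul_nonzero_iff).2 hg0
  -- Divide `g` by the polynomial with free coefficients `c`. Preparation amounts to choosing `c(x)`
  -- so that the remainder `R i (x, c(x))` vanishes.
  obtain ⟨Q, R, hQ, hR, hQR⟩ := exists_generic_division hg d
  -- values at the origin
  have hcont : ContinuousAt (fun z : ℂ => ((0 : E × (Fin d → ℂ)), z)) 0 := by fun_prop
  have hQz : ContinuousAt (fun z : ℂ => Q (0, z)) 0 := hQ.continuousAt.comp_of_eq hcont rfl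
  have h0 : ∀ᶠ z in 𝓝 (0 : ℂ), ∑ i, R i 0 * z ^ (i : ℕ) = (h z - Q (0, z)) * z ^ d := by
    filter_upwards [hgh, hcont.eventually hQR] with z h1 h2
    simp only [Prod.fst_zero, Prod.snd_zero, h1, sub_zero, smul_eq_mul, monicPoly,
      Pi.zero_apply, zero_mul, Finset.sum_const_zero, add_zero] at h2
    linear_combination -h2
  have hR0 : (fun i => R i 0) = 0 := eq_zero_of_sum_eq_mul_pow (hh.continuousAt.sub hQz) h0
  have hQ0 : Q 0 ≠ 0 := by
    have hev : (fun z : ℂ => h z) =ᶠ[𝓝[≠] 0] fun z => Q (0, z) := by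
      filter_upwards [h0.filter_mono nhdsWithin_le_nhds, self_mem_nhdsWithin] with z hz hz0
      have hz0 : z ≠ 0 := hz0
      have hz' : (0 : ℂ) = (h z - Q (0, z)) * z ^ d := by
        rw [← hz]
        exact (Finset.sum_eq_zero fun i _ => by rw [show R i 0 = 0 from congrFun hR0 i,
          zero_mul]).symm
      have := (mul_eq_zero.1 hz'.symm).resolve_right (pow_ne_zero _ hz0)
      exact sub_eq_zero.1 this
    have := tendsto_nhds_unique ((hh.continuousAt.tendsto.mono_left nhdsWithin_le_nhds).congr' hev)
      (hQz.tendsto.mono_left nhdsWithin_le_nhds)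
    rw [this] at hh0
    exact hh0
  -- the implicit function
  let Φ : E × (Fin d → ℂ) → Fin d → ℂ := fun v i => R i v
  have hΦ : AnalyticAt ℂ Φ 0 := analyticAt_pi_iff.2 hR
  have hΦ0 : Φ 0 = 0 := hR0
  -- Differentiate the division identity at `x = 0`, `c = 0` in the direction `v`. If the derivative
  -- of the remainder is zero, then `Q ∑ vᵢ zⁱ` is a multiple of `z ^ d`; as `Q 0 ≠ 0`, this forces
  -- `v = 0`.
  have hinj : Function.Injective
      (fderiv ℂ Φ 0 ∘L ContinuousLinearMap.inr ℂ E (Fin d → ℂ)) := by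
    rw [injective_iff_map_eq_zero]
    intro v hv
    have hRv : ∀ i, fderiv ℂ (R i) 0 (0, v) = 0 := fun i => by
      have h1 := congrFun hv i
      have h2 : HasFDerivAt (R i) ((ContinuousLinearMap.proj i).comp (fderiv ℂ Φ 0)) 0 :=
        (hasFDerivAt_pi'.1 hΦ.differentiableAt.hasFDerivAt) i
      rw [h2.fderiv]
      exact h1
    have hc2 : ContinuousAt (fun p : ℂ × ℂ => (((0 : E), p.2 • v), p.1)) 0 := by fun_prop
    have hc2' : Tendsto (fun p : ℂ × ℂ => (((0 : E), p.2 • v), p.1)) (𝓝 0 ×ˢ 𝓝 0)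
        (𝓝 (0 : (E × (Fin d → ℂ)) × ℂ)) := by
      rw [← nhds_prod_eq]
      have := hc2.tendsto
      rwa [show (((0 : E), (0 : ℂ × ℂ).2 • v), (0 : ℂ × ℂ).1) = 0 by simp] at this
    have hcur : ∀ᶠ z in 𝓝 (0 : ℂ), ∀ᶠ t in 𝓝 (0 : ℂ), g (0, z) =
        Q ((0, t • v), z) * monicPoly (t • v) z + ∑ i, R i (0, t • v) * z ^ (i : ℕ) :=
      (hc2'.eventually hQR).curry
    have hQd : ∀ᶠ z in 𝓝 (0 : ℂ), DifferentiableAt ℂ Q (0, z) :=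
      (hcont.eventually hQ.eventually_analyticAt).mono fun _ h => h.differentiableAt
    have hQne : ∀ᶠ z in 𝓝 (0 : ℂ), Q (0, z) ≠ 0 := hQz.eventually_ne hQ0
    refine eq_zero_of_sum_eq_mul_pow
      (k := fun z => -(fderiv ℂ Q (0, z) ((0, v), 0)) / Q (0, z)) ?_ ?_
    · refine ContinuousAt.div ?_ hQz hQ0
      exact ((hQ.fderiv.continuousAt.comp_of_eq hcont rfl).clm_apply continuousAt_const).neg
    · filter_upwards [hcur, hQd, hQne] with z h1 h2 h3
      have hl : HasDerivAt (fun t : ℂ => (((0 : E), t • v), z)) ((0, v), 0) 0 := by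
        refine ((hasDerivAt_const _ _).prodMk ?_).prodMk (hasDerivAt_const _ _)
        simpa using (hasDerivAt_id (0 : ℂ)).smul_const v
      have hl' : HasDerivAt (fun t : ℂ => ((0 : E), t • v)) (0, v) 0 := by
        refine (hasDerivAt_const _ _).prodMk ?_
        simpa using (hasDerivAt_id (0 : ℂ)).smul_const v
      have hA : HasDerivAt (fun t : ℂ => Q ((0, t • v), z)) (fderiv ℂ Q (0, z) ((0, v), 0)) 0 :=
        HasFDerivAt.comp_hasDerivAt_of_eq (0 : ℂ) h2.hasFDerivAt hl (by rw [zero_smul]; rfl)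
      have hC : ∀ i, HasDerivAt (fun t : ℂ => R i (0, t • v)) 0 0 := fun i => by
        have := HasFDerivAt.comp_hasDerivAt_of_eq (0 : ℂ) (hR i).differentiableAt.hasFDerivAt hl'
          (by rw [zero_smul]; rfl)
        rwa [hRv] at this
      have hB : HasDerivAt (fun t : ℂ => monicPoly (t • v) z) (∑ i, v i * z ^ (i : ℕ)) 0 := by
        refine HasDerivAt.const_add _ (HasDerivAt.fun_sum fun i _ => ?_)
        simpa using ((hasDerivAt_id (0 : ℂ)).mul_const (v i)).mul_const (z ^ (i : ℕ))
      have hD := (hA.mul hB).add (HasDerivAt.fun_sum fun i (_ : i ∈ Finset.univ) =>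
        (hC i).mul_const (z ^ (i : ℕ)))
      have hD' := (hasDerivAt_const (0 : ℂ) (g (0, z))).congr_of_eventuallyEq
        (EventuallyEq.symm h1)
      have huniq := hD.unique hD'
      simp only [zero_smul, monicPoly, Pi.zero_apply, zero_mul, Finset.sum_const_zero,
        add_zero] at huniq
      have h00 : Q (((0 : E), (0 : Fin d → ℂ)), z) = Q (0, z) := rfl
      rw [h00] at huniq
      field_simp
      linear_combination huniq
  have hinv : (fderiv ℂ Φ 0 ∘L ContinuousLinearMap.inr ℂ E (Fin d → ℂ)).IsInvertible :=
    ⟨(LinearEquiv.ofInjectiveEndo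
      (fderiv ℂ Φ 0 ∘L ContinuousLinearMap.inr ℂ E (Fin d → ℂ)).toLinearMap
        hinj).toContinuousLinearEquiv, by ext; rfl⟩
  have hcd : ContDiffAt ℂ ⊤ Φ 0 := hΦ.contDiffAt
  have hne : (⊤ : WithTop ℕ∞) ≠ 0 := by simp
  let c := hcd.implicitFunction hne hinv
  have hc : AnalyticAt ℂ c 0 := (hcd.contDiffAt_implicitFunction hne hinv).analyticAt
  have hc0 : c 0 = 0 := hcd.implicitFunction_apply_self hne hinv
  have hcΦ : ∀ᶠ x in 𝓝 (0 : E), Φ (x, c x) = 0 := by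
    have := hcd.eventually_apply_implicitFunction hne hinv
    rwa [hΦ0] at this
  have hcw : AnalyticAt ℂ (fun w : E × ℂ => ((w.1, c w.1), w.2)) 0 :=
    (analyticAt_fst.prod (hc.comp_of_eq analyticAt_fst rfl)).prod analyticAt_snd
  have hcw0 : (fun w : E × ℂ => ((w.1, c w.1), w.2)) 0 = 0 := by simp [hc0]
  have htend : Tendsto (fun w : E × ℂ => ((w.1, c w.1), w.2)) (𝓝 0) (𝓝 0) := by
    have := hcw.continuousAt.tendsto
    have e : 𝓝 (((0 : E × ℂ).1, c (0 : E × ℂ).1), (0 : E × ℂ).2) = 𝓝 0 := congrArg 𝓝 hcw0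
    rwa [e] at this
  refine ⟨d, c, hc, hc0, ⟨fun w => Q ((w.1, c w.1), w.2), hQ.comp_of_eq hcw hcw0, ?_, ?_⟩, ?_⟩
  · exact (congrArg Q hcw0).trans_ne hQ0
  · filter_upwards [htend.eventually hQR, (continuous_fst.tendsto (0 : E × ℂ)).eventually hcΦ]
      with w h1 h2
    have h3 : ∀ i, R i (w.1, c w.1) = 0 := fun i => congrFun h2 i
    simpa [h3] using h1
  -- Division of a general `F` is generic division specialized along `c(x)`.
  · intro F hF
    obtain ⟨Q', R', hQ', hR', hQR'⟩ := exists_generic_division hF d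
    refine ⟨fun w => Q' ((w.1, c w.1), w.2), fun i x => R' i (x, c x), hQ'.comp_of_eq hcw hcw0,
      fun i => (hR' i).comp_of_eq (analyticAt_id.prod hc) (by simp [hc0]), ?_⟩
    filter_upwards [htend.eventually hQR'] with w h1
    exact h1

end Preparation

/-! ### Finiteness of quotients by elimination of one variable -/

section Finiteness

/-- The roots of a monic polynomial whose lower coefficients tend to zero tend to zero. -/
lemma eventually_roots_mem {E : Type*} [NormedAddCommGroup E] {d : ℕ} {c : E → Fin d → ℂ} (hc : ContinuousAt c 0) (hc0 : c 0 = 0)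
    {U : Set (E × ℂ)} (hU : U ∈ 𝓝 0) :
    ∀ᶠ x in 𝓝 (0 : E), ∀ ξ, monicPoly (c x) ξ = 0 → (x, ξ) ∈ U := by
  obtain ⟨ε, hε, hεU⟩ := Metric.mem_nhds_iff.1 hU
  have h1 : Tendsto (fun x => ∑ i, ‖c x i‖ * (ε⁻¹) ^ (d - (i : ℕ))) (𝓝 0) (𝓝 0) := by
    have h : ∀ i : Fin d, Tendsto (fun x => ‖c x i‖ * (ε⁻¹) ^ (d - (i : ℕ))) (𝓝 0) (𝓝 0) := by
      intro i
      have h2 : Tendsto (fun x => c x i) (𝓝 0) (𝓝 (c 0 i)) :=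
        ((continuous_apply i).tendsto _).comp hc.tendsto
      have := h2.norm.mul_const ((ε⁻¹) ^ (d - (i : ℕ)))
      simpa [hc0] using this
    simpa using tendsto_finsetSum Finset.univ fun i _ => h i
  filter_upwards [h1.eventually (gt_mem_nhds (zero_lt_one)), Metric.ball_mem_nhds (0 : E) hε]
    with x hx hxε ξ hξ
  apply hεU
  rw [Metric.mem_ball, Prod.dist_eq, max_lt_iff]
  refine ⟨hxε, ?_⟩
  change dist ξ 0 < ε
  rw [dist_zero_right]
  by_contra! hle
  have hξ0 : 0 < ‖ξ‖ := hε.trans_le hle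
  have h2 : ξ ^ d = -∑ i, c x i * ξ ^ (i : ℕ) := eq_neg_of_add_eq_zero_left hξ
  have h3 : ‖ξ‖ ^ d ≤ ∑ i, ‖c x i‖ * ‖ξ‖ ^ (i : ℕ) := by
    rw [← norm_pow, h2, norm_neg]
    refine (norm_sum_le _ _).trans_eq ?_
    simp
  have h4 : ∀ i : Fin d, ‖c x i‖ * ‖ξ‖ ^ (i : ℕ) ≤
      (‖c x i‖ * (ε⁻¹) ^ (d - (i : ℕ))) * ‖ξ‖ ^ d := fun i => by
    rw [mul_assoc]
    refine mul_le_mul_of_nonneg_left ?_ (norm_nonneg _)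
    have h5 : ‖ξ‖ ^ d = ‖ξ‖ ^ (d - (i : ℕ)) * ‖ξ‖ ^ (i : ℕ) := by
      rw [← pow_add, Nat.sub_add_cancel i.2.le]
    rw [h5, ← mul_assoc, ← mul_pow]
    refine le_mul_of_one_le_left (by positivity) (one_le_pow₀ ?_)
    rw [inv_mul_eq_div, one_le_div hε]
    exact hle
  have h6 := h3.trans (Finset.sum_le_sum fun i _ => h4 i)
  rw [← Finset.sum_mul] at h6
  have h7 : 0 < ‖ξ‖ ^ d := by positivity
  nlinarith

/-- Functions on a normed space that are analytic at the origin. -/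
def anFun (E : Type*) [NormedAddCommGroup E] [NormedSpace ℂ E] : Subalgebra ℂ (E → ℂ) where
  carrier := {F | AnalyticAt ℂ F 0}
  mul_mem' := fun hF hG => hF.mul hG
  add_mem' := fun hF hG => hF.add hG
  algebraMap_mem' := fun _ => analyticAt_const

/-- The ideal of those functions which vanish in a neighbourhood of the origin. -/
def nullAn (E : Type*) [NormedAddCommGroup E] [NormedSpace ℂ E] : Ideal (anFun E) where
  carrier := {F | (F : E → ℂ) =ᶠ[𝓝 0] 0}
  add_mem' := fun {F G} hF hG => by
    filter_upwards [hF, hG] with x h1 h2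
    simp [h1, h2]
  zero_mem' := EventuallyEq.rfl
  smul_mem' := fun c F hF => by
    filter_upwards [hF] with x h
    simp [h]

variable {E : Type*} [NormedAddCommGroup E] [NormedSpace ℂ E]

/-- The pull-back of functions along a linear map. -/
def anPullback {E' : Type*} [NormedAddCommGroup E'] [NormedSpace ℂ E'] (L : E →L[ℂ] E') :
    anFun E' →ₐ[ℂ] anFun E where
  toFun F := ⟨fun x => (F : E' → ℂ) (L x), AnalyticAt.comp_of_eq F.2 (L.analyticAt 0) (map_zero L)⟩
  map_one' := rfl
  map_mul' _ _ := rfl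
  map_zero' := rfl
  map_add' _ _ := rfl
  commutes' _ := rfl

/-- Evaluation at a point. -/
def anEval (x : E) : anFun E →+* ℂ := (Pi.evalRingHom (fun _ : E => ℂ) x).comp (anFun E).val.toRingHom

lemma anEval_apply (x : E) (F : anFun E) : anEval x F = (F : E → ℂ) x := rfl

/-- The ideal `I` of analytic functions has an isolated common zero at the origin. -/
def HasIsolatedZero (I : Ideal (anFun E)) : Prop :=
  ∃ (m : ℕ) (g : Fin m → anFun E), (∀ j, g j ∈ I) ∧
    ∀ᶠ x in 𝓝 (0 : E), (∀ j, (g j : E → ℂ) x = 0) → x = 0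

lemma mem_of_eventuallyEq {I : Ideal (anFun E)} (hI : nullAn E ≤ I) {F G : anFun E} (hF : F ∈ I)
    (h : (G : E → ℂ) =ᶠ[𝓝 0] (F : E → ℂ)) : G ∈ I := by
  have : G - F ∈ nullAn E := by
    filter_upwards [h] with x hx
    simp [hx]
  simpa using I.add_mem (hI this) hF

/-- A nonzero vector has few orthogonal vectors of the form `(1, c, c², …)`. -/
lemma exists_nat_sum_pow_ne_zero {m : ℕ} {S : Finset ℂ} {d : ℕ} (hS : S.card ≤ d)
    {a : ℂ → Fin m → ℂ} (ha : ∀ ξ ∈ S, a ξ ≠ 0) :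
    ∃ k < d * m + 1, ∀ ξ ∈ S, ∑ j, a ξ j * (k : ℂ) ^ (j : ℕ) ≠ 0 := by
  classical
  let p : ℂ → Polynomial ℂ := fun ξ => ∑ j : Fin m, Polynomial.C (a ξ j) * Polynomial.X ^ (j : ℕ)
  have hp : ∀ ξ ∈ S, p ξ ≠ 0 := fun ξ hξ h => by
    refine ha ξ hξ (funext fun j => ?_)
    have := congrArg (fun q => Polynomial.coeff q (j : ℕ)) h
    simpa [p, Polynomial.finsetSum_coeff, Polynomial.coeff_C_mul, Polynomial.coeff_X_pow,
      Fin.val_inj] using this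
  have hdeg : ∀ ξ, (p ξ).natDegree ≤ m := fun ξ =>
    Polynomial.natDegree_sum_le_of_forall_le _ _ fun j _ =>
      (Polynomial.natDegree_C_mul_X_pow_le _ _).trans j.2.le
  have hP : (∏ ξ ∈ S, p ξ) ≠ 0 := Finset.prod_ne_zero_iff.2 hp
  by_contra! h
  -- Otherwise a nonzero product of at most `d` polynomials of degree at most `m` would have `d * m
  -- + 1` roots.
  have hroots : (Finset.range (d * m + 1)).image (fun k : ℕ => (k : ℂ)) ⊆
      (∏ ξ ∈ S, p ξ).roots.toFinset := by
    intro z hz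
    obtain ⟨k, hk, rfl⟩ := Finset.mem_image.1 hz
    obtain ⟨ξ, hξ, h0⟩ := h k (Finset.mem_range.1 hk)
    rw [Multiset.mem_toFinset, Polynomial.mem_roots hP, Polynomial.IsRoot, Polynomial.eval_prod]
    refine Finset.prod_eq_zero hξ ?_
    simpa [p, Polynomial.eval_finsetSum] using h0
  have h1 := Finset.card_le_card hroots
  rw [Finset.card_image_of_injective _ Nat.cast_injective, Finset.card_range] at h1
  have h2 := (Multiset.toFinset_card_le _).trans ((∏ ξ ∈ S, p ξ).card_roots')
  have h3 : (∏ ξ ∈ S, p ξ).natDegree ≤ d * m := by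
    refine (Polynomial.natDegree_prod_le _ _).trans ?_
    refine (Finset.sum_le_card_nsmul _ _ m fun ξ _ => hdeg ξ).trans ?_
    exact Nat.mul_le_mul_right m hS
  omega

lemma finite_quotient_of_one_mem {B : Type*} [CommRing B] [Algebra ℂ B] {I : Ideal B}
    (h : 1 ∈ I) : Module.Finite ℂ (B ⧸ I) := by
  have : Subsingleton (B ⧸ I) := Ideal.Quotient.subsingleton_iff.2 ((Ideal.eq_top_iff_one I).2 h)
  infer_instance

/-- If every element of `B` is congruent modulo `I` to a polynomial of bounded degree in `Z` with
coefficients in `A`, then `B ⧸ I` is finite as soon as `A ⧸ I ∩ A` is. -/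
lemma finite_quotient_of_division {A B : Type*} [CommRing A] [Algebra ℂ A] [CommRing B]
    [Algebra ℂ B] (ι : A →ₐ[ℂ] B) (I : Ideal B) (Z : B) {d : ℕ}
    (h : ∀ F : B, ∃ r : Fin d → A, F - ∑ i, ι (r i) * Z ^ (i : ℕ) ∈ I)
    (hfin : Module.Finite ℂ (A ⧸ I.comap ι)) : Module.Finite ℂ (B ⧸ I) := by
  let φ : (A ⧸ I.comap ι) →ₐ[ℂ] (B ⧸ I) := Ideal.quotientMapₐ I ι le_rfl
  let Ψ : (Fin d → A ⧸ I.comap ι) →ₗ[ℂ] (B ⧸ I) :=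
    ∑ i : Fin d, (LinearMap.mulRight ℂ (Ideal.Quotient.mk I (Z ^ (i : ℕ)))) ∘ₗ
      φ.toLinearMap ∘ₗ LinearMap.proj i
  refine Module.Finite.of_surjective Ψ fun b => ?_
  obtain ⟨F, rfl⟩ := Ideal.Quotient.mk_surjective b
  obtain ⟨r, hr⟩ := h F
  refine ⟨fun i => Ideal.Quotient.mk _ (r i), ?_⟩
  rw [Ideal.Quotient.eq.2 hr, map_sum]
  simp only [Ψ, LinearMap.sum_apply, LinearMap.comp_apply, LinearMap.proj_apply,
    LinearMap.mulRight_apply, map_mul]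
  rfl

/-- The inductive step for finiteness: elimination of the last variable. -/
lemma finite_quotient_prod [FiniteDimensional ℂ E]
    (IH : ∀ J : Ideal (anFun E), nullAn E ≤ J → HasIsolatedZero J → Module.Finite ℂ (anFun E ⧸ J))
    (I : Ideal (anFun (E × ℂ))) (hI : nullAn (E × ℂ) ≤ I) (hz : HasIsolatedZero I)
    (hreg : ∃ g ∈ I, ¬ ∀ᶠ z in 𝓝 (0 : ℂ), (g : E × ℂ → ℂ) (0, z) = 0) :
    Module.Finite ℂ (anFun (E × ℂ) ⧸ I) := by
  classical
  obtain ⟨g₀, hg₀I, hg₀⟩ := hreg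
  obtain ⟨d, c, hc, hc0, ⟨q₀, hq₀, hq₀0, hgq⟩, hdiv⟩ := exists_weierstrass g₀.2 hg₀
  let ι : anFun E →ₐ[ℂ] anFun (E × ℂ) := anPullback (ContinuousLinearMap.fst ℂ E ℂ)
  let Z : anFun (E × ℂ) := ⟨Prod.snd, analyticAt_snd⟩
  let cA : Fin d → anFun E := fun i =>
    ⟨fun x => c x i, ((ContinuousLinearMap.proj (R := ℂ) (φ := fun _ : Fin d => ℂ) i).analyticAt
      _).comp hc⟩
  let P : Polynomial (anFun E) :=
    Polynomial.X ^ d + ∑ i : Fin d, Polynomial.C (cA i) * Polynomial.X ^ (i : ℕ)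
  let ev : Polynomial (anFun E) →+* anFun (E × ℂ) := Polynomial.eval₂RingHom (ι : anFun E →+* _) Z
  have hevC : ∀ a, ev (Polynomial.C a) = ι a := fun a => Polynomial.eval₂_C _ _
  have hevX : ev Polynomial.X = Z := Polynomial.eval₂_X _ _
  have hPv : ∀ w, (ev P : E × ℂ → ℂ) w = monicPoly (c w.1) w.2 := fun w => by
    simp only [P, map_add, map_pow, map_sum, map_mul, hevC, hevX, monicPoly, AddMemClass.coe_add,
      Subalgebra.coe_pow, Pi.add_apply, Pi.pow_apply, AddSubmonoidClass.coe_finsetSum,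
      Finset.sum_apply, MulMemClass.coe_mul, Pi.mul_apply]
    rfl
  have hPI : ev P ∈ I := by
    have hq : AnalyticAt ℂ (fun w => (q₀ w)⁻¹) 0 := hq₀.inv hq₀0
    refine mem_of_eventuallyEq hI (I.mul_mem_left ⟨_, hq⟩ hg₀I) ?_
    filter_upwards [hgq, hq₀.continuousAt.eventually_ne hq₀0] with w h1 h2
    change _ = (q₀ w)⁻¹ * (g₀ : E × ℂ → ℂ) w
    rw [hPv, h1, inv_mul_cancel_left₀ h2]
  -- division of a function by `P`
  have hdiv' : ∀ F : anFun (E × ℂ), ∃ r : Fin d → anFun E,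
      (F - ∑ i, ι (r i) * Z ^ (i : ℕ) ∈ I) ∧ ∀ᶠ w in 𝓝 (0 : E × ℂ), monicPoly (c w.1) w.2 = 0 →
        (F : E × ℂ → ℂ) w = ∑ i, (r i : E → ℂ) w.1 * w.2 ^ (i : ℕ) := by
    intro F
    obtain ⟨q, r, hq, hr, hqr⟩ := hdiv F F.2
    refine ⟨fun i => ⟨r i, hr i⟩, ?_, ?_⟩
    · refine mem_of_eventuallyEq hI (I.mul_mem_left ⟨q, hq⟩ hPI) ?_
      filter_upwards [hqr] with w hw
      change (F : E × ℂ → ℂ) w - _ = q w * _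
      rw [hPv, hw, AddSubmonoidClass.coe_finsetSum, Finset.sum_apply, add_sub_assoc]
      simp only [MulMemClass.coe_mul, Pi.mul_apply, Subalgebra.coe_pow, Pi.pow_apply]
      exact (add_eq_left.2 (sub_eq_zero.2 rfl))
    · filter_upwards [hqr] with w hw h0
      rw [hw, h0, mul_zero, zero_add]
  let J : Ideal (anFun E) := I.comap ι
  have hJ : nullAn E ≤ J := fun F hF => hI <| by
    have : ∀ᶠ w in 𝓝 (0 : E × ℂ), (F : E → ℂ) w.1 = 0 :=
      (continuous_fst.tendsto (0 : E × ℂ)).eventually hF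
    exact this
  -- For `d = 0` the polynomial `P` is `1`; the Bézout identity for the resultant below needs `d ≠
  -- 0`.
  rcases Nat.eq_zero_or_pos d with hd | hd
  · subst hd
    have h1 : (1 : anFun (E × ℂ)) ∈ I := by simpa [P] using hPI
    exact finite_quotient_of_one_mem h1
  -- the projected ideal has an isolated zero
  have hJz : HasIsolatedZero J := by
    obtain ⟨m, g, hgI, hgz⟩ := hz
    -- Finitely many combinations of the generators suffice: over `x ≠ 0` near `0` no root `ξ` of
    -- `P` makes all `g j` vanish at `(x, ξ)`, so some `G k` is nonzero at all roots of `P`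
    -- simultaneously.
    let G : ℕ → anFun (E × ℂ) := fun k => ∑ j : Fin m, algebraMap ℂ _ ((k : ℂ) ^ (j : ℕ)) * g j
    have hGI : ∀ k, G k ∈ I := fun k => I.sum_mem fun j _ => I.mul_mem_left _ (hgI j)
    choose r hrI hrv using fun k => hdiv' (G k)
    let Q : ℕ → Polynomial (anFun E) := fun k =>
      ∑ i : Fin d, Polynomial.C (r k i) * Polynomial.X ^ (i : ℕ)
    have hPd : P.natDegree ≤ d := by
      refine Polynomial.natDegree_add_le_of_degree_le (Polynomial.natDegree_X_pow_le d) ?_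
      exact Polynomial.natDegree_sum_le_of_forall_le _ _ fun j _ =>
        (Polynomial.natDegree_C_mul_X_pow_le _ _).trans j.2.le
    have hQd : ∀ k, (Q k).natDegree ≤ d := fun k =>
      Polynomial.natDegree_sum_le_of_forall_le _ _ fun j _ =>
        (Polynomial.natDegree_C_mul_X_pow_le _ _).trans j.2.le
    have hQI : ∀ k, ev (Q k) ∈ I := fun k => by
      have e : ev (Q k) = ∑ i, ι (r k i) * Z ^ (i : ℕ) := by
        simp only [Q, map_sum, map_mul, map_pow, hevC, hevX]
      rw [e]
      simpa using I.sub_mem (hGI k) (hrI k)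
    -- The formal degrees are fixed at `d` so that the resultant commutes with evaluation at `x`.
    -- The Bézout identity puts it in `I`, and its vanishing at `x` gives `P` and `Q k` a common
    -- root.
    refine ⟨d * m + 1, fun k => P.resultant (Q k) d d, fun k => ?_, ?_⟩
    · obtain ⟨p, q, -, -, e⟩ := Polynomial.exists_mul_add_mul_eq_C_resultant (m := d) (n := d) P (Q k) hPd (hQd k)
        (Or.inl hd.ne')
      change ι _ ∈ I
      rw [← hevC, ← e, map_add, map_mul, map_mul]
      exact I.add_mem (I.mul_mem_right _ hPI) (I.mul_mem_right _ (hQI k))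
    · have hall : ∀ᶠ w in 𝓝 (0 : E × ℂ), ((∀ j, (g j : E × ℂ → ℂ) w = 0) → w = 0) ∧
          ∀ k : Fin (d * m + 1), monicPoly (c w.1) w.2 = 0 →
            (G k : E × ℂ → ℂ) w = ∑ i, (r k i : E → ℂ) w.1 * w.2 ^ (i : ℕ) :=
        hgz.and (eventually_all.2 fun k => hrv k)
      filter_upwards [eventually_roots_mem hc.continuousAt hc0 hall] with x hx hres
      by_contra hx0
      -- the polynomial `P` at `x`
      have hPx : P.map (anEval x) = Polynomial.X ^ d +
          ∑ i : Fin d, Polynomial.C (c x i) * Polynomial.X ^ (i : ℕ) := by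
        simp only [P, Polynomial.map_add, Polynomial.map_pow, Polynomial.map_X, Polynomial.map_sum,
          Polynomial.map_mul, Polynomial.map_C]
        rfl
      have hlow : (∑ i : Fin d, Polynomial.C (c x i) * Polynomial.X ^ (i : ℕ) : Polynomial ℂ).degree < d :=
        Polynomial.degree_sum_fin_lt (c x)
      have hPmonic : (P.map (anEval x)).Monic := by
        rw [hPx]; exact Polynomial.monic_X_pow_add hlow
      have hPdeg : (P.map (anEval x)).natDegree = d := by
        rw [hPx]
        exact Polynomial.natDegree_eq_of_degree_eq_some (by
          rw [Polynomial.degree_add_eq_left_of_degree_lt (by simpa using hlow),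
            Polynomial.degree_X_pow])
      have hPeval : ∀ ξ, (P.map (anEval x)).eval ξ = monicPoly (c x) ξ := fun ξ => by
        rw [hPx]
        simp [monicPoly, Polynomial.eval_finsetSum]
      let S := (P.map (anEval x)).roots.toFinset
      have hS : S.card ≤ d := (Multiset.toFinset_card_le _).trans
        ((Polynomial.card_roots' _).trans_eq hPdeg)
      have hSroot : ∀ ξ, ξ ∈ (P.map (anEval x)).roots → monicPoly (c x) ξ = 0 := fun ξ hξ => by
        rw [← hPeval]
        exact (Polynomial.mem_roots hPmonic.ne_zero).1 hξ
      obtain ⟨k, hk, hkS⟩ := exists_nat_sum_pow_ne_zero (m := m) hS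
        (a := fun ξ j => (g j : E × ℂ → ℂ) (x, ξ)) (fun ξ hξ h => by
          have h1 := (hx ξ (hSroot ξ (Multiset.mem_toFinset.1 hξ))).1 fun j => congrFun h j
          exact hx0 (congrArg Prod.fst h1))
      have h1 : ((P.map (anEval x)).resultant ((Q k).map (anEval x)) d d) = 0 := by
        rw [Polynomial.resultant_map_map]
        exact hres ⟨k, hk⟩
      have h2 := Polynomial.resultant_eq_prod_eval (P.map (anEval x)) ((Q k).map (anEval x)) d
        (Polynomial.natDegree_map_le.trans (hQd k)) (IsAlgClosed.splits _)
      rw [hPdeg, h1, hPmonic.leadingCoeff, one_pow, one_mul] at h2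
      obtain ⟨ξ, hξ, hξ0⟩ := Multiset.mem_map.1 (Multiset.prod_eq_zero_iff.1 h2.symm)
      refine hkS ξ (Multiset.mem_toFinset.2 hξ) ?_
      have h3 := (hx ξ (hSroot ξ hξ)).2 ⟨k, hk⟩ (hSroot ξ hξ)
      have h4 : ((Q k).map (anEval x)).eval ξ = ∑ i, (r k i : E → ℂ) x * ξ ^ (i : ℕ) := by
        simp only [Q, Polynomial.map_sum, Polynomial.map_mul, Polynomial.map_C, Polynomial.map_pow,
          Polynomial.map_X, Polynomial.eval_finsetSum, Polynomial.eval_mul, Polynomial.eval_C,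
          Polynomial.eval_pow, Polynomial.eval_X, anEval_apply]
      have h5 : (G k : E × ℂ → ℂ) (x, ξ) = ∑ j, (g j : E × ℂ → ℂ) (x, ξ) * (k : ℂ) ^ (j : ℕ) := by
        simp only [G, AddSubmonoidClass.coe_finsetSum, Finset.sum_apply, MulMemClass.coe_mul,
          Pi.mul_apply]
        exact Finset.sum_congr rfl fun j _ => mul_comm _ _
      rw [← h5]
      exact h3.trans (h4.symm.trans hξ0)
  have hfin := IH J hJ hJz
  exact finite_quotient_of_division ι I Z (fun F => (hdiv' F).imp fun r hr => hr.1) hfin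

end Finiteness

/-! ### Isolated zeros give finite-dimensional quotients -/

section Nullstellensatz

lemma finite_quotient_of_surjective {A B : Type*} [CommRing A] [Algebra ℂ A] [CommRing B]
    [Algebra ℂ B] (ι : A →ₐ[ℂ] B) (hι : Function.Surjective ι) (I : Ideal B)
    (hfin : Module.Finite ℂ (A ⧸ I.comap ι)) : Module.Finite ℂ (B ⧸ I) := by
  refine finite_quotient_of_division ι I 1 (d := 1) (fun F => ?_) hfin
  obtain ⟨a, rfl⟩ := hι F
  exact ⟨fun _ => a, by simp⟩

/-- A function that is analytic at the origin and vanishes on a neighbourhood of the origin in each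
complex line vanishes near the origin. -/
lemma eventually_eq_zero_of_lines {E : Type*} [NormedAddCommGroup E] [NormedSpace ℂ E]
    [Nontrivial E] {g : E → ℂ} (hg : AnalyticAt ℂ g 0)
    (h : ∀ v : E, v ≠ 0 → ∀ᶠ z in 𝓝 (0 : ℂ), g (z • v) = 0) : ∀ᶠ x in 𝓝 (0 : E), g x = 0 := by
  obtain ⟨ε, hε, hball⟩ := Metric.eventually_nhds_iff_ball.1 hg.eventually_analyticAt
  filter_upwards [Metric.ball_mem_nhds (0 : E) hε] with x hx
  by_cases hx0 : x = 0
  · obtain ⟨v, hv⟩ := exists_ne (0 : E)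
    have := (h v hv).self_of_nhds
    rwa [zero_smul, ← hx0] at this
  let U : Set ℂ := (fun z : ℂ => z • x) ⁻¹' Metric.ball 0 ε
  have hU : IsPreconnected U := by
    have hconv : Convex ℝ U := (convex_ball (0 : E) ε).linear_preimage
      ((LinearMap.toSpanSingleton ℂ E x).restrictScalars ℝ)
    exact hconv.isPreconnected
  have han : AnalyticOnNhd ℂ (fun z : ℂ => g (z • x)) U := fun z hz =>
    AnalyticAt.comp_of_eq (f := fun z : ℂ => z • x) (hball _ hz) (analyticAt_id.smul analyticAt_const) rfl
  have h0 : (0 : ℂ) ∈ U := by simpa [U] using hε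
  have h1 : (1 : ℂ) ∈ U := by simpa [U] using hx
  have := han.eqOn_zero_of_preconnected_of_eventuallyEq_zero hU h0 (h x hx0) h1
  simpa using this

/-- If an ideal of germs has an isolated common zero, its quotient ring is finite-dimensional. -/
theorem finite_quotient_of_hasIsolatedZero (k : ℕ) : ∀ (E : Type) [NormedAddCommGroup E]
    [NormedSpace ℂ E] [FiniteDimensional ℂ E], Module.finrank ℂ E = k →
    ∀ I : Ideal (anFun E), nullAn E ≤ I → HasIsolatedZero I → Module.Finite ℂ (anFun E ⧸ I) := by
  induction k with
  | zero =>
    intro E _ _ _ hk I _ _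
    have : Subsingleton E := Module.finrank_zero_iff.1 hk
    refine Module.Finite.of_surjective (Algebra.linearMap ℂ (anFun E ⧸ I)) fun b => ?_
    obtain ⟨F, rfl⟩ := Ideal.Quotient.mk_surjective b
    refine ⟨(F : E → ℂ) 0, ?_⟩
    have : F = algebraMap ℂ (anFun E) ((F : E → ℂ) 0) :=
      Subtype.ext (funext fun x => by rw [Subsingleton.elim x 0]; rfl)
    conv_rhs => rw [this]
    rfl
  | succ k ih =>
    intro E _ _ _ hk I hI hz
    have : Nontrivial E := Module.nontrivial_of_finrank_pos (R := ℂ) (by omega)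
    obtain ⟨m, g, hgI, hgz⟩ := hz
    obtain ⟨j, hj⟩ : ∃ j, ¬ ∀ᶠ x in 𝓝 (0 : E), (g j : E → ℂ) x = 0 := by
      by_contra! h
      have h1 : ∀ᶠ x in 𝓝 (0 : E), x = 0 := by
        filter_upwards [hgz, eventually_all.2 h] with x h1 h2
        exact h1 h2
      have hfalse : ∀ᶠ x in 𝓝[≠] (0 : E), False := by
        filter_upwards [h1.filter_mono nhdsWithin_le_nhds, self_mem_nhdsWithin] with x h1 h2
        exact h2 h1
      have : NeBot (𝓝[≠] (0 : E)) := Module.punctured_nhds_neBot ℂ E 0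
      exact hfalse.exists.elim fun _ h => h
    -- A line on which `g j` is not identically zero becomes the last coordinate axis, which is the
    -- regularity that Weierstrass preparation needs.
    obtain ⟨v, hv, hgv⟩ : ∃ v : E, v ≠ 0 ∧ ¬ ∀ᶠ z in 𝓝 (0 : ℂ), (g j : E → ℂ) (z • v) = 0 := by
      by_contra! h
      exact hj (eventually_eq_zero_of_lines (g j).2 h)
    obtain ⟨W, hW⟩ := Submodule.exists_isCompl (Submodule.span ℂ {v})
    let e : (W × ℂ) ≃L[ℂ] E := (((LinearEquiv.refl ℂ W).prodCongr
      (LinearEquiv.toSpanNonzeroSingleton ℂ E v hv)).trans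
        (Submodule.prodEquivOfIsCompl W _ hW.symm)).toContinuousLinearEquiv
    have he : ∀ z : ℂ, e (0, z) = z • v := fun z => by
      simp [e, LinearEquiv.toSpanNonzeroSingleton_apply]
    have hfr : Module.finrank ℂ W = k := by
      have h1 := Submodule.finrank_add_eq_of_isCompl hW
      rw [finrank_span_singleton hv, hk] at h1
      omega
    let φ : anFun (W × ℂ) →ₐ[ℂ] anFun E := anPullback (e.symm : E →L[ℂ] W × ℂ)
    let ψ : anFun E →ₐ[ℂ] anFun (W × ℂ) := anPullback (e : W × ℂ →L[ℂ] E)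
    have hφψ : ∀ F, φ (ψ F) = F := fun F => Subtype.ext (funext fun x => by
      change (F : E → ℂ) (e (e.symm x)) = _
      rw [e.apply_symm_apply])
    refine finite_quotient_of_surjective φ (fun F => ⟨ψ F, hφψ F⟩) I
      (finite_quotient_prod (fun J h1 h2 => ih W hfr J h1 h2) _ ?_ ?_ ?_)
    · intro F hF
      refine hI ?_
      have ht : Tendsto e.symm (𝓝 0) (𝓝 0) := by
        simpa using e.symm.continuous.tendsto 0
      exact ht.eventually hF
    · refine ⟨m, fun j => ψ (g j), fun j => ?_, ?_⟩
      · change φ (ψ (g j)) ∈ I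
        rw [hφψ]
        exact hgI j
      · have ht : Tendsto e (𝓝 0) (𝓝 0) := by
          simpa using e.continuous.tendsto 0
        filter_upwards [ht.eventually hgz] with w hw h
        have := hw h
        simpa using this
    · refine ⟨ψ (g j), ?_, fun h => hgv ?_⟩
      · change φ (ψ (g j)) ∈ I
        rw [hφψ]
        exact hgI j
      · filter_upwards [h] with z hz
        rw [← he]
        exact hz

end Nullstellensatz

/-! ### The local ring of germs and the Tjurina ideal -/

section LocalRing

variable {n : ℕ}

lemma isUnit_of_value_ne_zero {a : Hol n} (h : value n a ≠ 0) : IsUnit a := by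
  obtain ⟨F, rfl⟩ := germ_surjective a
  rw [value_germ] at h
  have hF : AnalyticAt ℂ (F : Space n → ℂ) 0 := F.2
  let G : holFun n := ⟨fun x => ((F : Space n → ℂ) x)⁻¹, hF.inv h⟩
  refine IsUnit.of_mul_eq_one (germ n G) ?_
  rw [← map_mul, ← map_one (germ n), germ_eq_iff]
  filter_upwards [hF.continuousAt.eventually_ne h] with x hx
  exact mul_inv_cancel₀ hx

lemma isUnit_iff_value {a : Hol n} : IsUnit a ↔ value n a ≠ 0 :=
  ⟨fun h => (h.map (value n)).ne_zero, isUnit_of_value_ne_zero⟩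

lemma mem_𝔪 {a : Hol n} : a ∈ 𝔪 n ↔ value n a = 0 := Iff.rfl

instance : Nontrivial (Hol n) := (value n).toRingHom.domain_nontrivial

instance : IsLocalRing (Hol n) := by
  refine IsLocalRing.of_isUnit_or_isUnit_one_sub_self fun a => ?_
  rw [isUnit_iff_value, isUnit_iff_value, map_sub, map_one]
  by_cases h : value n a = 0
  · right; simp [h]
  · exact Or.inl h

lemma 𝔪_eq_maximalIdeal : 𝔪 n = IsLocalRing.maximalIdeal (Hol n) := by
  ext a
  rw [IsLocalRing.mem_maximalIdeal, mem_nonunits_iff, isUnit_iff_value, mem_𝔪, not_not]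

/-- The coordinate function `xᵢ`. -/
def coordX (i : Fin (n + 1)) : Hol n :=
  germ n ⟨fun x => x i, (ContinuousLinearMap.proj (R := ℂ)
    (φ := fun _ : Fin (n + 1) => ℂ) i).analyticAt 0⟩

lemma coordX_mem (i : Fin (n + 1)) : coordX (n := n) i ∈ 𝔪 n := rfl

lemma pderiv_coordX (i j : Fin (n + 1)) : pderiv i (coordX (n := n) j) = if i = j then 1 else 0 := by
  rw [coordX, pderiv_germ]
  have h : ∀ x : Space n, fderiv ℂ (fun x : Space n => x j) x (Pi.single i 1) =
      if i = j then 1 else 0 := fun x => by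
    have h1 : HasFDerivAt (fun x : Space n => x j)
      (ContinuousLinearMap.proj (R := ℂ) (φ := fun _ : Fin (n + 1) => ℂ) j) x :=
      (ContinuousLinearMap.proj (R := ℂ) (φ := fun _ : Fin (n + 1) => ℂ) j).hasFDerivAt
    rw [h1.fderiv, ContinuousLinearMap.proj_apply, Pi.single_apply]
    simp only [eq_comm]
  split_ifs with hij
  · rw [← map_one (germ n), germ_eq_iff]
    exact Eventually.of_forall fun x => (h x).trans (if_pos hij)
  · rw [← map_zero (germ n), germ_eq_iff]
    exact Eventually.of_forall fun x => (h x).trans (if_neg hij)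

/-- Hadamard's lemma by shifting the power series: if `F 0 = 0`, then `F x = L x x` with `L`
analytic and valued in linear forms, and the coefficients of `L` multiply the coordinates. -/
lemma 𝔪_eq_span_coordX : 𝔪 n = Ideal.span (Set.range (coordX (n := n))) := by
  apply le_antisymm
  · intro a ha
    obtain ⟨F, rfl⟩ := germ_surjective a
    obtain ⟨p, r, hp⟩ := (show AnalyticAt ℂ (F : Space n → ℂ) 0 from F.2)
    have hpos : 0 < p.shift.radius := by
      rw [FormalMultilinearSeries.radius_shift]; exact hp.r_pos.trans_le hp.r_le
    have hL : AnalyticAt ℂ p.shift.sum 0 := (p.shift.hasFPowerSeriesOnBall hpos).analyticAt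
    let c : Fin (n + 1) → holFun n := fun i => ⟨fun x => p.shift.sum x (Pi.single i 1),
      ((ContinuousLinearMap.apply ℂ ℂ (Pi.single i 1 : Space n)).analyticAt _).comp hL⟩
    have h0 : p 0 (fun _ => 0) = 0 := by
      rw [hp.coeff_zero]; exact ha
    have key : germ n F = ∑ i, germ n (c i) * coordX i := by
      simp only [coordX, ← map_mul, ← map_sum]
      rw [germ_eq_iff]
      filter_upwards [Metric.eball_mem_nhds (0 : Space n) hp.r_pos] with x hx
      have h1 := hp.hasSum hx
      rw [zero_add, ← hasSum_nat_add_iff' 1] at h1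
      have h2 := (p.shift.hasSum (Metric.eball_subset_eball
        (by rw [FormalMultilinearSeries.radius_shift]; exact hp.r_le) hx)).mapL
          (ContinuousLinearMap.apply ℂ ℂ x)
      have h3 : (fun k => p (k + 1) fun _ => x) =
          fun k => ContinuousLinearMap.apply ℂ ℂ x (p.shift k fun _ => x) := by
        funext k
        rw [ContinuousLinearMap.apply_apply, FormalMultilinearSeries.shift,
          ContinuousMultilinearMap.curryRight_apply]
        congr 1
        ext i
        refine Fin.lastCases ?_ (fun j => ?_) i <;> simp
      rw [h3] at h1
      have h4 := h1.unique h2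
      have h5 : (F : Space n → ℂ) x = p.shift.sum x x := by
        have h6 : p 0 (fun _ => x) = 0 := by
          rw [← h0]; congr 1; exact Subsingleton.elim _ _
        simpa [h6] using h4
      rw [h5]
      conv_lhs => rw [pi_eq_sum_univ' x, map_sum]
      simp only [AddSubmonoidClass.coe_finsetSum, Finset.sum_apply, MulMemClass.coe_mul,
        Pi.mul_apply, c, map_smul, smul_eq_mul]
      refine Finset.sum_congr rfl fun i _ => ?_
      rw [mul_comm, ← pi_eq_sum_univ' x]
    rw [key]
    exact Ideal.sum_mem _ fun i _ => Ideal.mul_mem_left _ _ (Ideal.subset_span ⟨i, rfl⟩)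
  · rw [Ideal.span_le]
    rintro _ ⟨i, rfl⟩
    exact coordX_mem i

/-- By the identity theorem on a ball: a germ that is zero near one point where the other factor is
nonzero is zero on the whole ball. -/
instance : IsDomain (Hol n) := by
  have : NoZeroDivisors (Hol n) := ⟨fun {a b} hab => by
    obtain ⟨F, rfl⟩ := germ_surjective a
    obtain ⟨G, rfl⟩ := germ_surjective b
    rw [← map_mul, germ_eq_zero_iff] at hab
    rw [germ_eq_zero_iff, germ_eq_zero_iff]
    have hF : AnalyticAt ℂ (F : Space n → ℂ) 0 := F.2
    have hG : AnalyticAt ℂ (G : Space n → ℂ) 0 := G.2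
    obtain ⟨ε, hε, hball⟩ := Metric.eventually_nhds_iff_ball.1
      (hF.eventually_analyticAt.and (hG.eventually_analyticAt.and hab))
    by_cases h : ∀ x ∈ Metric.ball (0 : Space n) ε, (F : Space n → ℂ) x = 0
    · left
      filter_upwards [Metric.ball_mem_nhds (0 : Space n) hε] with x hx
      exact h x hx
    · right
      push Not at h
      obtain ⟨x, hx, hFx⟩ := h
      have hGx : (G : Space n → ℂ) =ᶠ[𝓝 x] 0 := by
        filter_upwards [(hball x hx).1.continuousAt.eventually_ne hFx,
          Metric.isOpen_ball.mem_nhds hx] with y h1 h2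
        exact (mul_eq_zero.1 (hball y h2).2.2).resolve_left h1
      have han : AnalyticOnNhd ℂ (G : Space n → ℂ) (Metric.ball 0 ε) := fun y hy => (hball y hy).2.1
      have := han.eqOn_zero_of_preconnected_of_eventuallyEq_zero
        (convex_ball (0 : Space n) ε).isPreconnected hx hGx
      filter_upwards [Metric.ball_mem_nhds (0 : Space n) hε] with y hy
      exact this hy⟩
  exact NoZeroDivisors.to_isDomain _

/-- The Tjurina ideal of `f`, generated by `f` and its partial derivatives. -/
def tjurina (f : Hol n) : Ideal (Hol n) := Ideal.span (insert f (Set.range fun i => pderiv i f))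

/-- A finite-dimensional quotient is Artinian, so its maximal ideal is nilpotent. -/
lemma exists_pow_le_of_finite {R : Type*} [CommRing R] [Algebra ℂ R] [IsLocalRing R] (T : Ideal R)
    (h : Module.Finite ℂ (R ⧸ T)) : ∃ k, IsLocalRing.maximalIdeal R ^ k ≤ T := by
  by_cases hT : T = ⊤
  · exact ⟨0, hT ▸ le_top⟩
  have : Nontrivial (R ⧸ T) := Ideal.Quotient.nontrivial_iff.2 hT
  have : IsLocalRing (R ⧸ T) := IsLocalRing.of_surjective' _ Ideal.Quotient.mk_surjective
  have : IsArtinianRing (R ⧸ T) := IsArtinianRing.of_finite ℂ _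
  obtain ⟨k, hk⟩ := IsArtinianRing.isNilpotent_jacobson_bot (R := R ⧸ T)
  rw [IsLocalRing.jacobson_eq_maximalIdeal _ bot_ne_top] at hk
  refine ⟨k, ?_⟩
  have h1 : (IsLocalRing.maximalIdeal R).map (Ideal.Quotient.mk T) ≤
      IsLocalRing.maximalIdeal (R ⧸ T) :=
    ((IsLocalRing.local_hom_TFAE (Ideal.Quotient.mk T)).out 0 2).1
      (IsLocalHom.of_surjective _ Ideal.Quotient.mk_surjective)
  have h2 := Ideal.pow_right_mono h1 k
  rw [← Ideal.map_pow, hk] at h2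
  intro x hx
  exact Ideal.Quotient.eq_zero_iff_mem.1 (h2 (Ideal.mem_map_of_mem _ hx))

/-- The Tjurina ideal of an isolated singularity contains a power of the maximal ideal. -/
theorem exists_pow_le_tjurina {f : Hol n} (hf : IsIsolatedSingularity f) :
    ∃ k, 𝔪 n ^ k ≤ tjurina f := by
  obtain ⟨F, rfl, hF⟩ := hf.isolated
  let φ : anFun (Space n) →ₐ[ℂ] Hol n := germ n
  have hφ : Function.Surjective φ := germ_surjective
  rw [𝔪_eq_maximalIdeal]
  refine exists_pow_le_of_finite _ (finite_quotient_of_surjective φ hφ _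
    (finite_quotient_of_hasIsolatedZero _ _ rfl _ ?_ ?_))
  · intro G hG
    have : φ G = 0 := germ_eq_zero_iff.2 hG
    rw [Ideal.mem_comap, this]
    exact Ideal.zero_mem _
  · refine ⟨n + 2, Fin.cons F fun i => pderivFun i F, fun j => ?_, ?_⟩
    · refine Fin.cases ?_ (fun i => ?_) j
      · exact Ideal.subset_span (Or.inl rfl)
      · exact Ideal.subset_span (Or.inr ⟨i, rfl⟩)
    · filter_upwards [hF] with x hx h
      refine hx (h 0) ?_
      ext v
      have : ∀ i, fderiv ℂ (F : Space n → ℂ) x (Pi.single i 1) = 0 := fun i => h i.succ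
      rw [pi_eq_sum_univ' v, map_sum]
      simp [this]

end LocalRing

/-! ### Solving polynomial systems over the ring of germs -/

section Hensel

variable {n : ℕ}

/-- This links formal partial derivatives at the origin to the analytic derivative used by the
implicit function theorem. -/
lemma hasDerivAt_eval_smul {s : Type*} [Fintype s] [DecidableEq s] (v : s → ℂ) (p : MvPolynomial s ℂ) :
    HasDerivAt (fun t : ℂ => MvPolynomial.eval (t • v) p)
      (∑ β, v β * MvPolynomial.constantCoeff (MvPolynomial.pderiv β p)) 0 := by
  induction p using MvPolynomial.induction_on with
  | C a => simpa using hasDerivAt_const (0 : ℂ) a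
  | add p q hp hq =>
    simp only [map_add, mul_add, Finset.sum_add_distrib]
    exact hp.add hq
  | mul_X p γ hp =>
    have h1 : HasDerivAt (fun t : ℂ => t * v γ) (v γ) 0 := by
      simpa using (hasDerivAt_id (0 : ℂ)).mul_const (v γ)
    have h2 := hp.mul h1
    have h4 : (fun t : ℂ => MvPolynomial.eval (t • v) (p * MvPolynomial.X γ)) =
        (fun t => MvPolynomial.eval (t • v) p) * fun t => t * v γ := by
      funext t; simp
    rw [h4]
    refine h2.congr_deriv ?_
    simp [Derivation.leibniz, MvPolynomial.pderiv_X, Pi.single_apply, apply_ite, mul_comm]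

/-- The multivariate Hensel lemma for the ring of germs of holomorphic functions. -/
theorem exists_hensel {s : Type} [Fintype s] [DecidableEq s] (G : s → MvPolynomial s (Hol n))
    (h0 : ∀ α, MvPolynomial.constantCoeff (G α) ∈ 𝔪 n)
    (h1 : ∀ α β, MvPolynomial.constantCoeff (MvPolynomial.pderiv β (G α)) -
      (if α = β then 1 else 0) ∈ 𝔪 n) :
    ∃ t : s → Hol n, (∀ α, t α ∈ 𝔪 n) ∧ ∀ α, MvPolynomial.eval t (G α) = 0 := by
  choose rep hrep using germ_surjective (n := n)
  -- Representatives of the coefficients turn the system into an analytic map in `x` and the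
  -- unknowns. By `h1` its derivative in the unknowns at the origin is the identity, so the implicit
  -- function theorem applies.
  let Φ : Space n × (s → ℂ) → s → ℂ := fun w α => ∑ m ∈ (G α).support,
    (rep ((G α).coeff m) : Space n → ℂ) w.1 * ∏ β, w.2 β ^ m β
  have hΦ : AnalyticAt ℂ Φ 0 := by
    refine analyticAt_pi_iff.2 fun α => Finset.analyticAt_fun_sum _ fun m _ => ?_
    refine AnalyticAt.mul (AnalyticAt.comp_of_eq (rep _).2 analyticAt_fst rfl) ?_
    refine Finset.analyticAt_fun_prod _ fun β _ => AnalyticAt.pow ?_ _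
    exact ((ContinuousLinearMap.proj (R := ℂ) (φ := fun _ : s => ℂ) β).analyticAt _).comp
      analyticAt_snd
  have hval : ∀ a, (rep a : Space n → ℂ) 0 = value n a := fun a => by
    rw [← value_germ, hrep]
  have hΦv : ∀ τ α, Φ (0, τ) α = MvPolynomial.eval τ ((G α).map (value n : Hol n →+* ℂ)) := by
    intro τ α
    rw [MvPolynomial.eval_map, MvPolynomial.eval₂_eq']
    exact Finset.sum_congr rfl fun m _ => by rw [hval]; rfl
  have hΦ0 : Φ 0 = 0 := by
    funext α
    have := hΦv 0 α
    rw [show ((0 : Space n), (0 : s → ℂ)) = 0 from rfl] at this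
    rw [this, MvPolynomial.eval_zero, MvPolynomial.constantCoeff_map]
    exact h0 α
  have hder : ∀ v : s → ℂ, fderiv ℂ Φ 0 (0, v) = v := by
    intro v
    have hl : HasDerivAt (fun t : ℂ => ((0 : Space n), t • v)) (0, v) 0 := by
      refine (hasDerivAt_const _ _).prodMk ?_
      simpa using (hasDerivAt_id (0 : ℂ)).smul_const v
    have h2 := HasFDerivAt.comp_hasDerivAt_of_eq (0 : ℂ) hΦ.differentiableAt.hasFDerivAt hl
      (by rw [zero_smul]; rfl)
    funext α
    have h3 := (hasDerivAt_pi.1 h2) α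
    have h4 := hasDerivAt_eval_smul v ((G α).map (value n : Hol n →+* ℂ))
    have h5 : (fun t : ℂ => MvPolynomial.eval (t • v) ((G α).map (value n : Hol n →+* ℂ))) =
        fun t => (Φ ∘ fun t : ℂ => ((0 : Space n), t • v)) t α := funext fun t => (hΦv _ α).symm
    rw [h5] at h4
    rw [h3.unique h4]
    have h6 : ∀ β, MvPolynomial.constantCoeff
        (MvPolynomial.pderiv β ((G α).map (value n : Hol n →+* ℂ))) = if α = β then 1 else 0 := by
      intro β
      rw [MvPolynomial.pderiv_map, MvPolynomial.constantCoeff_map]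
      have := mem_𝔪.1 (h1 α β)
      rw [map_sub, sub_eq_zero] at this
      rw [RingHom.coe_coe, this]
      split_ifs <;> simp
    simp [h6]
  have hinv : (fderiv ℂ Φ 0 ∘L ContinuousLinearMap.inr ℂ (Space n) (s → ℂ)).IsInvertible :=
    ⟨ContinuousLinearEquiv.refl ℂ _, by ext1 v; exact (hder v).symm⟩
  have hcd : ContDiffAt ℂ ⊤ Φ 0 := hΦ.contDiffAt
  have hne : (⊤ : WithTop ℕ∞) ≠ 0 := by simp
  let ψ := hcd.implicitFunction hne hinv
  have hψ : AnalyticAt ℂ ψ 0 := (hcd.contDiffAt_implicitFunction hne hinv).analyticAt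
  have hψ0 : ψ 0 = 0 := hcd.implicitFunction_apply_self hne hinv
  have hψΦ : ∀ᶠ x in 𝓝 (0 : Space n), Φ (x, ψ x) = 0 := by
    have := hcd.eventually_apply_implicitFunction hne hinv
    rwa [hΦ0] at this
  let T : s → holFun n := fun β => ⟨fun x => ψ x β, ((ContinuousLinearMap.proj (R := ℂ)
    (φ := fun _ : s => ℂ) β).analyticAt _).comp hψ⟩
  refine ⟨fun β => germ n (T β), fun β => ?_, fun α => ?_⟩
  · rw [mem_𝔪, value_germ]
    exact congrFun hψ0 β
  · have e : MvPolynomial.eval (fun β => germ n (T β)) (G α) =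
        germ n (∑ m ∈ (G α).support, rep ((G α).coeff m) * ∏ β, T β ^ m β) := by
      rw [MvPolynomial.eval_eq', map_sum]
      exact Finset.sum_congr rfl fun m _ => by rw [map_mul, hrep, map_prod]; simp
    rw [e, germ_eq_zero_iff]
    filter_upwards [hψΦ] with x hx
    have := congrFun hx α
    simpa [Φ, T, AddSubmonoidClass.coe_finsetSum, Finset.prod_apply] using this

end Hensel

/-! ### Derivations, ideals and a second order Taylor formula -/

section DerivationIdeal

variable {R : Type*} [CommRing R] [Algebra ℂ R]

lemma derivation_mem_pow (δ : Derivation ℂ R R) (I : Ideal R) (N : ℕ) :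
    ∀ a ∈ I ^ (N + 1), δ a ∈ I ^ N := by
  induction N with
  | zero => intro a _; simp
  | succ N ih =>
    intro a ha
    rw [pow_succ'] at ha
    refine Submodule.mul_induction_on ha (fun b hb c hc => ?_) fun b c hb hc => ?_
    · rw [Derivation.leibniz, smul_eq_mul, smul_eq_mul]
      refine add_mem ?_ (Ideal.mul_mem_right _ _ hc)
      rw [pow_succ']
      exact Ideal.mul_mem_mul hb (ih c hc)
    · rw [map_add]; exact add_mem hb hc

lemma derivation_mem_mul (δ : Derivation ℂ R R) {I J : Ideal R} (hI : ∀ a ∈ I, δ a ∈ I)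
    (hJ : ∀ a ∈ J, δ a ∈ J) : ∀ a ∈ I * J, δ a ∈ I * J := by
  intro a ha
  refine Submodule.mul_induction_on ha (fun b hb c hc => ?_) fun b c hb hc => ?_
  · rw [Derivation.leibniz, smul_eq_mul, smul_eq_mul]
    refine add_mem (Ideal.mul_mem_mul hb (hJ c hc)) ?_
    rw [mul_comm c]
    exact Ideal.mul_mem_mul (hI b hb) hc
  · rw [map_add]; exact add_mem hb hc

lemma derivation_mem_pow_of_mem (δ : Derivation ℂ R R) {I : Ideal R} (hI : ∀ a ∈ I, δ a ∈ I)
    (N : ℕ) : ∀ a ∈ I ^ N, δ a ∈ I ^ N := by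
  induction N with
  | zero => intro a _; simp
  | succ N ih => rw [pow_succ]; exact derivation_mem_mul δ ih hI

lemma derivation_mem_span (δ : Derivation ℂ R R) {s : Set R} {J : Ideal R}
    (hs : ∀ a ∈ s, a ∈ J) (hδ : ∀ a ∈ s, δ a ∈ J) : ∀ a ∈ Ideal.span s, δ a ∈ J := by
  intro a ha
  have h : a ∈ J ∧ δ a ∈ J := by
    refine Submodule.span_induction (p := fun a _ => a ∈ J ∧ δ a ∈ J) (fun b hb => ⟨hs b hb, hδ b hb⟩)
      ⟨J.zero_mem, by simp⟩ (fun b c _ _ hb hc => ⟨add_mem hb.1 hc.1, by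
        rw [map_add]; exact add_mem hb.2 hc.2⟩) (fun r b _ hb => ⟨J.smul_mem r hb.1, ?_⟩) ha
    rw [smul_eq_mul, Derivation.leibniz, smul_eq_mul, smul_eq_mul]
    exact add_mem (J.mul_mem_left _ hb.2) (J.mul_mem_right _ hb.1)
  exact h.2

lemma derivation_aeval {σ : Type*} [Fintype σ] [DecidableEq σ] (δ : Derivation ℂ R R) (y : σ → R)
    (G : MvPolynomial σ ℂ) :
    δ (MvPolynomial.aeval y G) = ∑ k, MvPolynomial.aeval y (MvPolynomial.pderiv k G) * δ (y k) := by
  induction G using MvPolynomial.induction_on with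
  | C a => simp
  | add p q hp hq => simp only [map_add, hp, hq, add_mul, Finset.sum_add_distrib]
  | mul_X p i hp =>
    simp only [map_mul, Derivation.leibniz, MvPolynomial.aeval_X, hp, smul_eq_mul,
      MvPolynomial.pderiv_X, Pi.single_apply, map_add, add_mul, Finset.sum_add_distrib]
    congr 1
    · simp
    · rw [Finset.mul_sum]
      exact Finset.sum_congr rfl fun k _ => by ring

/-- The second order Taylor formula for polynomials. -/
lemma exists_taylor {σ : Type*} [Fintype σ] [DecidableEq σ] (y δ : σ → R) (F : MvPolynomial σ ℂ) :
    ∃ C : σ → σ → R, MvPolynomial.aeval (y + δ) F = MvPolynomial.aeval y F +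
      ∑ i, δ i * MvPolynomial.aeval y (MvPolynomial.pderiv i F) +
        ∑ i, ∑ k, δ i * δ k * C i k := by
  induction F using MvPolynomial.induction_on with
  | C a => exact ⟨0, by simp⟩
  | add p q hp hq =>
    obtain ⟨C, hC⟩ := hp
    obtain ⟨C', hC'⟩ := hq
    refine ⟨C + C', ?_⟩
    simp only [map_add, hC, hC', mul_add, Pi.add_apply, Finset.sum_add_distrib]
    ring
  | mul_X p j hp =>
    obtain ⟨C, hC⟩ := hp
    refine ⟨fun i k => C i k * (y j + δ j) +
      if k = j then MvPolynomial.aeval y (MvPolynomial.pderiv i p) else 0, ?_⟩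
    have h1 : ∑ i, ∑ k, δ i * δ k * (C i k * (y j + δ j) +
        if k = j then MvPolynomial.aeval y (MvPolynomial.pderiv i p) else 0) =
        (∑ i, ∑ k, δ i * δ k * C i k) * (y j + δ j) +
          (∑ i, δ i * MvPolynomial.aeval y (MvPolynomial.pderiv i p)) * δ j := by
      simp only [mul_add, Finset.sum_add_distrib, mul_ite, mul_zero, Finset.sum_ite_eq',
        Finset.mem_univ, if_true, Finset.sum_mul]
      rw [Finset.sum_add_distrib.symm]
      congr 1
      · simp only [← Finset.sum_add_distrib]
        refine Finset.sum_congr rfl fun i _ => Finset.sum_congr rfl fun k _ => by ring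
      · exact Finset.sum_congr rfl fun i _ => by ring
    have h2 : ∑ i, δ i * MvPolynomial.aeval y (MvPolynomial.pderiv i (p * MvPolynomial.X j)) =
        (∑ i, δ i * MvPolynomial.aeval y (MvPolynomial.pderiv i p)) * y j +
          δ j * MvPolynomial.aeval y p := by
      simp only [Derivation.leibniz, MvPolynomial.pderiv_X, Pi.single_apply, smul_eq_mul, map_add,
        map_mul, MvPolynomial.aeval_X, mul_add, Finset.sum_add_distrib, Finset.sum_mul]
      rw [add_comm]
      congr 1
      · exact Finset.sum_congr rfl fun i _ => by ring
      · simp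
    rw [h1, h2, map_mul, hC, MvPolynomial.aeval_X, map_mul, MvPolynomial.aeval_X, Pi.add_apply]
    ring

end DerivationIdeal

/-! ### Vector fields and frames dual to coordinates -/

section Frames

variable {n : ℕ}

/-- The module of holomorphic vector fields. -/
def vectorFields (n : ℕ) : Submodule (Hol n) (Derivation ℂ (Hol n) (Hol n)) :=
  Submodule.span (Hol n) (Set.range fun i => pderiv i)

lemma pderiv_mem_vectorFields (i : Fin (n + 1)) : pderiv i ∈ vectorFields n :=
  Submodule.subset_span ⟨i, rfl⟩

/-- The derivations `D` form the frame of vector fields dual to the functions `y`. -/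
structure IsDualFrame (y : Fin (n + 1) → Hol n)
    (D : Fin (n + 1) → Derivation ℂ (Hol n) (Hol n)) : Prop where
  mem : ∀ k, D k ∈ vectorFields n
  dual : ∀ k j, D k (y j) = if k = j then 1 else 0
  expand : ∀ δ ∈ vectorFields n, δ = ∑ k, δ (y k) • D k

lemma sum_smul_derivation_apply {ι : Type*} (s : Finset ι) (a : ι → Hol n)
    (D : ι → Derivation ℂ (Hol n) (Hol n)) (b : Hol n) :
    (∑ i ∈ s, a i • D i) b = ∑ i ∈ s, a i * D i b := by
  classical
  induction s using Finset.induction_on with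
  | empty => simp
  | insert i s hi ih => simp [Finset.sum_insert hi, ih]

/-- The Jacobian matrix is invertible over `𝒪`, since its determinant is nonzero at `0`; the inverse
supplies the coefficients of the frame. -/
lemma exists_dualFrame {y : Fin (n + 1) → Hol n} (hy : IsCoordinateSystem y) :
    ∃ D, IsDualFrame y D := by
  let J : Matrix (Fin (n + 1)) (Fin (n + 1)) (Hol n) := Matrix.of fun i j => pderiv j (y i)
  have hJ : IsUnit J.det := by
    rw [isUnit_iff_value]
    have := hy.2
    rw [show (Matrix.of fun i j => value n (pderiv j (y i))) = (value n).mapMatrix J from rfl,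
      ← AlgHom.map_det] at this
    exact this
  have hJ1 := Matrix.mul_nonsing_inv J hJ
  have hJ2 := Matrix.nonsing_inv_mul J hJ
  let D : Fin (n + 1) → Derivation ℂ (Hol n) (Hol n) := fun k => ∑ j, J⁻¹ j k • pderiv j
  have hD : ∀ i, pderiv i = ∑ k, pderiv i (y k) • D k := by
    intro i
    simp only [D, Finset.smul_sum, smul_smul]
    rw [Finset.sum_comm]
    have h : ∀ j, ∑ k, (pderiv i (y k) * J⁻¹ j k) • pderiv (n := n) j =
        (if j = i then 1 else 0 : Hol n) • pderiv j := fun j => by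
      rw [← Finset.sum_smul]
      congr 1
      have := congrFun (congrFun hJ2 j) i
      rw [Matrix.mul_apply, Matrix.one_apply] at this
      rw [← this]
      exact Finset.sum_congr rfl fun k _ => mul_comm _ _
    rw [Finset.sum_congr rfl fun j _ => h j]
    simp
  refine ⟨D, fun k => Submodule.sum_mem _ fun j _ =>
    Submodule.smul_mem _ _ (pderiv_mem_vectorFields j), fun k j => ?_, fun δ hδ => ?_⟩
  · rw [sum_smul_derivation_apply]
    have := congrFun (congrFun hJ1 j) k
    rw [Matrix.mul_apply, Matrix.one_apply] at this
    simp only [eq_comm (a := k)]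
    rw [← this]
    exact Finset.sum_congr rfl fun i _ => mul_comm _ _
  · refine Submodule.span_induction (p := fun δ _ => δ = ∑ k, δ (y k) • D k) ?_ (by simp) ?_ ?_ hδ
    · rintro _ ⟨i, rfl⟩
      exact hD i
    · intro a b _ _ ha hb
      conv_lhs => rw [ha, hb]
      simp only [Derivation.add_apply, add_smul, Finset.sum_add_distrib]
    · intro r a _ ha
      conv_lhs => rw [ha]
      simp only [Derivation.smul_apply, smul_eq_mul, Finset.smul_sum, smul_smul]

variable {y : Fin (n + 1) → Hol n} {D : Fin (n + 1) → Derivation ℂ (Hol n) (Hol n)}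

lemma IsDualFrame.expand_apply (h : IsDualFrame y D) {δ : Derivation ℂ (Hol n) (Hol n)}
    (hδ : δ ∈ vectorFields n) (a : Hol n) : δ a = ∑ k, δ (y k) * D k a := by
  conv_lhs => rw [h.expand δ hδ]
  rw [sum_smul_derivation_apply]

lemma IsDualFrame.apply_aeval (h : IsDualFrame y D) (k : Fin (n + 1))
    (G : MvPolynomial (Fin (n + 1)) ℂ) :
    D k (MvPolynomial.aeval y G) = MvPolynomial.aeval y (MvPolynomial.pderiv k G) := by
  rw [derivation_aeval]
  simp [h.dual]

/-- The Jacobian criterion with respect to an arbitrary frame. -/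
lemma IsDualFrame.isCoordinateSystem (h : IsDualFrame y D) (hy : IsCoordinateSystem y)
    {z : Fin (n + 1) → Hol n} (hz : ∀ i, z i ∈ 𝔪 n)
    (hdet : (Matrix.of fun i j => value n (D j (z i))).det ≠ 0) : IsCoordinateSystem z := by
  refine ⟨hz, ?_⟩
  have : (Matrix.of fun i j => value n (pderiv j (z i))) =
      (Matrix.of fun i j => value n (D j (z i))) *
        (Matrix.of fun i j => value n (pderiv j (y i))) := by
    ext i j
    rw [Matrix.mul_apply, Matrix.of_apply, h.expand_apply (pderiv_mem_vectorFields j), map_sum]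
    refine Finset.sum_congr rfl fun k _ => ?_
    rw [map_mul, mul_comm]
    rfl
  rw [this, Matrix.det_mul]
  exact mul_ne_zero hdet hy.2

lemma value_derivation_of_mem_sq (δ : Derivation ℂ (Hol n) (Hol n)) {a : Hol n}
    (ha : a ∈ 𝔪 n ^ 2) : value n (δ a) = 0 := by
  have := derivation_mem_pow δ (𝔪 n) 1 a ha
  rwa [pow_one] at this

lemma isCoordinateSystem_coordX : IsCoordinateSystem (coordX (n := n)) := by
  refine ⟨coordX_mem, ?_⟩
  have : (Matrix.of fun i j => value n (pderiv j (coordX (n := n) i))) = 1 := by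
    ext i j
    rw [Matrix.of_apply, pderiv_coordX, Matrix.one_apply]
    simp only [eq_comm (a := j)]
    split_ifs <;> simp
  rw [this, Matrix.det_one]
  exact one_ne_zero

/-- Writing `y = c x` with a matrix `c` over `𝒪`, the value of `c` at `0` is the Jacobian matrix, so
`c` is invertible and `x` is a combination of `y`. -/
lemma 𝔪_eq_span (hy : IsCoordinateSystem y) : 𝔪 n = Ideal.span (Set.range y) := by
  apply le_antisymm
  · have h1 : ∀ i, ∃ c : Fin (n + 1) → Hol n, ∑ j, c j * coordX j = y i := fun i => by
      have := hy.1 i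
      rw [𝔪_eq_span_coordX] at this
      obtain ⟨c, hc⟩ := (Ideal.mem_span_range_iff_exists_fun).1 this
      exact ⟨c, hc⟩
    choose c hc using h1
    have hcv : ∀ i j, value n (pderiv j (y i)) = value n (c i j) := fun i j => by
      rw [← hc, map_sum, map_sum]
      simp only [Derivation.leibniz, pderiv_coordX, smul_eq_mul, map_add, map_mul,
        mem_𝔪.1 (coordX_mem _), zero_mul, add_zero, apply_ite (value n), map_one, map_zero]
      simp
    have hu : IsUnit (Matrix.of c).det := by
      rw [isUnit_iff_value]
      have := hy.2
      have e : (Matrix.of fun i j => value n (pderiv j (y i))) = (value n).mapMatrix (Matrix.of c) := by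
        ext i j
        exact hcv i j
      rwa [e, ← AlgHom.map_det] at this
    have h2 : (Matrix.of c)⁻¹.mulVec y = coordX := by
      have : y = (Matrix.of c).mulVec coordX := funext fun i => (hc i).symm
      rw [this, Matrix.mulVec_mulVec, Matrix.nonsing_inv_mul _ hu, Matrix.one_mulVec]
    rw [𝔪_eq_span_coordX, Ideal.span_le]
    rintro _ ⟨i, rfl⟩
    rw [← h2]
    change ∑ j, _ * y j ∈ Ideal.span (Set.range y)
    exact Ideal.sum_mem _ fun j _ => Ideal.mul_mem_left _ _ (Ideal.subset_span ⟨j, rfl⟩)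
  · rw [Ideal.span_le]
    rintro _ ⟨i, rfl⟩
    exact hy.1 i

lemma derivation_mem_tjurina (f : Hol n) {δ : Derivation ℂ (Hol n) (Hol n)}
    (hδ : δ ∈ vectorFields n) : δ f ∈ tjurina f := by
  refine Submodule.span_induction (p := fun δ _ => δ f ∈ tjurina f) ?_ (by simp) ?_ ?_ hδ
  · rintro _ ⟨i, rfl⟩
    exact Ideal.subset_span (Or.inr ⟨i, rfl⟩)
  · intro a b _ _ ha hb
    exact add_mem ha hb
  · intro r a _ ha
    exact Ideal.mul_mem_left _ _ ha

/-- The Tjurina ideal in terms of an arbitrary frame. -/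
lemma IsDualFrame.tjurina_eq (h : IsDualFrame y D) (f : Hol n) :
    tjurina f = Ideal.span (insert f (Set.range fun k => D k f)) := by
  apply le_antisymm
  · refine Ideal.span_le.2 ?_
    rintro _ (rfl | ⟨i, rfl⟩)
    · exact Ideal.subset_span (Or.inl rfl)
    · change pderiv i f ∈ _
      rw [h.expand_apply (pderiv_mem_vectorFields i)]
      exact Ideal.sum_mem _ fun k _ => Ideal.mul_mem_left _ _ (Ideal.subset_span (Or.inr ⟨k, rfl⟩))
  · refine Ideal.span_le.2 ?_
    rintro _ (rfl | ⟨k, rfl⟩)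
    · exact Ideal.subset_span (Or.inl rfl)
    · exact derivation_mem_tjurina f (h.mem k)

end Frames

/-! ### Finite determinacy via the implicit function theorem -/

section Determinacy

variable {n : ℕ}

lemma exists_sum_of_mem_mul_sq {R κ : Type*} [CommRing R] [Fintype κ] {M : Ideal R} {g : κ → R}
    {p : R} (hp : p ∈ M * Ideal.span (Set.range g) ^ 2) :
    ∃ m : κ × κ → R, (∀ a, m a ∈ M) ∧ p = ∑ a, m a * (g a.1 * g a.2) := by
  have h1 : Ideal.span (Set.range g) ^ 2 = Ideal.span (Set.range fun a : κ × κ => g a.1 * g a.2) := by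
    rw [pow_two, Ideal.span_mul_span']
    congr 1
    ext x
    simp [Set.mem_mul]
  rw [h1, ← smul_eq_mul, Submodule.mem_ideal_smul_span_iff_exists_sum] at hp
  obtain ⟨a, ha, rfl⟩ := hp
  refine ⟨a, ha, ?_⟩
  rw [Finsupp.sum_fintype _ _ (by simp)]
  rfl

/-- The index `none` stands for the function itself and `some i` for its `i`-th partial derivative.
Moving the coordinates by `δ` and multiplying by `1 + U`, both linear in the generators `g` with
coefficients `T`, changes the function by `∑ g_a g_b (T_ab + …)`, where the dots are quadratic in
the `T`. Any prescribed small coefficients of `g_a g_b` can therefore be reached. -/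
lemma one_add_mul_taylor {S σ : Type*} [CommRing S] [Fintype σ] (T : Option σ → Option σ → S)
    (g : Option σ → S) (C : σ → σ → S) (δ B : σ → S) (U : S)
    (hδ : ∀ i, δ i = ∑ l, T (some i) l * g l) (hU : U = ∑ l, T none l * g l)
    (hB : ∀ i, B i = g (some i) + ∑ k, δ k * C i k) :
    (1 + U) * (g none + ∑ i, δ i * g (some i) + ∑ i, ∑ k, δ i * δ k * C i k) = g none +
      ∑ a : Option σ × Option σ, g a.1 * g a.2 * (T a.1 a.2 +
        ((∑ i, ∑ k, T (some i) a.1 * T (some k) a.2 * C i k) +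
          ∑ i, T none a.1 * T (some i) a.2 * B i)) := by
  have e0 : ∑ i, δ i * B i = ∑ i, δ i * g (some i) + ∑ i, ∑ k, δ i * δ k * C i k := by
    simp only [hB, mul_add, Finset.sum_add_distrib, Finset.mul_sum, ← mul_assoc]
  have e2 : U * g none + ∑ i, δ i * g (some i) =
      ∑ a : Option σ × Option σ, g a.1 * g a.2 * T a.1 a.2 := by
    rw [Fintype.sum_prod_type, Fintype.sum_option]
    simp only [hU, hδ, Finset.sum_mul]
    congr 1
    · exact Finset.sum_congr rfl fun l _ => by ring
    · exact Finset.sum_congr rfl fun i _ => Finset.sum_congr rfl fun l _ => by ring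
  have e3 : ∑ i, ∑ k, δ i * δ k * C i k = ∑ a : Option σ × Option σ, g a.1 * g a.2 *
      ∑ i, ∑ k, T (some i) a.1 * T (some k) a.2 * C i k := by
    simp only [Finset.mul_sum]
    rw [Finset.sum_comm]
    conv_rhs => rw [Finset.sum_comm]
    rw [Finset.sum_comm]
    refine Finset.sum_congr rfl fun i _ => ?_
    rw [Finset.sum_comm]
    refine Finset.sum_congr rfl fun k _ => ?_
    rw [Fintype.sum_prod_type]
    simp only [hδ, Finset.sum_mul, Finset.mul_sum]
    rw [Finset.sum_comm]
    exact Finset.sum_congr rfl fun j _ => Finset.sum_congr rfl fun l _ => by ring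
  have e4 : U * ∑ i, δ i * B i = ∑ a : Option σ × Option σ, g a.1 * g a.2 *
      ∑ i, T none a.1 * T (some i) a.2 * B i := by
    simp only [Finset.mul_sum]
    rw [Finset.sum_comm]
    refine Finset.sum_congr rfl fun i _ => ?_
    rw [Fintype.sum_prod_type]
    simp only [hU, hδ, Finset.sum_mul, Finset.mul_sum]
    rw [Finset.sum_comm]
    exact Finset.sum_congr rfl fun j _ => Finset.sum_congr rfl fun l _ => by ring
  simp only [mul_add, Finset.sum_add_distrib] at e2 e3 e4 ⊢
  rw [← e2, ← e3, ← e4, e0]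
  ring

/-- Polynomials in variables indexed by pairs of elements of `{none, 0, …, n}`. -/
abbrev PairPolynomial (n : ℕ) : Type :=
  MvPolynomial (Option (Fin (n + 1)) × Option (Fin (n + 1))) (Hol n)

/-- Adding to a polynomial in coordinates an element of `𝔪 I²`, with `I` the Tjurina ideal, only
changes the coordinates and multiplies by a unit. -/
theorem exists_coordinate_change {y : Fin (n + 1) → Hol n} (hy : IsCoordinateSystem y)
    (F : MvPolynomial (Fin (n + 1)) ℂ) (hI : tjurina (MvPolynomial.aeval y F) ≤ 𝔪 n) {p : Hol n}
    (hp : p ∈ 𝔪 n * tjurina (MvPolynomial.aeval y F) ^ 2) :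
    ∃ z : Fin (n + 1) → Hol n, IsCoordinateSystem z ∧
      Associated (MvPolynomial.aeval y F + p) (MvPolynomial.aeval z F) := by
  obtain ⟨D, hD⟩ := exists_dualFrame hy
  let g : Option (Fin (n + 1)) → Hol n := fun o =>
    o.elim (MvPolynomial.aeval y F) fun i => MvPolynomial.aeval y (MvPolynomial.pderiv i F)
  have hg : tjurina (MvPolynomial.aeval y F) = Ideal.span (Set.range g) := by
    rw [hD.tjurina_eq]
    congr 1
    ext a
    simp only [hD.apply_aeval, Set.mem_insert_iff, Set.mem_range, Option.exists]
    simp [g, eq_comm]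
  have hg𝔪 : ∀ o, g o ∈ 𝔪 n := fun o => hI (hg ▸ Ideal.subset_span ⟨o, rfl⟩)
  rw [hg] at hp
  obtain ⟨m, hm, rfl⟩ := exists_sum_of_mem_mul_sq hp
  -- The coefficients of the displacement and of the unit are unknowns. The equations are `T + Q =
  -- m` with `m` in `𝔪` and `Q` without constant or linear terms, which is the situation of
  -- `exists_hensel`.
  let T : Option (Fin (n + 1)) → Option (Fin (n + 1)) → PairPolynomial n := fun j l =>
    MvPolynomial.X (j, l)
  let δ : Fin (n + 1) → PairPolynomial n := fun i => ∑ l, T (some i) l * MvPolynomial.C (g l)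
  let U : PairPolynomial n := ∑ l, T none l * MvPolynomial.C (g l)
  let Y : Fin (n + 1) → PairPolynomial n := fun i => MvPolynomial.C (y i)
  obtain ⟨C, hC⟩ := exists_taylor Y δ F
  have hCY : ∀ G : MvPolynomial (Fin (n + 1)) ℂ,
      MvPolynomial.aeval Y G = MvPolynomial.C (MvPolynomial.aeval y G) := fun G => by
    have := MvPolynomial.comp_aeval_apply y ((Algebra.ofId (Hol n)
      (PairPolynomial n)).restrictScalars ℂ) G
    exact this.symm
  let B : Fin (n + 1) → PairPolynomial n := fun i =>
    MvPolynomial.C (g (some i)) + ∑ k, δ k * C i k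
  have hB : MvPolynomial.aeval (Y + δ) F = MvPolynomial.C (g none) +
      ∑ i, δ i * MvPolynomial.C (g (some i)) + ∑ i, ∑ k, δ i * δ k * C i k := by
    rw [hC, hCY]
    simp only [hCY]
    rfl
  let Q : Option (Fin (n + 1)) → Option (Fin (n + 1)) → PairPolynomial n := fun j l =>
    (∑ i, ∑ k, T (some i) j * T (some k) l * C i k) +
    ∑ i, T none j * T (some i) l * B i
  let G : Option (Fin (n + 1)) × Option (Fin (n + 1)) → PairPolynomial n := fun a =>
    T a.1 a.2 + Q a.1 a.2 - MvPolynomial.C (m a)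
  have hT0 : ∀ j l, MvPolynomial.constantCoeff (T j l) = 0 := fun j l => by simp [T]
  have hQ0 : ∀ j l, MvPolynomial.constantCoeff (Q j l) = 0 := fun j l => by
    simp [Q, hT0]
  have hQ1 : ∀ j l b, MvPolynomial.constantCoeff (MvPolynomial.pderiv b (Q j l)) = 0 :=
    fun j l b => by
      simp [Q, hT0, Derivation.leibniz]
  obtain ⟨t, ht, htG⟩ := exists_hensel G (fun a => by
      simp only [G, map_sub, map_add, hT0, hQ0, MvPolynomial.constantCoeff_C, zero_add, zero_sub]
      exact neg_mem (hm a)) fun a b => by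
      have : MvPolynomial.constantCoeff (MvPolynomial.pderiv b (G a)) -
          (if a = b then 1 else 0) = 0 := by
        simp only [G, map_sub, map_add, hQ1, MvPolynomial.pderiv_C, add_zero, sub_zero, T]
        rw [MvPolynomial.pderiv_X, Pi.single_apply]
        by_cases hab : a = b
        · subst hab; simp
        · simp [hab]
      rw [this]
      exact Ideal.zero_mem _
  have key : (1 + U) * MvPolynomial.aeval (Y + δ) F = MvPolynomial.C (g none) +
      ∑ a : Option (Fin (n + 1)) × Option (Fin (n + 1)),
        MvPolynomial.C (g a.1 * g a.2) * (T a.1 a.2 + Q a.1 a.2) := by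
    rw [hB, one_add_mul_taylor T (fun l => MvPolynomial.C (g l)) C δ B U (fun _ => rfl) rfl
      fun _ => rfl]
    simp only [map_mul, Q]
  let z : Fin (n + 1) → Hol n := fun i => y i + ∑ l, t (some i, l) * g l
  let u : Hol n := 1 + ∑ l, t (none, l) * g l
  have hev := congrArg (MvPolynomial.eval t) key
  have hz : MvPolynomial.eval t (MvPolynomial.aeval (Y + δ) F) = MvPolynomial.aeval z F := by
    have := MvPolynomial.comp_aeval_apply (Y + δ)
      ((MvPolynomial.aeval (R := Hol n) t : PairPolynomial n →ₐ[Hol n] Hol n).restrictScalars ℂ) F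
    rw [AlgHom.restrictScalars_apply] at this
    refine Eq.trans this ?_
    congr 2
    funext i
    simp [Y, δ, T, z]
  have hmain : u * MvPolynomial.aeval z F = MvPolynomial.aeval y F + ∑ a, m a * (g a.1 * g a.2) := by
    rw [map_mul, hz] at hev
    have hu : MvPolynomial.eval t (1 + U) = u := by simp [U, T, u]
    rw [hu] at hev
    rw [hev, map_add, map_sum, MvPolynomial.eval_C]
    congr 1
    refine Finset.sum_congr rfl fun a _ => ?_
    have := htG a
    simp only [G, map_sub, MvPolynomial.eval_C, sub_eq_zero] at this
    rw [map_mul, this, MvPolynomial.eval_C, mul_comm]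
  -- The displacement has order two, so the Jacobian matrix at `0` does not change.
  have hsum : ∀ o : Option (Fin (n + 1)), ∑ l, t (o, l) * g l ∈ 𝔪 n ^ 2 := fun o =>
    Ideal.sum_mem _ fun l _ => by
      rw [pow_two]; exact Ideal.mul_mem_mul (ht _) (hg𝔪 l)
  refine ⟨z, ⟨fun i => add_mem (hy.1 i) (Ideal.pow_le_self two_ne_zero (hsum _)), ?_⟩, ?_⟩
  · have : (Matrix.of fun i j => value n (pderiv j (z i))) =
        Matrix.of fun i j => value n (pderiv j (y i)) := by
      ext i j
      simp only [Matrix.of_apply, z, map_add, value_derivation_of_mem_sq _ (hsum (some i)),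
        add_zero]
    rw [this]
    exact hy.2
  · have hu : IsUnit u := by
      rw [isUnit_iff_value, map_add, map_one,
        mem_𝔪.1 (Ideal.pow_le_self two_ne_zero (hsum none)), add_zero]
      exact one_ne_zero
    rw [← hmain, mul_comm]
    exact (associated_mul_unit_left _ _ hu)

end Determinacy

/-! ### Generalized eigenspaces modulo an invariant subspace -/

section GeneralizedWeights

variable {V : Type*} [AddCommGroup V] [Module ℂ V] {T : Module.End ℂ V} {K : Submodule ℂ V}

/-- The vectors that are generalized eigenvectors of `T` with eigenvalue `c` modulo the `T`-stable
subspace `K`. -/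
def genWeight (hK : K ≤ K.comap T) (c : ℂ) : Submodule ℂ V :=
  (Module.End.maxGenEigenspace (K.mapQ K T hK) c).comap K.mkQ

lemma mem_genWeight {hK : K ≤ K.comap T} {c : ℂ} {a : V} :
    a ∈ genWeight hK c ↔ ∃ k : ℕ, ((T - c • 1) ^ k) a ∈ K := by
  have h : ∀ k : ℕ, ((K.mapQ K T hK - c • 1) ^ k) (K.mkQ a) = K.mkQ (((T - c • 1) ^ k) a) := by
    intro k
    induction k with
    | zero => simp
    | succ k ih => rw [pow_succ', Module.End.mul_apply, ih, pow_succ', Module.End.mul_apply]; simp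
  rw [genWeight, Submodule.mem_comap, Module.End.mem_maxGenEigenspace]
  refine exists_congr fun k => ?_
  rw [h, Submodule.mkQ_apply, Submodule.Quotient.mk_eq_zero]

lemma le_genWeight (hK : K ≤ K.comap T) (c : ℂ) : K ≤ genWeight hK c := fun a ha =>
  mem_genWeight.2 ⟨0, by simpa using ha⟩

lemma mem_genWeight_of_apply_sub {hK : K ≤ K.comap T} {c : ℂ} {a : V}
    (h : T a - c • a ∈ genWeight hK c) : a ∈ genWeight hK c := by
  obtain ⟨k, hk⟩ := mem_genWeight.1 h
  refine mem_genWeight.2 ⟨k + 1, ?_⟩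
  rw [pow_succ, Module.End.mul_apply]
  simpa using hk

lemma iSup_genWeight (hK : K ≤ K.comap T) [FiniteDimensional ℂ (V ⧸ K)] :
    ⨆ c, genWeight hK c = ⊤ := by
  have h : (⨆ c, genWeight hK c).map K.mkQ = ⊤ := by
    rw [Submodule.map_iSup, ← Module.End.iSup_maxGenEigenspace_eq_top (K.mapQ K T hK)]
    exact iSup_congr fun c => Submodule.map_comap_eq_of_surjective (Submodule.mkQ_surjective K) _
  rw [eq_top_iff]
  intro a _
  obtain ⟨b, hb, hab⟩ : K.mkQ a ∈ (⨆ c, genWeight hK c).map K.mkQ := h ▸ Submodule.mem_top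
  have : a - b ∈ K := by
    rw [← Submodule.Quotient.mk_eq_zero, Submodule.Quotient.mk_sub, sub_eq_zero]
    exact hab.symm
  rw [← sub_add_cancel a b]
  exact add_mem (Submodule.mem_iSup_of_mem 0 (le_genWeight hK 0 this)) hb

/-- Independence of the generalized eigenspaces on the quotient: a vector of weight `c` congruent to
a sum of vectors of other weights is zero there. -/
lemma mem_of_sub_mem_of_mem_iSup {hK : K ≤ K.comap T} {c : ℂ} {a b : V} (ha : a ∈ genWeight hK c)
    (hb : b ∈ ⨆ (d) (_ : d ≠ c), genWeight hK d) (hab : a - b ∈ K) : a ∈ K := by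
  have h := Module.End.independent_maxGenEigenspace (K.mapQ K T hK) c
  have hab' : K.mkQ a = K.mkQ b := by
    rw [← sub_eq_zero, ← map_sub]
    exact (Submodule.Quotient.mk_eq_zero K).2 hab
  have hb' : K.mkQ b ∈ ⨆ (d) (_ : d ≠ c), Module.End.maxGenEigenspace (K.mapQ K T hK) d := by
    have := Submodule.mem_map_of_mem (f := K.mkQ) hb
    simp only [Submodule.map_iSup] at this
    exact iSup₂_mono (fun d _ => Submodule.map_comap_le _ _) this
  have := Submodule.disjoint_def.1 h (K.mkQ a) ha (hab' ▸ hb')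
  exact (Submodule.Quotient.mk_eq_zero K).1 this

end GeneralizedWeights

/-! ### Trace as a sum of generalized eigenvalues -/

section Trace

variable {V : Type*} [AddCommGroup V] [Module ℂ V]

/-- Pointwise version of the nilpotency of a difference of commuting nilpotents: applying `g - m`
gives terms in which one of the two exponents has dropped. -/
lemma mem_maxGenEigenspace_sub {g m : Module.End ℂ V} (hc : Commute g m) (i j : ℕ) :
    ∀ x, (g ^ i) x = 0 → (m ^ j) x = 0 → x ∈ (g - m).maxGenEigenspace 0 := by
  have hstep : ∀ x, (g - m) x ∈ (g - m).maxGenEigenspace 0 → x ∈ (g - m).maxGenEigenspace 0 := by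
    intro x hx
    rw [Module.End.mem_maxGenEigenspace] at hx ⊢
    obtain ⟨k, hk⟩ := hx
    exact ⟨k + 1, by rw [pow_succ, Module.End.mul_apply]; simpa using hk⟩
  induction i generalizing j with
  | zero => intro x hx _; simp only [pow_zero, Module.End.one_apply] at hx; simp [hx]
  | succ i ih =>
    induction j with
    | zero => intro x _ hx; simp only [pow_zero, Module.End.one_apply] at hx; simp [hx]
    | succ j ih' =>
      intro x hg hm
      apply hstep
      rw [LinearMap.sub_apply]
      refine sub_mem (ih (j + 1) _ (by rwa [← Module.End.mul_apply, ← pow_succ]) ?_)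
        (ih' _ ?_ (by rwa [← Module.End.mul_apply, ← pow_succ]))
      · rw [← Module.End.mul_apply, ← (hc.pow_right (j + 1)).eq, Module.End.mul_apply, hm, map_zero]
      · rw [← Module.End.mul_apply, (hc.pow_left (i + 1)).eq, Module.End.mul_apply, hg, map_zero]

/-- By the Jordan–Chevalley decomposition the nilpotent part has trace zero, and each `b i` is a
true eigenvector of the semisimple part. -/
lemma trace_eq_sum_of_mem_maxGenEigenspace {ι : Type*} [Fintype ι] [DecidableEq ι]
    (b : Module.Basis ι ℂ V) {A : Module.End ℂ V} {w : ι → ℂ}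
    (h : ∀ i, b i ∈ A.maxGenEigenspace (w i)) : LinearMap.trace ℂ V A = ∑ i, w i := by
  have := Module.Finite.of_basis b
  obtain ⟨m, hm, s, hs, hmn, hss, hA⟩ := A.exists_isNilpotent_isSemisimple
  have hcomm : Commute A m := Algebra.commute_of_mem_adjoin_self hm
  have hsA : s = A - m := by rw [hA]; abel
  have hsb : ∀ i, s (b i) = w i • b i := by
    intro i
    have h1 : b i ∈ s.maxGenEigenspace (w i) := by
      obtain ⟨k, hk⟩ := (Module.End.mem_maxGenEigenspace _ _ _).1 (h i)
      obtain ⟨j, hj⟩ := hmn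
      have := mem_maxGenEigenspace_sub (g := A - w i • 1) (m := m)
        (hcomm.sub_left ((Commute.one_left m).smul_left _)) k j (b i) hk (by rw [hj]; rfl)
      rw [Module.End.maxGenEigenspace_eq_maxGenEigenspace_zero, hsA, sub_right_comm]
      exact this
    rw [hss.isFinitelySemisimple.maxGenEigenspace_eq_eigenspace] at h1
    exact Module.End.mem_eigenspace_iff.1 h1
  rw [hA, map_add, (LinearMap.isNilpotent_trace_of_isNilpotent hmn).eq_zero, zero_add,
    LinearMap.trace_eq_matrix_trace ℂ b, Matrix.trace]
  refine Finset.sum_congr rfl fun i _ => ?_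
  rw [Matrix.diag_apply, LinearMap.toMatrix_apply, hsb]
  simp

end Trace

/-! ### Weights of a vector field modulo a power of the maximal ideal -/

section Weights

variable {n : ℕ}

lemma isDualFrame_pderiv : IsDualFrame (coordX (n := n)) (fun i => pderiv i) := by
  obtain ⟨D, hD⟩ := exists_dualFrame (isCoordinateSystem_coordX (n := n))
  have : D = fun i => pderiv i := by
    funext i
    rw [hD.expand _ (pderiv_mem_vectorFields i)]
    simp [pderiv_coordX]
  exact this ▸ hD

/-- The powers of the maximal ideal, as complex subspaces. -/
def 𝔪pow (n N : ℕ) : Submodule ℂ (Hol n) := (𝔪 n ^ N).restrictScalars ℂ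

lemma sub_value_mem (a : Hol n) : a - algebraMap ℂ (Hol n) (value n a) ∈ 𝔪 n := by
  rw [mem_𝔪, map_sub, AlgHom.commutes]; simp

lemma exists_polynomial_approx {y : Fin (n + 1) → Hol n} (hy : IsCoordinateSystem y) (N : ℕ) :
    ∀ a : Hol n, ∃ G : MvPolynomial (Fin (n + 1)) ℂ, G.totalDegree ≤ N ∧
      a - MvPolynomial.aeval y G ∈ 𝔪 n ^ N := by
  induction N with
  | zero => exact fun a => ⟨0, by simp, by simp⟩
  | succ N ih =>
    intro a
    have h := sub_value_mem a
    rw [𝔪_eq_span hy] at h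
    obtain ⟨b, hb⟩ := Ideal.mem_span_range_iff_exists_fun.1 h
    choose G hG using ih
    refine ⟨MvPolynomial.C (value n a) + ∑ i, G (b i) * MvPolynomial.X i, ?_, ?_⟩
    · refine (MvPolynomial.totalDegree_add _ _).trans (max_le (by simp)
        (MvPolynomial.totalDegree_finsetSum_le fun i _ => ?_))
      refine (MvPolynomial.totalDegree_mul _ _).trans (add_le_add (hG _).1 ?_)
      simp
    · have : a - MvPolynomial.aeval y (MvPolynomial.C (value n a) + ∑ i, G (b i) * MvPolynomial.X i) =
          ∑ i, (b i - MvPolynomial.aeval y (G (b i))) * y i := by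
        simp only [map_add, map_sum, map_mul, MvPolynomial.aeval_X, MvPolynomial.aeval_C, sub_mul,
          Finset.sum_sub_distrib, hb]
        ring
      rw [this, pow_succ]
      exact Ideal.sum_mem _ fun i _ => Ideal.mul_mem_mul (hG _).2 (hy.1 i)

instance finite_quotient_𝔪pow (N : ℕ) : FiniteDimensional ℂ (Hol n ⧸ 𝔪pow n N) := by
  have : FiniteDimensional ℂ (MvPolynomial.restrictTotalDegree (Fin (n + 1)) ℂ N) := inferInstance
  refine Module.Finite.of_surjective (((𝔪pow n N).mkQ ∘ₗ
    (MvPolynomial.aeval (coordX (n := n))).toLinearMap) ∘ₗ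
      (MvPolynomial.restrictTotalDegree (Fin (n + 1)) ℂ N).subtype) fun q => ?_
  obtain ⟨a, rfl⟩ := Submodule.mkQ_surjective _ q
  obtain ⟨G, hG, hGa⟩ := exists_polynomial_approx (isCoordinateSystem_coordX (n := n)) N a
  refine ⟨⟨G, (MvPolynomial.mem_restrictTotalDegree _ _ _).2 hG⟩, ?_⟩
  symm
  rw [← sub_eq_zero]
  exact (Submodule.Quotient.mk_eq_zero (𝔪pow n N)).2 hGa

section

variable {N : ℕ} {T : Module.End ℂ (Hol n)} {hT : 𝔪pow n N ≤ (𝔪pow n N).comap T} {t : ℂ}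

lemma value_eq_zero_of_mem_genWeight (hN : N ≠ 0) (ht : ∀ a, value n (T a) = t * value n a) {c : ℂ}
    (hc : c ≠ t) {a : Hol n} (ha : a ∈ genWeight hT c) : value n a = 0 := by
  obtain ⟨k, hk⟩ := mem_genWeight.1 ha
  have h1 : ∀ k : ℕ, value n (((T - c • 1) ^ k) a) = (t - c) ^ k * value n a := by
    intro k
    induction k with
    | zero => simp
    | succ k ih =>
      rw [pow_succ', Module.End.mul_apply]
      simp only [LinearMap.sub_apply, LinearMap.smul_apply, Module.End.one_apply, map_sub, map_smul,
        ih, ht, smul_eq_mul]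
      ring
  have h2 := mem_𝔪.1 (Ideal.pow_le_self hN hk)
  rw [h1] at h2
  exact (mul_eq_zero.1 h2).resolve_left (pow_ne_zero _ (sub_ne_zero.2 hc.symm))

/-- Weight vectors of eigenvalue other than `t` vanish at `0`. As the weight spaces span, one of
weight `t` does not. -/
lemma exists_isUnit_mem_genWeight (hN : N ≠ 0) (ht : ∀ a, value n (T a) = t * value n a) :
    ∃ u ∈ genWeight hT t, IsUnit u := by
  by_contra! h
  have h1 : ⨆ c, genWeight hT c ≤ LinearMap.ker (value n).toLinearMap := by
    refine iSup_le fun c a ha => ?_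
    rw [LinearMap.mem_ker]
    change value n a = 0
    by_cases hc : c = t
    · subst hc
      by_contra hv
      exact h a ha (isUnit_iff_value.2 hv)
    · exact value_eq_zero_of_mem_genWeight hN ht hc ha
  rw [iSup_genWeight] at h1
  have := h1 (Submodule.mem_top (x := (1 : Hol n)))
  rw [LinearMap.mem_ker] at this
  change value n 1 = 0 at this
  simp at this

end

section

variable {N : ℕ} {η : Derivation ℂ (Hol n) (Hol n)}

lemma derivation_stable (hη : ∀ a, η a ∈ 𝔪 n) (N : ℕ) :
    𝔪pow n N ≤ (𝔪pow n N).comap (η : Module.End ℂ (Hol n)) :=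
  fun a ha => derivation_mem_pow_of_mem η (fun b _ => hη b) N a ha

/-- By the Leibniz rule `(η - c - d)(a b) = (η - c)(a) b + a (η - d)(b)`; induct on the two
nilpotency exponents. -/
lemma mul_mem_genWeight (hη : ∀ a, η a ∈ 𝔪 n) {c d : ℂ} {a b : Hol n}
    (ha : a ∈ genWeight (derivation_stable hη N) c) (hb : b ∈ genWeight (derivation_stable hη N) d) :
    a * b ∈ genWeight (derivation_stable hη N) (c + d) := by
  obtain ⟨i, hi⟩ := mem_genWeight.1 ha
  obtain ⟨j, hj⟩ := mem_genWeight.1 hb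
  clear ha hb
  induction i generalizing j a b with
  | zero => exact le_genWeight _ _ (Ideal.mul_mem_right b _ hi)
  | succ i ih =>
    induction j generalizing b with
    | zero => exact le_genWeight _ _ (Ideal.mul_mem_left _ a hj)
    | succ j ih' =>
      apply mem_genWeight_of_apply_sub
      have h1 := ih (a := η a - c • a) (b := b) (j := j + 1)
        (by rw [pow_succ, Module.End.mul_apply] at hi; simpa using hi) hj
      have h2 := ih' (b := η b - d • b) (by rw [pow_succ, Module.End.mul_apply] at hj; simpa using hj)
      convert add_mem h1 h2 using 1
      rw [Derivation.coeFn_coe, Derivation.leibniz, smul_eq_mul, smul_eq_mul, add_smul, sub_mul,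
        mul_sub, smul_mul_assoc, mul_smul_comm]
      ring

lemma one_mem_genWeight (hη : ∀ a, η a ∈ 𝔪 n) : 1 ∈ genWeight (derivation_stable hη N) 0 :=
  mem_genWeight_of_apply_sub (by simp)

lemma aeval_mem_genWeight (hη : ∀ a, η a ∈ 𝔪 n) {y : Fin (n + 1) → Hol n} {w : Fin (n + 1) → ℂ}
    (hy : ∀ i, y i ∈ genWeight (derivation_stable hη N) (w i)) {G : MvPolynomial (Fin (n + 1)) ℂ}
    {c : ℂ} (hG : G.IsWeightedHomogeneous w c) :
    MvPolynomial.aeval y G ∈ genWeight (derivation_stable hη N) c := by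
  have hpow : ∀ i (k : ℕ), y i ^ k ∈ genWeight (derivation_stable hη N) (k • w i) := fun i k => by
    induction k with
    | zero => simpa using one_mem_genWeight hη
    | succ k ih => rw [pow_succ, succ_nsmul]; exact mul_mem_genWeight hη ih (hy i)
  have hprod : ∀ (s : Finset (Fin (n + 1))) (m : Fin (n + 1) →₀ ℕ), ∏ i ∈ s, y i ^ m i ∈
      genWeight (derivation_stable hη N) (∑ i ∈ s, m i • w i) := fun s m => by
    classical
    induction s using Finset.induction_on with
    | empty => simpa using one_mem_genWeight hη
    | insert i s hi ih =>
      rw [Finset.prod_insert hi, Finset.sum_insert hi]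
      exact mul_mem_genWeight hη (hpow i _) ih
  rw [MvPolynomial.aeval_def, MvPolynomial.eval₂_eq]
  refine Submodule.sum_mem _ fun m hm => ?_
  rw [← Algebra.smul_def]
  refine Submodule.smul_mem _ _ ?_
  have := hprod m.support m
  rwa [show ∑ i ∈ m.support, m i • w i = c from ?_] at this
  have h := hG (MvPolynomial.mem_support_iff.1 hm)
  rwa [Finsupp.weight_apply, Finsupp.sum] at h

/-- Monomials in weight coordinates are weight vectors. So in any polynomial approximation of `a`
the homogeneous components of degree other than `c` can be dropped, by independence of the weight
spaces. -/
theorem exists_approx_of_mem_genWeight (hη : ∀ a, η a ∈ 𝔪 n) {y : Fin (n + 1) → Hol n}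
    (hy : IsCoordinateSystem y) {w : Fin (n + 1) → ℂ}
    (hyw : ∀ i, y i ∈ genWeight (derivation_stable hη N) (w i)) {c : ℂ} {a : Hol n}
    (ha : a ∈ genWeight (derivation_stable hη N) c) :
    ∃ G : MvPolynomial (Fin (n + 1)) ℂ, G.IsWeightedHomogeneous w c ∧
      a - MvPolynomial.aeval y G ∈ 𝔪 n ^ N := by
  classical
  obtain ⟨G, -, hG⟩ := exists_polynomial_approx hy N a
  have hc := MvPolynomial.weightedHomogeneousComponent_isWeightedHomogeneous (w := w) c G
  refine ⟨_, hc, ?_⟩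
  refine mem_of_sub_mem_of_mem_iSup (sub_mem ha (aeval_mem_genWeight hη hyw hc))
    (b := MvPolynomial.aeval y (G - MvPolynomial.weightedHomogeneousComponent w c G)) ?_ ?_
  · have : G - MvPolynomial.weightedHomogeneousComponent w c G =
        ∑ m ∈ G.support with Finsupp.weight w m ≠ c, MvPolynomial.monomial m (G.coeff m) := by
      rw [MvPolynomial.weightedHomogeneousComponent_apply, sub_eq_iff_eq_add]
      exact G.as_sum.trans
        ((Finset.sum_filter_add_sum_filter_not _ _ _).symm.trans (add_comm _ _))
    rw [this, map_sum]
    refine Submodule.sum_mem _ fun m hm => ?_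
    refine Submodule.mem_iSup_of_mem _ (Submodule.mem_iSup_of_mem (Finset.mem_filter.1 hm).2 ?_)
    exact aeval_mem_genWeight hη hyw (MvPolynomial.isWeightedHomogeneous_monomial _ _ _ rfl)
  · rw [map_sub, sub_sub_sub_cancel_right]
    exact hG

/-- The linear part of a germ. -/
def linearPart (n : ℕ) : Hol n →ₗ[ℂ] (Fin (n + 1) → ℂ) :=
  LinearMap.pi fun j => (value n).toLinearMap ∘ₗ (pderiv j : Hol n →ₗ[ℂ] Hol n)

lemma linearPart_apply (a : Hol n) (j : Fin (n + 1)) : linearPart n a j = value n (pderiv j a) := rfl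

/-- Since `η` vanishes at `0`, it acts on linear parts through a matrix, whose trace is the
divergence of `η` at `0`. -/
lemma linearPart_vectorField (hη : ∀ a, η a ∈ 𝔪 n) (hηv : η ∈ vectorFields n) (a : Hol n) :
    linearPart n (η a) =
      Matrix.toLin' (Matrix.of fun j i => value n (pderiv j (η (coordX i)))) (linearPart n a) := by
  funext j
  rw [Matrix.toLin'_apply, linearPart_apply, isDualFrame_pderiv.expand_apply hηv a]
  simp only [map_sum, Derivation.leibniz, smul_eq_mul, map_add, map_mul, mem_𝔪.1 (hη _), zero_mul,
    zero_add]
  exact Finset.sum_congr rfl fun i _ => mul_comm _ _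

/-- Weight vectors span all germs, so their linear parts span `ℂⁿ⁺¹`; representatives of a basis
extracted from these are coordinates. The basis consists of generalized eigenvectors of the linear
part of `η`, whose trace is then the sum of the weights. -/
theorem exists_weight_coordinates (hη : ∀ a, η a ∈ 𝔪 n) (hηv : η ∈ vectorFields n) (hN : 2 ≤ N) :
    ∃ (y : Fin (n + 1) → Hol n) (w : Fin (n + 1) → ℂ), IsCoordinateSystem y ∧
      (∀ i, y i ∈ genWeight (derivation_stable hη N) (w i)) ∧
      ∑ i, w i = ∑ i, value n (pderiv i (η (coordX i))) := by
  have hv : ∀ a, value n ((η : Module.End ℂ (Hol n)) a) = 0 * value n a := fun a => by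
    rw [zero_mul]; exact hη a
  let S : Set (Fin (n + 1) → ℂ) :=
    {v | ∃ c, ∃ a ∈ genWeight (derivation_stable hη N) c, a ∈ 𝔪 n ∧ linearPart n a = v}
  have hlin : ∀ c, ∀ a ∈ genWeight (derivation_stable hη N) c, linearPart n a ∈ S := by
    intro c a ha
    refine ⟨c, a - algebraMap ℂ _ (value n a), ?_, sub_value_mem a, ?_⟩
    · by_cases hc : c = 0
      · rw [Algebra.algebraMap_eq_smul_one]
        subst hc
        exact sub_mem ha (Submodule.smul_mem _ _ (one_mem_genWeight hη))
      · rw [value_eq_zero_of_mem_genWeight (by omega) hv hc ha, map_zero, sub_zero]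
        exact ha
    · ext j
      simp [linearPart_apply]
  have hsurj : LinearMap.range (linearPart n) = ⊤ := by
    rw [eq_top_iff, ← (Pi.basisFun ℂ (Fin (n + 1))).span_eq, Submodule.span_le]
    rintro _ ⟨i, rfl⟩
    refine ⟨coordX i, ?_⟩
    ext j
    simp [linearPart_apply, pderiv_coordX, Pi.single_apply, apply_ite (value n)]
  have hspan : Submodule.span ℂ S = ⊤ := by
    rw [eq_top_iff, ← hsurj, LinearMap.range_eq_map, ← iSup_genWeight (derivation_stable hη N),
      Submodule.map_iSup]
    refine iSup_le fun c => ?_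
    rintro _ ⟨a, ha, rfl⟩
    exact Submodule.subset_span (hlin c a ha)
  let b := Module.Basis.ofSpan hspan.ge
  let e : _ ≃ Fin (n + 1) := b.indexEquiv (Pi.basisFun ℂ (Fin (n + 1)))
  let b' := b.reindex e
  have hb : ∀ i, b' i ∈ S := fun i => by
    rw [Module.Basis.reindex_apply]
    exact Module.Basis.ofSpan_subset hspan.ge ⟨_, rfl⟩
  choose w y hyw hy𝔪 hyb using hb
  refine ⟨y, w, ⟨hy𝔪, ?_⟩, hyw, ?_⟩
  · have : (Matrix.of fun i j => value n (pderiv j (y i))) = Matrix.of fun i => b' i := by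
      ext i j
      rw [Matrix.of_apply, Matrix.of_apply, ← hyb]
      rfl
    rw [this]
    have h : IsUnit (Matrix.of fun i => b' i) :=
      Matrix.linearIndependent_rows_iff_isUnit.1 b'.linearIndependent
    exact ((Matrix.isUnit_iff_isUnit_det _).1 h).ne_zero
  · rw [← trace_eq_sum_of_mem_maxGenEigenspace b'
      (A := Matrix.toLin' (Matrix.of fun j i => value n (pderiv j (η (coordX i))))) fun i => ?_]
    · rw [Matrix.trace_toLin'_eq]
      rfl
    · rw [← hyb, Module.End.mem_maxGenEigenspace]
      obtain ⟨k, hk⟩ := mem_genWeight.1 (hyw i)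
      refine ⟨k, ?_⟩
      have : ∀ (k : ℕ) (a : Hol n), ((Matrix.toLin' (Matrix.of fun j i =>
          value n (pderiv j (η (coordX i)))) - w i • 1) ^ k) (linearPart n a) =
          linearPart n ((((η : Module.End ℂ (Hol n)) - w i • 1) ^ k) a) := by
        intro k
        induction k with
        | zero => simp
        | succ k ih =>
          intro a
          rw [pow_succ, pow_succ, Module.End.mul_apply, Module.End.mul_apply, ← ih]
          congr 1
          simp [linearPart_vectorField hη hηv]
      rw [this]
      ext j
      exact value_derivation_of_mem_sq _ (Ideal.pow_le_pow_right hN hk)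

/-- A germ `f` with `η f = h f` is, up to a unit and terms of high order, a weighted homogeneous
polynomial of degree `h(0)` in suitable coordinates. -/
theorem exists_weightedHomogeneous_approx (hη : ∀ a, η a ∈ 𝔪 n) (hηv : η ∈ vectorFields n)
    (hN : 2 ≤ N) {f h : Hol n} (hf : η f = h * f) :
    ∃ (u : Hol n) (y : Fin (n + 1) → Hol n) (w : Fin (n + 1) → ℂ)
      (G : MvPolynomial (Fin (n + 1)) ℂ), IsUnit u ∧ IsCoordinateSystem y ∧
      G.IsWeightedHomogeneous w (value n h) ∧
      ∑ i, w i = ∑ i, value n (pderiv i (η (coordX i))) ∧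
      u * f - MvPolynomial.aeval y G ∈ 𝔪 n ^ N := by
  obtain ⟨y, w, hy, hyw, hw⟩ := exists_weight_coordinates hη hηv hN
  -- The operator `η + h` satisfies `η (a f) = (T a) f`, and it acts on values at `0` as
  -- multiplication by `h(0)`. A unit of weight `h(0)` for `T` therefore gives `u f` the weight
  -- `h(0)` for `η`.
  let T : Module.End ℂ (Hol n) := (η : Module.End ℂ (Hol n)) + LinearMap.mulLeft ℂ h
  have hT : 𝔪pow n N ≤ (𝔪pow n N).comap T := fun a ha => by
    have h1 : η a ∈ 𝔪 n ^ N := derivation_stable hη N ha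
    exact add_mem h1 (Ideal.mul_mem_left (𝔪 n ^ N) h ha)
  obtain ⟨u, hu, hu'⟩ := exists_isUnit_mem_genWeight (T := T) (hT := hT) (t := value n h)
    (by omega) fun a => by
      change value n (η a + h * a) = _
      rw [map_add, mem_𝔪.1 (hη a), zero_add, map_mul]
  have huf : u * f ∈ genWeight (derivation_stable hη N) (value n h) := by
    obtain ⟨k, hk⟩ := mem_genWeight.1 hu
    refine mem_genWeight.2 ⟨k, ?_⟩
    have : ∀ (k : ℕ) (a : Hol n), ((((η : Module.End ℂ (Hol n)) - value n h • 1) ^ k) (a * f)) =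
        ((T - value n h • 1) ^ k) a * f := by
      intro k
      induction k with
      | zero => simp
      | succ k ih =>
        intro a
        rw [pow_succ, pow_succ, Module.End.mul_apply, Module.End.mul_apply, ← ih]
        congr 1
        simp only [T, LinearMap.sub_apply, LinearMap.add_apply, Derivation.coeFn_coe,
          Derivation.leibniz, hf, LinearMap.smul_apply, Module.End.one_apply,
          LinearMap.mulLeft_apply, smul_eq_mul, sub_mul, add_mul, smul_mul_assoc]
        ring
    rw [this]
    exact Ideal.mul_mem_right f _ hk
  obtain ⟨G, hG, hGf⟩ := exists_approx_of_mem_genWeight hη hy hyw huf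
  exact ⟨u, y, w, G, hu', hy, hG, hw, hGf⟩

end

end Weights

/-! ### Tangent vector fields and complex weights -/

section Tjurina

variable {n : ℕ}

lemma tjurina_le_𝔪 {f : Hol n} (hf : f ∈ 𝔪 n ^ 2) : tjurina f ≤ 𝔪 n := by
  refine Ideal.span_le.2 ?_
  rintro _ (rfl | ⟨i, rfl⟩)
  · exact Ideal.pow_le_self two_ne_zero hf
  · exact value_derivation_of_mem_sq _ hf

lemma self_mem_tjurina (f : Hol n) : f ∈ tjurina f := Ideal.subset_span (Or.inl rfl)

lemma pderiv_mem_tjurina (f : Hol n) (i : Fin (n + 1)) : pderiv i f ∈ tjurina f :=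
  Ideal.subset_span (Or.inr ⟨i, rfl⟩)

lemma tjurina_mul_le (a f : Hol n) : tjurina (a * f) ≤ tjurina f := by
  refine Ideal.span_le.2 ?_
  rintro _ (rfl | ⟨i, rfl⟩)
  · exact Ideal.mul_mem_left _ _ (self_mem_tjurina f)
  · change pderiv i (a * f) ∈ _
    rw [Derivation.leibniz, smul_eq_mul, smul_eq_mul]
    exact add_mem (Ideal.mul_mem_left _ _ (pderiv_mem_tjurina f i))
      (Ideal.mul_mem_right _ _ (self_mem_tjurina f))

lemma tjurina_eq_of_associated {f g : Hol n} (h : Associated f g) : tjurina f = tjurina g := by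
  obtain ⟨u, rfl⟩ := h
  apply le_antisymm
  · have := tjurina_mul_le (↑u⁻¹ : Hol n) (f * u)
    rwa [mul_comm f, Units.inv_mul_cancel_left, mul_comm] at this
  · rw [mul_comm]
    exact tjurina_mul_le _ f

/-- A vector field tangent to `f = 0` preserves the Tjurina ideal. -/
lemma vectorField_mem_tjurina {η : Derivation ℂ (Hol n) (Hol n)} (hη : η ∈ vectorFields n)
    {f h : Hol n} (hf : η f = h * f) : ∀ a ∈ tjurina f, η a ∈ tjurina f := by
  refine derivation_mem_span η (fun a ha => Ideal.subset_span ha) ?_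
  rintro _ (rfl | ⟨j, rfl⟩)
  · rw [hf]
    exact Ideal.mul_mem_left _ _ (self_mem_tjurina _)
  · have h1 := congrArg (pderiv j) hf
    rw [isDualFrame_pderiv.expand_apply hη f, map_sum] at h1
    change η (pderiv j f) ∈ _
    rw [isDualFrame_pderiv.expand_apply hη (pderiv j f)]
    have h2 : ∑ i, η (coordX i) * pderiv i (pderiv j f) =
        pderiv j (h * f) - ∑ i, pderiv j (η (coordX i)) * pderiv i f := by
      rw [← h1, ← Finset.sum_sub_distrib]
      refine Finset.sum_congr rfl fun i _ => ?_
      rw [Derivation.leibniz, smul_eq_mul, smul_eq_mul, pderiv_comm]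
      ring
    rw [h2]
    exact sub_mem (tjurina_mul_le h f (pderiv_mem_tjurina _ j))
      (Ideal.sum_mem _ fun i _ => Ideal.mul_mem_left _ _ (pderiv_mem_tjurina f i))

/-- A vector field tangent to a singular hypersurface with isolated singularity vanishes at the
singular point. -/
lemma vectorField_mem_𝔪 {η : Derivation ℂ (Hol n) (Hol n)} (hη : η ∈ vectorFields n)
    {f h : Hol n} (hf : η f = h * f) (hsq : f ∈ 𝔪 n ^ 2) {k : ℕ} (hk : 𝔪 n ^ k ≤ tjurina f)
    (a : Hol n) : η a ∈ 𝔪 n := by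
  classical
  have hx : ∀ i, η (coordX i) ∈ 𝔪 n := by
    intro i
    by_contra hv
    have hu : IsUnit (η (coordX i)) := isUnit_iff_value.2 hv
    -- Take the least power of `xᵢ` in the Tjurina ideal. The field preserves that ideal and `η xᵢ`
    -- is a unit, so differentiating puts the next lower power in it as well.
    have hex : ∃ k, coordX (n := n) i ^ k ∈ tjurina f :=
      ⟨k, hk (Ideal.pow_mem_pow (coordX_mem i) k)⟩
    have hmin := Nat.find_spec hex
    have hlt := fun m => Nat.find_min hex (m := m)
    revert hmin hlt
    generalize Nat.find hex = k
    intro hmin hlt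
    cases k with
    | zero =>
      rw [pow_zero] at hmin
      have := mem_𝔪.1 (tjurina_le_𝔪 hsq hmin)
      simp at this
    | succ k =>
      refine hlt k (Nat.lt_succ_self k) ?_
      have h1 := vectorField_mem_tjurina hη hf _ hmin
      rw [Derivation.leibniz_pow, Nat.add_sub_cancel, smul_eq_mul, nsmul_eq_mul] at h1
      have h2 : IsUnit ((k + 1 : ℕ) : Hol n) := by
        rw [isUnit_iff_value, map_natCast]
        exact Nat.cast_ne_zero.2 (Nat.succ_ne_zero k)
      rw [Ideal.unit_mul_mem_iff_mem _ h2] at h1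
      rwa [mul_comm, Ideal.unit_mul_mem_iff_mem _ hu] at h1
  rw [isDualFrame_pderiv.expand_apply hη a]
  exact Ideal.sum_mem _ fun i _ => Ideal.mul_mem_right _ _ (hx i)

/-- The hypotheses give `tjurina f ≤ tjurina g ⊔ 𝔪 * tjurina f`, and Nakayama's lemma applies. -/
lemma tjurina_le_of_sub_mem {f g : Hol n} (h0 : f - g ∈ tjurina g ⊔ 𝔪 n * tjurina f)
    (h1 : ∀ i, pderiv i (f - g) ∈ tjurina g ⊔ 𝔪 n * tjurina f) : tjurina f ≤ tjurina g := by
  refine Submodule.le_of_le_smul_of_le_jacobson_bot (I := 𝔪 n) ?_ ?_ ?_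
  · exact Submodule.fg_span ((Set.finite_range _).insert _)
  · rw [𝔪_eq_maximalIdeal]
    exact IsLocalRing.maximalIdeal_le_jacobson _
  · refine Ideal.span_le.2 ?_
    rintro _ (rfl | ⟨i, rfl⟩)
    · have := add_mem h0 (Ideal.mem_sup_left (self_mem_tjurina g))
      rwa [sub_add_cancel] at this
    · have := add_mem (h1 i) (Ideal.mem_sup_left (pderiv_mem_tjurina g i))
      rwa [map_sub, sub_add_cancel] at this

/-- A germ with isolated singularity is finitely determined. -/
lemma exists_associated_of_sub_mem {y : Fin (n + 1) → Hol n} (hy : IsCoordinateSystem y)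
    (F : MvPolynomial (Fin (n + 1)) ℂ) {f : Hol n} (hf : f ∈ 𝔪 n ^ 2) {k : ℕ}
    (hk : 𝔪 n ^ k ≤ tjurina f) (hp : f - MvPolynomial.aeval y F ∈ 𝔪 n ^ (2 * k + 2)) :
    ∃ z, IsCoordinateSystem z ∧ Associated f (MvPolynomial.aeval z F) := by
  have hk' : 𝔪 n ^ (k + 1) ≤ 𝔪 n * tjurina f := by
    rw [pow_succ']
    exact Ideal.mul_mono_right hk
  -- The exponent `2 k + 2` puts the error and its derivatives in `𝔪 ^ (k + 1)`, as Nakayama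
  -- requires, and below puts the error in `𝔪` times the squared Tjurina ideal.
  have hle : tjurina f ≤ tjurina (MvPolynomial.aeval y F) := by
    refine tjurina_le_of_sub_mem (Ideal.mem_sup_right (hk' ?_)) fun i =>
      Ideal.mem_sup_right (hk' ?_)
    · exact Ideal.pow_le_pow_right (by omega) hp
    · exact Ideal.pow_le_pow_right (by omega) (derivation_mem_pow (pderiv i) _ (2 * k + 1) _ hp)
  have hF : MvPolynomial.aeval y F ∈ 𝔪 n ^ 2 := by
    have := sub_mem hf (Ideal.pow_le_pow_right (show 2 ≤ 2 * k + 2 by omega) hp)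
    rwa [sub_sub_cancel] at this
  have hp' : f - MvPolynomial.aeval y F ∈ 𝔪 n * tjurina (MvPolynomial.aeval y F) ^ 2 := by
    refine Ideal.mul_mono_right (Ideal.pow_right_mono (hk.trans hle) 2) ?_
    rw [← pow_mul, ← pow_succ']
    exact Ideal.pow_le_pow_right (by omega) hp
  obtain ⟨z, hz, h⟩ := exists_coordinate_change hy F (tjurina_le_𝔪 hF) hp'
  rw [add_sub_cancel] at h
  exact ⟨z, hz, h⟩

/-- A germ `f` with isolated singularity and a vector field `η` with `η f = h f` is a weighted
homogeneous polynomial in suitable coordinates, with respect to complex weights. -/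
theorem exists_complex_weights {η : Derivation ℂ (Hol n) (Hol n)} (hη : η ∈ vectorFields n)
    {f h : Hol n} (hf : η f = h * f) (hsq : f ∈ 𝔪 n ^ 2) {k : ℕ} (hk : 𝔪 n ^ k ≤ tjurina f) :
    ∃ (z : Fin (n + 1) → Hol n) (w : Fin (n + 1) → ℂ) (G : MvPolynomial (Fin (n + 1)) ℂ),
      IsCoordinateSystem z ∧ G.IsWeightedHomogeneous w (value n h) ∧
      ∑ i, w i = ∑ i, value n (pderiv i (η (coordX i))) ∧
      Associated f (MvPolynomial.aeval z G) := by
  obtain ⟨u, y, w, G, hu, hy, hG, hw, hGf⟩ := exists_weightedHomogeneous_approx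
    (vectorField_mem_𝔪 hη hf hsq hk) hη (show 2 ≤ 2 * k + 2 by omega) hf
  have hass : Associated f (u * f) := (associated_unit_mul_right _ _ hu)
  obtain ⟨z, hz, h⟩ := exists_associated_of_sub_mem hy G (Ideal.mul_mem_left _ u hsq)
    (tjurina_eq_of_associated hass ▸ hk) hGf
  exact ⟨z, w, G, hz, hG, hw, hass.trans h⟩

end Tjurina

/-! ### Nondegenerate part of a symmetric matrix -/

section RowBasis

/-- Let `P` index a maximal independent set of rows. The other rows are combinations of these, and
by symmetry the columns indexed by `P` are independent too. -/
lemma exists_rowBasis {ι : Type*} [Fintype ι] {H : Matrix ι ι ℂ} (hH : ∀ i j, H i j = H j i) :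
    ∃ P : Finset ι, (∀ v, (∀ k ∈ P, (H.mulVec v) k = 0) → H.mulVec v = 0) ∧
      ∀ v, (∀ i ∉ P, v i = 0) → H.mulVec v = 0 → v = 0 := by
  classical
  obtain ⟨κ, a, ha, hspan, hli⟩ := exists_linearIndependent' ℂ (fun i => H i)
  have : Finite κ := Finite.of_injective a ha
  have : Fintype κ := Fintype.ofFinite κ
  refine ⟨Finset.univ.image a, fun v hv => ?_, fun v hv hHv => ?_⟩
  · have h1 : ∀ r ∈ Submodule.span ℂ (Set.range ((fun i => H i) ∘ a)), r ⬝ᵥ v = 0 := by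
      intro r hr
      refine Submodule.span_induction (p := fun r _ => r ⬝ᵥ v = 0) ?_ (zero_dotProduct _) ?_ ?_ hr
      · rintro _ ⟨k, rfl⟩
        exact hv (a k) (Finset.mem_image_of_mem a (Finset.mem_univ k))
      · intro r s _ _ hr hs
        rw [add_dotProduct, hr, hs, add_zero]
      · intro c r _ hr
        rw [smul_dotProduct, hr, smul_zero]
    rw [hspan] at h1
    funext i
    exact h1 _ (Submodule.subset_span ⟨i, rfl⟩)
  · have h2 : ∑ k, v (a k) • H (a k) = 0 := by
      funext j
      have h3 := congrFun hHv j
      rw [Matrix.mulVec, dotProduct] at h3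
      rw [Finset.sum_apply, ← h3]
      simp only [Pi.smul_apply, smul_eq_mul]
      rw [← Finset.sum_image (f := fun i => v i * H i j) (s := Finset.univ) (g := a)
        (fun _ _ _ _ h => ha h)]
      rw [← Finset.sum_subset (Finset.subset_univ (Finset.univ.image a))
        (f := fun i => H j i * v i) fun i _ hi => by rw [hv i hi, mul_zero]]
      exact Finset.sum_congr rfl fun i _ => by rw [hH i j, mul_comm]
    have h4 := Fintype.linearIndependent_iff.1 hli _ h2
    funext i
    by_cases hi : i ∈ Finset.univ.image a
    · obtain ⟨k, -, rfl⟩ := Finset.mem_image.1 hi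
      exact h4 k
    · exact hv i hi

end RowBasis

/-! ### Coordinates adapted to the Hessian -/

section SplittingFrame

variable {n : ℕ}

lemma value_aeval {y : Fin (n + 1) → Hol n} (hy : ∀ i, y i ∈ 𝔪 n)
    (Q : MvPolynomial (Fin (n + 1)) ℂ) :
    value n (MvPolynomial.aeval y Q) = MvPolynomial.constantCoeff Q := by
  rw [MvPolynomial.comp_aeval_apply, show (fun i => value n (y i)) = 0 from
    funext fun i => mem_𝔪.1 (hy i), MvPolynomial.aeval_zero]
  rfl

lemma value_derivation_comm (δ ε : Derivation ℂ (Hol n) (Hol n)) {a : Hol n} (ha : a ∈ 𝔪 n ^ 2) :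
    value n (δ (ε a)) = value n (ε (δ a)) := by
  have := value_derivation_of_mem_sq ⁅δ, ε⁆ ha
  rwa [Derivation.commutator_apply, map_sub, sub_eq_zero] at this

lemma value_derivation_mul {δ : Derivation ℂ (Hol n) (Hol n)} {a b : Hol n} (hb : b ∈ 𝔪 n) :
    value n (δ (a * b)) = value n a * value n (δ b) := by
  rw [Derivation.leibniz, smul_eq_mul, smul_eq_mul, map_add, map_mul, map_mul, mem_𝔪.1 hb]
  ring

/-- The coordinates `y` arise from the coordinates `z` by replacing a maximal set `P` of them by
partial derivatives of `f`. -/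
structure IsSplittingFrame (f : Hol n) (z : Fin (n + 1) → Hol n)
    (D : Fin (n + 1) → Derivation ℂ (Hol n) (Hol n)) (P : Finset (Fin (n + 1)))
    (y : Fin (n + 1) → Hol n) (E : Fin (n + 1) → Derivation ℂ (Hol n) (Hol n)) : Prop where
  frame : IsDualFrame z D
  coord : IsCoordinateSystem y
  frame' : IsDualFrame y E
  mem : ∀ k ∈ P, y k = D k f
  notMem : ∀ i ∉ P, y i = z i
  null : ∀ i ∉ P, ∀ j, value n (E i (E j f)) = 0

/-- Apply the row basis lemma to the Hessian. The Jacobian matrix of `y` consists of Hessian rows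
for `P` and unit rows elsewhere, hence is invertible. For `i ∉ P` the field `E i` annihilates `D k
f` for `k ∈ P`, so its value at `0` lies in the kernel of the Hessian. -/
lemma exists_splittingFrame {z : Fin (n + 1) → Hol n} (hz : IsCoordinateSystem z)
    {D : Fin (n + 1) → Derivation ℂ (Hol n) (Hol n)} (hD : IsDualFrame z D) {f : Hol n}
    (hf : f ∈ 𝔪 n ^ 2) : ∃ P y E, IsSplittingFrame f z D P y E := by
  classical
  let H : Matrix (Fin (n + 1)) (Fin (n + 1)) ℂ := Matrix.of fun i j => value n (D i (D j f))
  obtain ⟨P, hP1, hP2⟩ := exists_rowBasis (H := H) fun i j => value_derivation_comm _ _ hf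
  let y : Fin (n + 1) → Hol n := fun i => if i ∈ P then D i f else z i
  have hD𝔪 : ∀ i, D i f ∈ 𝔪 n := fun i => value_derivation_of_mem_sq _ hf
  have hy𝔪 : ∀ i, y i ∈ 𝔪 n := fun i => by
    by_cases hi : i ∈ P
    · simpa [y, hi] using hD𝔪 i
    · simpa [y, hi] using hz.1 i
  have hy : IsCoordinateSystem y := by
    refine hD.isCoordinateSystem hz hy𝔪 fun hdet => ?_
    obtain ⟨v, hv0, hv⟩ := Matrix.exists_mulVec_eq_zero_iff.2 hdet
    refine hv0 (hP2 v (fun i hi => ?_) (hP1 v fun k hk => ?_))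
    · have := congrFun hv i
      simpa [Matrix.mulVec, dotProduct, y, hi, hD.dual, apply_ite (value n)] using this
    · refine Eq.trans ?_ (congrFun hv k)
      rw [Matrix.mulVec, Matrix.mulVec, dotProduct, dotProduct]
      refine Finset.sum_congr rfl fun j _ => ?_
      simp only [H, Matrix.of_apply, y, hk, if_true]
      rw [value_derivation_comm _ _ hf]
  obtain ⟨E, hE⟩ := exists_dualFrame hy
  refine ⟨P, y, E, hD, hy, hE, fun k hk => by simp [y, hk], fun i hi => by simp [y, hi],
    fun i hi j => ?_⟩
  have h1 : H.mulVec (fun l => value n (E i (z l))) = 0 := by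
    refine hP1 _ fun k hk => ?_
    have h2 := hE.dual i k
    rw [if_neg (fun e : i = k => hi (e ▸ hk)), show y k = D k f by simp [y, hk],
      hD.expand_apply (hE.mem i)] at h2
    have h3 := congrArg (value n) h2
    rw [map_zero, map_sum] at h3
    rw [← h3, Matrix.mulVec, dotProduct]
    refine Finset.sum_congr rfl fun l _ => ?_
    rw [map_mul, mul_comm, value_derivation_comm _ _ hf]
    rfl
  rw [value_derivation_comm _ _ hf, hD.expand_apply (hE.mem i) f, map_sum, map_sum]
  simp only [value_derivation_mul (hD𝔪 _)]
  have h4 : ∀ l, value n (E j (D l f)) = ∑ m, value n (E j (z m)) * H m l := fun l => by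
    rw [hD.expand_apply (hE.mem j), map_sum]
    exact Finset.sum_congr rfl fun m _ => map_mul _ _ _
  simp only [h4, Finset.mul_sum]
  rw [Finset.sum_comm]
  refine Finset.sum_eq_zero fun m _ => ?_
  have h5 := congrFun h1 m
  calc _ = value n (E j (z m)) * ∑ l, H m l * value n (E i (z l)) := by
        rw [Finset.mul_sum]
        exact Finset.sum_congr rfl fun l _ => by ring
    _ = 0 := by
        change value n (E j (z m)) * (H.mulVec (fun l => value n (E i (z l)))) m = 0
        rw [h5]; simp

namespace IsSplittingFrame

variable {f : Hol n} {z : Fin (n + 1) → Hol n} {D : Fin (n + 1) → Derivation ℂ (Hol n) (Hol n)}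
  {P : Finset (Fin (n + 1))} {y : Fin (n + 1) → Hol n}
  {E : Fin (n + 1) → Derivation ℂ (Hol n) (Hol n)}

/-- By the chain rule only the derivatives `D l f` with `l ∈ P` contribute, since `E k` annihilates
the unchanged coordinates. In particular `f` has no term linear in the variables from `P`, with any
coefficient. -/
lemma apply_eq (h : IsSplittingFrame f z D P y E) {k : Fin (n + 1)} (hk : k ∈ P) :
    E k f = ∑ l ∈ P, E k (z l) * y l := by
  rw [h.frame.expand_apply (h.frame'.mem k),
    ← Finset.sum_subset (Finset.subset_univ P) fun l _ hl => ?_]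
  · exact Finset.sum_congr rfl fun l hl => by rw [h.mem l hl]
  · rw [← h.notMem l hl, h.frame'.dual, if_neg (fun e : k = l => hl (e ▸ hk)), zero_mul]

lemma coord_eq (h : IsSplittingFrame f z D P y E) {k : Fin (n + 1)} (hk : k ∈ P) :
    y k = ∑ j ∈ P, D k (D j f) * E j f := by
  rw [h.mem k hk, h.frame'.expand_apply (h.frame.mem k),
    ← Finset.sum_subset (Finset.subset_univ P) fun l _ hl => ?_]
  · exact Finset.sum_congr rfl fun l hl => by rw [h.mem l hl]
  · rw [h.notMem l hl, h.frame.dual, if_neg (fun e : k = l => hl (e ▸ hk)), zero_mul]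

/-- On `P` the Hessians in the old and the new frame are mutually inverse; this is the diagonal
part, used to sum the weights. -/
lemma sum_hessian_mul (h : IsSplittingFrame f z D P y E) (hf : f ∈ 𝔪 n ^ 2) {k : Fin (n + 1)}
    (hk : k ∈ P) :
    ∑ j ∈ P, value n (D k (D j f)) * value n (E k (E j f)) = 1 := by
  have h1 := congrArg (fun a => value n (E k a)) (h.coord_eq hk)
  simp only [h.frame'.dual, if_true, map_one, map_sum,
    value_derivation_mul (show E _ f ∈ 𝔪 n from value_derivation_of_mem_sq _ hf)] at h1
  exact h1.symm

lemma hessian_eq (h : IsSplittingFrame f z D P y E) {k l : Fin (n + 1)} (hk : k ∈ P)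
    (hl : l ∈ P) : value n (E l (E k f)) = value n (E k (z l)) := by
  rw [h.apply_eq hk, map_sum, map_sum]
  simp only [value_derivation_mul (h.coord.1 _), h.frame'.dual]
  rw [Finset.sum_eq_single l]
  · simp
  · intro b _ hb; simp [hb.symm]
  · intro hn; exact absurd hl hn

/-- The ideal generated by the nondegenerate coordinates. -/
def splitIdeal (P : Finset (Fin (n + 1))) (y : Fin (n + 1) → Hol n) : Ideal (Hol n) :=
  Ideal.span (y '' P)

lemma mem_splitIdeal {k : Fin (n + 1)} (hk : k ∈ P) : y k ∈ splitIdeal P y :=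
  Ideal.subset_span ⟨k, hk, rfl⟩

lemma mem_splitIdeal_iff {a : Hol n} :
    a ∈ splitIdeal P y ↔ ∃ c : Fin (n + 1) → Hol n, ∑ i ∈ P, c i * y i = a := by
  classical
  refine ⟨fun ha => ?_, ?_⟩
  · obtain ⟨c, rfl⟩ := (Submodule.mem_span_image_finset_iff_exists_fun (Hol n)).1 ha
    refine ⟨fun i => if hi : i ∈ P then c ⟨i, hi⟩ else 0, ?_⟩
    rw [← Finset.sum_coe_sort]
    simp
  · rintro ⟨c, rfl⟩
    exact Ideal.sum_mem _ fun i hi => Ideal.mul_mem_left _ _ (mem_splitIdeal hi)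

lemma apply_sub_mem (h : IsSplittingFrame f z D P y E) {k : Fin (n + 1)} (hk : k ∈ P) :
    E k f - ∑ l ∈ P, algebraMap ℂ (Hol n) (value n (E l (E k f))) * y l ∈
      𝔪 n * splitIdeal P y := by
  rw [h.apply_eq hk, ← Finset.sum_sub_distrib]
  refine Ideal.sum_mem _ fun l hl => ?_
  rw [← sub_mul, ← h.apply_eq hk, h.hessian_eq hk hl]
  exact Ideal.mul_mem_mul (sub_value_mem _) (mem_splitIdeal hl)

/-- The Euler vector field of the nondegenerate coordinates. -/
def splitEuler (P : Finset (Fin (n + 1))) (y : Fin (n + 1) → Hol n)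
    (E : Fin (n + 1) → Derivation ℂ (Hol n) (Hol n)) : Derivation ℂ (Hol n) (Hol n) :=
  ∑ k ∈ P, y k • E k

lemma splitEuler_apply (a : Hol n) : splitEuler P y E a = ∑ k ∈ P, y k * E k a :=
  sum_smul_derivation_apply P y E a

lemma splitEuler_mem (a : Hol n) : splitEuler P y E a ∈ splitIdeal P y := by
  rw [splitEuler_apply]
  exact Ideal.sum_mem _ fun k hk => Ideal.mul_mem_right _ _ (mem_splitIdeal hk)

lemma splitEuler_coord (h : IsDualFrame y E) {k : Fin (n + 1)} (hk : k ∈ P) :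
    splitEuler P y E (y k) = y k := by
  rw [splitEuler_apply, Finset.sum_eq_single k]
  · simp [h.dual]
  · intro b _ hb; simp [h.dual, hb]
  · intro hn; exact absurd hk hn

lemma splitEuler_sq_sub_mem (h : IsDualFrame y E) (b : Hol n) :
    splitEuler P y E (splitEuler P y E b) - splitEuler P y E b ∈ splitIdeal P y ^ 2 := by
  have : splitEuler P y E (splitEuler P y E b) - splitEuler P y E b =
      ∑ k ∈ P, y k * splitEuler P y E (E k b) := by
    conv_lhs => rw [splitEuler_apply b, map_sum]
    rw [← Finset.sum_sub_distrib]
    refine Finset.sum_congr rfl fun k hk => ?_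
    rw [Derivation.leibniz, splitEuler_coord h hk, smul_eq_mul, smul_eq_mul]
    ring
  rw [this, pow_two]
  exact Ideal.sum_mem _ fun k hk => Ideal.mul_mem_mul (mem_splitIdeal hk) (splitEuler_mem _)

/-- The Euler field multiplies the part of degree `j` in the variables from `P` by `j`, so `(e -
1)(e - 2)` annihilates degrees one and two. -/
lemma splitEuler_quadratic_mem (h : IsDualFrame y E) {a : Hol n} (ha : a ∈ splitIdeal P y) :
    splitEuler P y E (splitEuler P y E a) - 3 * splitEuler P y E a + 2 * a ∈
      splitIdeal P y ^ 3 := by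
  obtain ⟨c, rfl⟩ := mem_splitIdeal_iff.1 ha
  have h1 : ∀ k ∈ P, splitEuler P y E (splitEuler P y E (c k * y k)) -
      3 * splitEuler P y E (c k * y k) + 2 * (c k * y k) ∈ splitIdeal P y ^ 3 := fun k hk => by
    have : splitEuler P y E (splitEuler P y E (c k * y k)) -
        3 * splitEuler P y E (c k * y k) + 2 * (c k * y k) =
        (splitEuler P y E (splitEuler P y E (c k)) - splitEuler P y E (c k)) * y k := by
      simp only [Derivation.leibniz, splitEuler_coord h hk, smul_eq_mul, map_add]
      ring
    rw [this, pow_succ]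
    exact Ideal.mul_mem_mul (splitEuler_sq_sub_mem h _) (mem_splitIdeal hk)
  have := Ideal.sum_mem _ h1
  simpa only [map_sum, Finset.mul_sum, Finset.sum_add_distrib, Finset.sum_sub_distrib] using this

end IsSplittingFrame

end SplittingFrame

/-! ### The splitting lemma -/

section NormalForm

variable {n : ℕ}

namespace IsSplittingFrame

variable {f : Hol n} {z : Fin (n + 1) → Hol n} {D : Fin (n + 1) → Derivation ℂ (Hol n) (Hol n)}
  {P : Finset (Fin (n + 1))} {y : Fin (n + 1) → Hol n}
  {E : Fin (n + 1) → Derivation ℂ (Hol n) (Hol n)}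

lemma splitIdeal_le (hy : ∀ i, y i ∈ 𝔪 n) : splitIdeal P y ≤ 𝔪 n := by
  refine Ideal.span_le.2 ?_
  rintro _ ⟨i, -, rfl⟩
  exact hy i

/-- The nondegenerate quadratic part of `f`. -/
def splitQuadric (f : Hol n) (P : Finset (Fin (n + 1))) (y : Fin (n + 1) → Hol n)
    (E : Fin (n + 1) → Derivation ℂ (Hol n) (Hol n)) : Hol n :=
  ∑ i ∈ P, ∑ j ∈ P, algebraMap ℂ (Hol n) (value n (E j (E i f)) / 2) * (y i * y j)

lemma splitEuler_splitQuadric (h : IsDualFrame y E) :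
    splitEuler P y E (splitQuadric f P y E) = 2 * splitQuadric f P y E := by
  simp only [splitQuadric, map_sum, Finset.mul_sum]
  refine Finset.sum_congr rfl fun i hi => Finset.sum_congr rfl fun j hj => ?_
  simp only [Derivation.leibniz, splitEuler_coord h hi, splitEuler_coord h hj, smul_eq_mul,
    Derivation.map_algebraMap]
  ring

lemma two_mul_splitQuadric : 2 * splitQuadric f P y E =
    ∑ i ∈ P, y i * ∑ j ∈ P, algebraMap ℂ (Hol n) (value n (E j (E i f))) * y j := by
  simp only [splitQuadric, Finset.mul_sum]
  refine Finset.sum_congr rfl fun i _ => Finset.sum_congr rfl fun j _ => ?_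
  have : algebraMap ℂ (Hol n) (value n (E j (E i f))) =
      2 * algebraMap ℂ (Hol n) (value n (E j (E i f)) / 2) := by
    rw [← map_ofNat (algebraMap ℂ (Hol n)) 2, ← map_mul]
    congr 1
    ring
  rw [this]
  ring

lemma splitEuler_sub_mem (h : IsSplittingFrame f z D P y E) :
    splitEuler P y E f - 2 * splitQuadric f P y E ∈ 𝔪 n * splitIdeal P y ^ 2 := by
  rw [splitEuler_apply, two_mul_splitQuadric, ← Finset.sum_sub_distrib]
  refine Ideal.sum_mem _ fun i hi => ?_
  rw [← mul_sub, pow_two, mul_left_comm]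
  exact Ideal.mul_mem_mul (mem_splitIdeal hi) (h.apply_sub_mem hi)

/-- Here `b` is the part of `f` free of the variables from `P`. The operator `(e - 1)(e - 2)` is the
identity up to a factor two and terms in the image of `e`, and `e f` is known to be `2 q` modulo `𝔪`
times the square of the split ideal. -/
lemma sub_splitQuadric_mem (h : IsSplittingFrame f z D P y E) {N : ℕ} {b : Hol n}
    (hb : ∀ k ∈ P, E k b = 0) (hfb : f - b ∈ splitIdeal P y ⊔ 𝔪 n ^ N) :
    f - b - splitQuadric f P y E ∈ 𝔪 n * splitIdeal P y ^ 2 ⊔ 𝔪 n ^ N := by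
  obtain ⟨a, ha, d, hd, had⟩ := Submodule.mem_sup.1 hfb
  set e := splitEuler P y E with he
  set q := splitQuadric f P y E with hq
  have hL : splitIdeal P y ≤ 𝔪 n := splitIdeal_le h.coord.1
  have hed : ∀ x ∈ 𝔪 n ^ N, e x ∈ 𝔪 n ^ N :=
    derivation_mem_pow_of_mem e (fun x _ => hL (splitEuler_mem x)) N
  have her : ∀ x ∈ 𝔪 n * splitIdeal P y ^ 2, e x ∈ 𝔪 n * splitIdeal P y ^ 2 :=
    derivation_mem_mul e (fun x _ => hL (splitEuler_mem x))
      (derivation_mem_pow_of_mem e (fun x _ => splitEuler_mem x) 2)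
  have heb : e b = 0 := by
    rw [he, splitEuler_apply]
    exact Finset.sum_eq_zero fun k hk => by rw [hb k hk, mul_zero]
  have hr := h.splitEuler_sub_mem
  rw [← he, ← hq] at hr
  have hX : e (e a) - 3 * e a + 2 * a ∈ 𝔪 n * splitIdeal P y ^ 2 := by
    have := splitEuler_quadratic_mem h.frame' ha
    rw [pow_succ'] at this
    exact Ideal.mul_mono_left hL this
  have hY : e (e d) - 3 * e d + 2 * d ∈ 𝔪 n ^ N :=
    add_mem (sub_mem (hed _ (hed _ hd)) (Ideal.mul_mem_left _ _ (hed _ hd)))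
      (Ideal.mul_mem_left _ _ hd)
  have hsum : 2 * (f - b - q) = ((e (e a) - 3 * e a + 2 * a) + 3 * (e f - 2 * q) -
      e (e f - 2 * q)) + (e (e d) - 3 * e d + 2 * d) := by
    have h1 : e f = e a + e d := by
      rw [← map_add, had, map_sub, heb, sub_zero]
    have h2 : e (e f - 2 * q) = e (e a) + e (e d) - 4 * q := by
      rw [map_sub, h1, map_add, two_mul, map_add, splitEuler_splitQuadric h.frame']
      ring
    rw [h2, h1, ← had]
    ring
  have h2u : IsUnit (2 : Hol n) := by
    rw [isUnit_iff_value, map_ofNat]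
    exact two_ne_zero
  rw [← Ideal.unit_mul_mem_iff_mem _ h2u, hsum]
  exact add_mem (Ideal.mem_sup_left (sub_mem (add_mem hX (Ideal.mul_mem_left _ _ hr)) (her _ hr)))
    (Ideal.mem_sup_right hY)

lemma apply_splitQuadric (h : IsDualFrame y E) (hf : f ∈ 𝔪 n ^ 2) {k : Fin (n + 1)} (hk : k ∈ P) :
    E k (splitQuadric f P y E) =
      ∑ l ∈ P, algebraMap ℂ (Hol n) (value n (E l (E k f))) * y l := by
  have h1 : E k (splitQuadric f P y E) =
      (∑ i ∈ P, ∑ j ∈ P, algebraMap ℂ (Hol n) (value n (E j (E i f)) / 2) *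
        (y i * if k = j then 1 else 0)) +
      ∑ i ∈ P, ∑ j ∈ P, algebraMap ℂ (Hol n) (value n (E j (E i f)) / 2) *
        (y j * if k = i then 1 else 0) := by
    simp only [splitQuadric, map_sum, ← Finset.sum_add_distrib]
    refine Finset.sum_congr rfl fun i hi => Finset.sum_congr rfl fun j hj => ?_
    rw [Derivation.leibniz, Derivation.leibniz, Derivation.map_algebraMap, h.dual, h.dual]
    simp only [smul_eq_mul]
    ring
  rw [h1, Finset.sum_comm (s := P) (t := P) (f := fun i j =>
    algebraMap ℂ (Hol n) (value n (E j (E i f)) / 2) * (y j * if k = i then 1 else 0)),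
    ← Finset.sum_add_distrib]
  refine Finset.sum_congr rfl fun l _ => ?_
  simp only [mul_ite, mul_one, mul_zero, Finset.sum_ite_eq, hk, if_true]
  rw [value_derivation_comm (E k) (E l) hf, ← add_mul, ← map_add, add_halves]

/-- The `y k` are combinations of the `E j f`, which agree with the `E j g` modulo `𝔪` times the
ideal of the `y k`; Nakayama's lemma finishes. -/
lemma splitIdeal_le_tjurina (h : IsSplittingFrame f z D P y E) {g : Hol n}
    (hg : ∀ k ∈ P, E k f - E k g ∈ 𝔪 n * splitIdeal P y) : splitIdeal P y ≤ tjurina g := by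
  refine Submodule.le_of_le_smul_of_le_jacobson_bot (I := 𝔪 n) ?_ ?_ ?_
  · exact Submodule.fg_span (P.finite_toSet.image y)
  · rw [𝔪_eq_maximalIdeal]
    exact IsLocalRing.maximalIdeal_le_jacobson _
  · refine Ideal.span_le.2 ?_
    rintro _ ⟨k, hk, rfl⟩
    rw [h.coord_eq hk]
    refine Ideal.sum_mem _ fun j hj => Ideal.mul_mem_left _ _ ?_
    have := add_mem (Ideal.mem_sup_left (derivation_mem_tjurina g (h.frame'.mem j)))
      (Ideal.mem_sup_right (hg j hj))
    rwa [add_sub_cancel] at this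

/-- The error need not be of high order, but its low order part lies in `𝔪` times the square of the
split ideal. That ideal sits in the Tjurina ideal of the normal form, so `exists_coordinate_change`
absorbs the error. -/
lemma exists_associated (h : IsSplittingFrame f z D P y E) (hf : f ∈ 𝔪 n ^ 2) {N : ℕ}
    (hN : 𝔪 n ^ N ≤ tjurina f) {b : Hol n} (hb : ∀ k ∈ P, E k b = 0)
    (hfb : f - b ∈ splitIdeal P y ⊔ 𝔪 n ^ (2 * N + 3)) {F₀ : MvPolynomial (Fin (n + 1)) ℂ}
    (hF₀ : MvPolynomial.aeval y F₀ = b + splitQuadric f P y E) :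
    ∃ y', IsCoordinateSystem y' ∧ Associated f (MvPolynomial.aeval y' F₀) := by
  have hp : f - MvPolynomial.aeval y F₀ ∈ 𝔪 n * splitIdeal P y ^ 2 ⊔ 𝔪 n ^ (2 * N + 3) := by
    rw [hF₀, ← sub_sub]
    refine h.sub_splitQuadric_mem hb ?_
    exact hfb
  have hL : splitIdeal P y ≤ tjurina (MvPolynomial.aeval y F₀) := by
    refine h.splitIdeal_le_tjurina fun k hk => ?_
    rw [hF₀, map_add, hb k hk, zero_add, apply_splitQuadric h.frame' hf hk]
    exact h.apply_sub_mem hk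
  have hN' : 𝔪 n ^ (N + 1) ≤ 𝔪 n * tjurina f := by
    rw [pow_succ']
    exact Ideal.mul_mono_right hN
  have hle : tjurina f ≤ tjurina (MvPolynomial.aeval y F₀) := by
    have h1 : 𝔪 n * splitIdeal P y ^ 2 ≤ splitIdeal P y ^ (1 + 1) := Ideal.mul_le_right
    obtain ⟨p₁, hp₁, p₂, hp₂, hpp⟩ := Submodule.mem_sup.1 hp
    refine tjurina_le_of_sub_mem ?_ fun i => ?_
    · rw [← hpp]
      exact add_mem (Ideal.mem_sup_left (hL (Ideal.pow_le_self two_ne_zero (h1 hp₁))))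
        (Ideal.mem_sup_right (hN' (Ideal.pow_le_pow_right (by omega) hp₂)))
    · rw [← hpp, map_add]
      have h2 := derivation_mem_pow (pderiv i) (splitIdeal P y) 1 _ (h1 hp₁)
      rw [pow_one] at h2
      have h3 := derivation_mem_pow (pderiv i) (𝔪 n) (2 * N + 2) _ hp₂
      exact add_mem (Ideal.mem_sup_left (hL h2))
        (Ideal.mem_sup_right (hN' (Ideal.pow_le_pow_right (by omega) h3)))
  have hle2 : 𝔪 n * splitIdeal P y ^ 2 ⊔ 𝔪 n ^ (2 * N + 3) ≤
      𝔪 n * tjurina (MvPolynomial.aeval y F₀) ^ 2 := by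
    refine sup_le (Ideal.mul_mono_right (Ideal.pow_right_mono hL 2)) ?_
    refine le_trans ?_ (Ideal.mul_mono_right (Ideal.pow_right_mono (hN.trans hle) 2))
    rw [← pow_mul, ← pow_succ']
    exact Ideal.pow_le_pow_right (by omega)
  have hF₀𝔪 : MvPolynomial.aeval y F₀ ∈ 𝔪 n ^ 2 := by
    have h1 : 𝔪 n * splitIdeal P y ^ 2 ⊔ 𝔪 n ^ (2 * N + 3) ≤ 𝔪 n ^ 2 := sup_le
      (Ideal.mul_le_right.trans (Ideal.pow_right_mono (splitIdeal_le h.coord.1) 2))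
      (Ideal.pow_le_pow_right (by omega))
    have := sub_mem hf (h1 hp)
    rwa [sub_sub_cancel] at this
  obtain ⟨y', hy', hass⟩ := exists_coordinate_change h.coord F₀ (tjurina_le_𝔪 hF₀𝔪) (hle2 hp)
  rw [add_sub_cancel] at hass
  exact ⟨y', hy', hass⟩

end IsSplittingFrame

/-- Evaluate `∑ (w k + w j) a_kj b_kj` in two ways. No bijection pairing variables of complementary
weight has to be chosen. -/
lemma two_mul_sum_eq_of_hessian {ι : Type*} (P : Finset ι) {a b : ι → ι → ℂ} {w : ι → ℂ} {c : ℂ}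
    (ha : ∀ i j, a i j = a j i) (hb : ∀ i j, b i j = b j i) (haw : ∀ i j, a i j ≠ 0 → w i + w j = c)
    (hab : ∀ k ∈ P, ∑ j ∈ P, a k j * b k j = 1) : 2 * ∑ k ∈ P, w k = P.card * c := by
  have h1 : ∑ k ∈ P, ∑ j ∈ P, (w k + w j) * (a k j * b k j) = P.card * c := by
    have : ∀ k ∈ P, ∑ j ∈ P, (w k + w j) * (a k j * b k j) = c := fun k hk => by
      rw [← mul_one c, ← hab k hk, Finset.mul_sum]
      refine Finset.sum_congr rfl fun j _ => ?_
      by_cases h : a k j = 0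
      · simp [h]
      · rw [haw k j h]
    rw [Finset.sum_congr rfl this, Finset.sum_const, nsmul_eq_mul]
  have h2 : ∑ k ∈ P, ∑ j ∈ P, w k * (a k j * b k j) = ∑ k ∈ P, w k :=
    Finset.sum_congr rfl fun k hk => by rw [← Finset.mul_sum, hab k hk, mul_one]
  have h3 : ∑ k ∈ P, ∑ j ∈ P, w j * (a k j * b k j) = ∑ k ∈ P, w k := by
    rw [← h2, Finset.sum_comm]
    exact Finset.sum_congr rfl fun k _ => Finset.sum_congr rfl fun j _ => by rw [ha, hb]
  rw [← h1]
  simp only [add_mul, Finset.sum_add_distrib, h2, h3]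
  ring

lemma exists_filter_support {σ : Type*} (p : (σ →₀ ℕ) → Prop) [DecidablePred p]
    (F : MvPolynomial σ ℂ) :
    ∃ g : MvPolynomial σ ℂ, ∀ m, g.coeff m = if p m then F.coeff m else 0 := by
  classical
  refine ⟨∑ m ∈ F.support with p m, MvPolynomial.monomial m (F.coeff m), fun m => ?_⟩
  rw [MvPolynomial.coeff_sum]
  simp only [MvPolynomial.coeff_monomial, Finset.sum_ite_eq', Finset.mem_filter,
    MvPolynomial.mem_support_iff]
  by_cases h : p m <;> by_cases h' : F.coeff m = 0 <;> simp [h, h']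

lemma constantCoeff_pderiv {σ : Type*} (k : σ) (F : MvPolynomial σ ℂ) :
    MvPolynomial.constantCoeff (MvPolynomial.pderiv k F) = F.coeff (Finsupp.single k 1) := by
  rw [MvPolynomial.constantCoeff_eq, MvPolynomial.coeff_pderiv]
  simp

lemma constantCoeff_pderiv_pderiv_eq_zero_iff {σ : Type*} (i k : σ) (F : MvPolynomial σ ℂ) :
    MvPolynomial.constantCoeff (MvPolynomial.pderiv i (MvPolynomial.pderiv k F)) = 0 ↔
      F.coeff (Finsupp.single i 1 + Finsupp.single k 1) = 0 := by
  rw [constantCoeff_pderiv, MvPolynomial.coeff_pderiv, mul_eq_zero]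
  refine or_iff_left ?_
  exact Nat.cast_add_one_ne_zero _

lemma exponent_eq_of_mem_support {σ : Type*} {w : σ → ℂ} {c : ℂ} {F : MvPolynomial σ ℂ}
    (hF : F.IsWeightedHomogeneous w c) {i k : σ} {a : ℕ}
    (h : F.coeff (Finsupp.single i a + Finsupp.single k 1) ≠ 0) : a * w i + w k = c := by
  have := hF h
  rw [map_add, Finsupp.weight_single, Finsupp.weight_single] at this
  simpa using this

open IsSplittingFrame in
/-- The splitting lemma for weighted homogeneous isolated singularities: up to a change of
coordinates, the variables split into those of a nondegenerate quadratic form and those of a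
weighted homogeneous polynomial of order at least three. -/
theorem exists_splitting {z : Fin (n + 1) → Hol n} (hz : IsCoordinateSystem z) {w : Fin (n + 1) → ℂ}
    {c : ℂ} {G : MvPolynomial (Fin (n + 1)) ℂ} (hG : G.IsWeightedHomogeneous w c)
    (hf : MvPolynomial.aeval z G ∈ 𝔪 n ^ 2) {N : ℕ}
    (hN : 𝔪 n ^ N ≤ tjurina (MvPolynomial.aeval z G)) :
    ∃ (P : Finset (Fin (n + 1))) (y : Fin (n + 1) → Hol n) (g : MvPolynomial (Fin (n + 1)) ℂ)
      (S : Fin (n + 1) → Fin (n + 1) → ℂ), IsCoordinateSystem y ∧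
      g.IsWeightedHomogeneous w c ∧ (∀ m, g.coeff m ≠ 0 → ∀ k ∈ P, m k = 0) ∧
      (∀ (i k : Fin (n + 1)) (a : ℕ), a ≤ 1 →
        g.coeff (Finsupp.single i a + Finsupp.single k 1) = 0) ∧
      2 * ∑ k ∈ P, w k = P.card * c ∧
      Associated (MvPolynomial.aeval z G) (MvPolynomial.aeval y (g + ∑ i ∈ P, ∑ j ∈ P,
        MvPolynomial.C (S i j) * (MvPolynomial.X i * MvPolynomial.X j))) := by
  classical
  obtain ⟨D, hD⟩ := exists_dualFrame hz
  set f := MvPolynomial.aeval z G with hfG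
  obtain ⟨P, y, E, h⟩ := exists_splittingFrame hz hD hf
  -- The Euler field of the weights `w`; it makes membership in `genWeight` the device for tracking
  -- homogeneity through the change from `z` to `y`.
  let η : Derivation ℂ (Hol n) (Hol n) := ∑ i, (w i • z i) • D i
  have hηz : ∀ i, η (z i) = w i • z i := fun i => by
    rw [sum_smul_derivation_apply]
    simp [hD.dual]
  have hη : ∀ a, η a ∈ 𝔪 n := fun a => by
    simp only [η, sum_smul_derivation_apply]
    exact Ideal.sum_mem _ fun i _ => Ideal.mul_mem_right _ _
      (Submodule.smul_of_tower_mem (𝔪 n) (w i) (hz.1 i))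
  let M := 2 * N + 3
  have hzw : ∀ i, z i ∈ genWeight (derivation_stable hη M) (w i) := fun i =>
    mem_genWeight_of_apply_sub (by simp [hηz])
  -- For `i ∈ P` the new coordinate is a partial derivative of `f`, of weight `c - w i`. Since `g`
  -- does not involve these variables, it is homogeneous for `w` as well as for `w'`.
  let w' : Fin (n + 1) → ℂ := fun i => if i ∈ P then c - w i else w i
  have hyw : ∀ i, y i ∈ genWeight (derivation_stable hη M) (w' i) := fun i => by
    by_cases hi : i ∈ P
    · rw [h.mem i hi, hfG, hD.apply_aeval]
      exact aeval_mem_genWeight hη hzw (hG.pderiv (by simp [w', hi]))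
    · rw [h.notMem i hi]
      simpa [w', hi] using hzw i
  obtain ⟨F, hF, hfF⟩ := exists_approx_of_mem_genWeight hη h.coord hyw
    (aeval_mem_genWeight hη hzw hG)
  rw [← hfG] at hfF
  obtain ⟨g, hg⟩ := exists_filter_support (fun m => ∀ k ∈ P, m k = 0) F
  have hgP : ∀ m, g.coeff m ≠ 0 → ∀ k ∈ P, m k = 0 := fun m hm => by
    by_contra hc
    exact hm (by rw [hg, if_neg hc])
  have hgF : ∀ m, g.coeff m ≠ 0 → F.coeff m ≠ 0 := fun m hm hc => hm (by rw [hg, hc]; simp)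
  have hFg : MvPolynomial.aeval y (F - g) ∈ splitIdeal P y := by
    have h1 : F - g ∈ Ideal.span (MvPolynomial.X '' (P : Set (Fin (n + 1)))) := by
      rw [MvPolynomial.mem_ideal_span_X_image]
      intro m hm
      by_contra! hc
      refine MvPolynomial.mem_support_iff.1 hm ?_
      rw [MvPolynomial.coeff_sub, hg, if_pos (show ∀ k ∈ P, m k = 0 from hc), sub_self]
    have h2 : Ideal.span (MvPolynomial.X '' (P : Set (Fin (n + 1)))) ≤
        (splitIdeal P y).comap (MvPolynomial.aeval y : MvPolynomial (Fin (n + 1)) ℂ →ₐ[ℂ] Hol n) := by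
      refine Ideal.span_le.2 ?_
      rintro _ ⟨k, hk, rfl⟩
      rw [SetLike.mem_coe, Ideal.mem_comap, MvPolynomial.aeval_X]
      exact mem_splitIdeal hk
    exact h2 h1
  have hEg : ∀ k ∈ P, E k (MvPolynomial.aeval y g) = 0 := fun k hk => by
    rw [h.frame'.apply_aeval]
    have : MvPolynomial.pderiv k g = 0 := by
      ext m
      rw [MvPolynomial.coeff_pderiv, hg, if_neg, zero_mul, MvPolynomial.coeff_zero]
      intro hc
      simpa using hc k hk
    rw [this, map_zero]
  let F₀ := g + ∑ i ∈ P, ∑ j ∈ P, MvPolynomial.C (value n (E j (E i f)) / 2) *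
    (MvPolynomial.X i * MvPolynomial.X j)
  have hF₀ : MvPolynomial.aeval y F₀ = MvPolynomial.aeval y g + splitQuadric f P y E := by
    simp [F₀, splitQuadric]
  obtain ⟨y', hy', hass⟩ := h.exists_associated hf hN hEg (by
    have := add_mem (Ideal.mem_sup_right hfF) (Ideal.mem_sup_left hFg)
    rwa [map_sub, sub_add_sub_cancel] at this) hF₀
  refine ⟨P, y', g, fun i j => value n (E j (E i f)) / 2, hy', fun m hm => ?_, hgP,
    fun i k a ha => ?_, ?_, hass⟩
  · rw [← hF (hgF m hm), Finsupp.weight_apply, Finsupp.weight_apply]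
    refine Finset.sum_congr rfl fun k hk => ?_
    by_cases hkP : k ∈ P
    · exact absurd (hgP m hm k hkP) (Finsupp.mem_support_iff.1 hk)
    · simp [w', hkP]
  · rw [hg]
    split_ifs with hm
    · interval_cases a
      · rw [Finsupp.single_zero, zero_add, ← constantCoeff_pderiv, ← value_aeval h.coord.1,
          ← h.frame'.apply_aeval]
        have h1 := value_derivation_of_mem_sq (E k) hf
        have h2 := value_derivation_of_mem_sq (E k) (Ideal.pow_le_pow_right (show 2 ≤ M by omega) hfF)
        rw [map_sub, map_sub, h1] at h2
        simpa using h2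
      · have hi : i ∉ P := fun hi => by simpa using hm i hi
        rw [← constantCoeff_pderiv_pderiv_eq_zero_iff, ← value_aeval h.coord.1,
          ← h.frame'.apply_aeval, ← h.frame'.apply_aeval]
        have h1 := h.null i hi k
        have h2 := derivation_mem_pow (E k) (𝔪 n) 2 _ (Ideal.pow_le_pow_right (show 3 ≤ M by omega) hfF)
        have h3 := value_derivation_of_mem_sq (E i) h2
        rw [map_sub, map_sub, map_sub, h1] at h3
        simpa using h3
    · rfl
  · refine two_mul_sum_eq_of_hessian P (a := fun i j => value n (D i (D j f)))
      (b := fun i j => value n (E i (E j f))) (fun i j => value_derivation_comm _ _ hf)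
      (fun i j => value_derivation_comm _ _ hf) (fun i j hij => ?_) fun k hk =>
        h.sum_hessian_mul hf hk
    rw [hfG, hD.apply_aeval, hD.apply_aeval, value_aeval hz.1, Ne,
      constantCoeff_pderiv_pderiv_eq_zero_iff] at hij
    simpa using exponent_eq_of_mem_support hG hij

end NormalForm

/-! ### Sign of rational weights -/

section WeightCombinatorics

variable {ι : Type*} {Z : Finset ι} {r : ι → ℚ}

/-- At an index of maximal `|r k|` the partner has absolute value at least `2 |r k|`. -/
lemma eq_zero_of_weight_relations
    (h : ∀ i ∈ Z, ∃ j ∈ Z, ∃ a : ℕ, 2 ≤ a ∧ a * r i + r j = 0) : ∀ i ∈ Z, r i = 0 := by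
  intro i hi
  obtain ⟨k, hk, hmax⟩ := Z.exists_max_image (fun i => |r i|) ⟨i, hi⟩
  obtain ⟨j, hj, a, ha, hr⟩ := h k hk
  have h1 : |r j| = a * |r k| := by
    rw [show r j = -(a * r k) by linarith, abs_neg, abs_mul, Nat.abs_cast]
  have h2 : (2 : ℚ) ≤ a := by exact_mod_cast ha
  have h3 := hmax j hj
  have h4 : |r k| ≤ 0 := by
    have := mul_le_mul_of_nonneg_right h2 (abs_nonneg (r k))
    linarith
  exact abs_nonpos_iff.1 ((hmax i hi).trans h4)

/-- A nonpositive weight has a partner of weight at least `1`, so the maximum `r m` is at least `1`.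
The partner of `m` has weight at most `1 - 2 r m < 0`, and the partner of that one has weight at
least `4 r m - 1 > r m`. -/
lemma pos_of_weight_relations
    (h : ∀ i ∈ Z, ∃ j ∈ Z, ∃ a : ℕ, 2 ≤ a ∧ a * r i + r j = 1) : ∀ i ∈ Z, 0 < r i := by
  by_contra! hneg
  obtain ⟨i, hi, hri⟩ := hneg
  obtain ⟨m, hm, hmax⟩ := Z.exists_max_image r ⟨i, hi⟩
  have hstep : ∀ i ∈ Z, r i ≤ 0 → ∃ j ∈ Z, 1 - 2 * r i ≤ r j := fun i hi hri => by
    obtain ⟨j, hj, a, ha, hr⟩ := h i hi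
    have h2 : (2 : ℚ) ≤ a := by exact_mod_cast ha
    exact ⟨j, hj, by linarith [mul_le_mul_of_nonpos_right h2 hri]⟩
  obtain ⟨j, hj, hrj⟩ := hstep i hi hri
  have hm1 : 1 ≤ r m := by linarith [hmax j hj]
  obtain ⟨l, hl, a, ha, hr⟩ := h m hm
  have h2 : (2 : ℚ) ≤ a := by exact_mod_cast ha
  have h3 : r l ≤ 1 - 2 * r m := by
    linarith [mul_le_mul_of_nonneg_right h2 (show 0 ≤ r m by linarith)]
  obtain ⟨k, hk, hrk⟩ := hstep l hl (by linarith)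
  linarith [hmax k hk]

lemma exists_natural_multiple [Fintype ι] {v : ι → ℚ} (hv : ∀ i, 0 < v i) :
    ∃ (M : ℕ) (W : ι → ℕ), (∀ i, 0 < W i) ∧ ∀ i, (W i : ℚ) = M * v i := by
  let M : ℕ := ∏ i, (v i).den
  have hM : 0 < M := Finset.prod_pos fun i _ => (v i).den_pos
  have h : ∀ i, ∃ W : ℕ, (W : ℚ) = M * v i := fun i => by
    obtain ⟨q, hq⟩ : (v i).den ∣ M := Finset.dvd_prod_of_mem _ (Finset.mem_univ i)
    refine ⟨q * (v i).num.toNat, ?_⟩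
    have h1 : (((v i).num.toNat : ℤ) : ℚ) = (v i).num := by
      rw [Int.toNat_of_nonneg (Rat.num_nonneg.2 (hv i).le)]
    have h2 : (v i) * (v i).den = (v i).num := Rat.mul_den_eq_num (v i)
    rw [hq]
    push_cast at h1 ⊢
    rw [h1, ← h2]
    ring
  choose W hW using h
  refine ⟨M, W, fun i => ?_, hW⟩
  have : (0 : ℚ) < W i := by
    rw [hW]
    exact mul_pos (by exact_mod_cast hM) (hv i)
  exact_mod_cast this

end WeightCombinatorics

/-! ### From complex weights to positive integer weights -/

section Quasihomogeneity

variable {n : ℕ}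

/-- The quadratic form with coefficients `S` in the variables from `P`. -/
def quadric (P : Finset (Fin (n + 1))) (S : Fin (n + 1) → Fin (n + 1) → ℂ) :
    MvPolynomial (Fin (n + 1)) ℂ :=
  ∑ i ∈ P, ∑ j ∈ P, MvPolynomial.C (S i j) * (MvPolynomial.X i * MvPolynomial.X j)

lemma coeff_quadric_eq_zero {P : Finset (Fin (n + 1))} (S : Fin (n + 1) → Fin (n + 1) → ℂ)
    {i : Fin (n + 1)} (hi : i ∉ P) (a : ℕ) (k : Fin (n + 1)) :
    (quadric P S).coeff (Finsupp.single i a + Finsupp.single k 1) = 0 := by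
  classical
  rw [quadric, MvPolynomial.coeff_sum]
  refine Finset.sum_eq_zero fun p hp => ?_
  rw [MvPolynomial.coeff_sum]
  refine Finset.sum_eq_zero fun q hq => ?_
  rw [MvPolynomial.X, MvPolynomial.X, MvPolynomial.monomial_mul, MvPolynomial.C_mul_monomial,
    MvPolynomial.coeff_monomial, if_neg]
  intro h
  have hpi : p ≠ i := fun e => hi (e ▸ hp)
  have hqi : q ≠ i := fun e => hi (e ▸ hq)
  have h1 := DFunLike.congr_fun h i
  simp only [Finsupp.add_apply, Finsupp.single_apply, hpi, hqi, if_false, if_true] at h1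
  have h2 := congrArg Finsupp.degree h
  simp only [map_add, Finsupp.degree_single] at h2
  omega

/-- The field `E i` preserves the ideal of the `i`-th axis and lowers powers of `y i`, so induction
ends at `1`. -/
lemma pow_notMem_span {y : Fin (n + 1) → Hol n}
    {E : Fin (n + 1) → Derivation ℂ (Hol n) (Hol n)} (hy : IsCoordinateSystem y)
    (hE : IsDualFrame y E) (i : Fin (n + 1)) (k : ℕ) : y i ^ k ∉ Ideal.span (y '' {l | l ≠ i}) := by
  induction k with
  | zero =>
    intro h
    have hle : Ideal.span (y '' {l | l ≠ i}) ≤ 𝔪 n := by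
      refine Ideal.span_le.2 ?_
      rintro _ ⟨l, -, rfl⟩
      exact hy.1 l
    have := mem_𝔪.1 (hle h)
    simp at this
  | succ k ih =>
    intro h
    refine ih ?_
    have h1 := derivation_mem_span (E i) (J := Ideal.span (y '' {l | l ≠ i}))
      (fun a ha => Ideal.subset_span ha) (by
        rintro _ ⟨l, hl, rfl⟩
        rw [hE.dual, if_neg (Ne.symm hl)]
        exact Ideal.zero_mem _) _ h
    rw [Derivation.leibniz_pow, Nat.add_sub_cancel, hE.dual, if_pos rfl, smul_eq_mul, mul_one,
      nsmul_eq_mul] at h1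
    have h2 : IsUnit ((k + 1 : ℕ) : Hol n) := by
      rw [isUnit_iff_value, map_natCast]
      exact Nat.cast_ne_zero.2 (Nat.succ_ne_zero k)
    rwa [Ideal.unit_mul_mem_iff_mem _ h2] at h1

/-- A polynomial with isolated singularity contains for each variable `xᵢ` a monomial
`xᵢᵃ x_k`. -/
lemma exists_coeff_ne_zero {y : Fin (n + 1) → Hol n} (hy : IsCoordinateSystem y)
    {F : MvPolynomial (Fin (n + 1)) ℂ} (hF : MvPolynomial.aeval y F ∈ 𝔪 n ^ 2) {N : ℕ}
    (hN : 𝔪 n ^ N ≤ tjurina (MvPolynomial.aeval y F)) (i : Fin (n + 1)) :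
    ∃ (a : ℕ) (k : Fin (n + 1)), F.coeff (Finsupp.single i a + Finsupp.single k 1) ≠ 0 := by
  by_contra! hc
  obtain ⟨E, hE⟩ := exists_dualFrame hy
  have hspan : Ideal.span (MvPolynomial.X '' {l | l ≠ i}) ≤
      (Ideal.span (y '' {l | l ≠ i})).comap
        (MvPolynomial.aeval y : MvPolynomial (Fin (n + 1)) ℂ →ₐ[ℂ] Hol n) := by
    refine Ideal.span_le.2 ?_
    rintro _ ⟨l, hl, rfl⟩
    rw [SetLike.mem_coe, Ideal.mem_comap, MvPolynomial.aeval_X]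
    exact Ideal.subset_span ⟨l, hl, rfl⟩
  have key : ∀ Q : MvPolynomial (Fin (n + 1)) ℂ, (∀ a, Q.coeff (Finsupp.single i a) = 0) →
      MvPolynomial.aeval y Q ∈ Ideal.span (y '' {l | l ≠ i}) := fun Q hQ => by
    refine hspan (MvPolynomial.mem_ideal_span_X_image.2 fun m hm => ?_)
    by_contra! hml
    refine MvPolynomial.mem_support_iff.1 hm ?_
    rw [← hQ (m i)]
    congr 1
    ext l
    by_cases hl : l = i
    · subst hl; simp
    · rw [hml l hl, Finsupp.single_eq_of_ne hl]
  -- Without such monomials the polynomial and all its partial derivatives vanish along the `i`-th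
  -- axis, which no power of `𝔪` in the Tjurina ideal permits.
  have hle : tjurina (MvPolynomial.aeval y F) ≤ Ideal.span (y '' {l | l ≠ i}) := by
    rw [hE.tjurina_eq]
    refine Ideal.span_le.2 ?_
    rintro _ (rfl | ⟨k, rfl⟩)
    · refine key F fun a => ?_
      cases a with
      | zero =>
        have := value_aeval hy.1 F
        rw [mem_𝔪.1 (Ideal.pow_le_self two_ne_zero hF)] at this
        rw [Finsupp.single_zero, ← MvPolynomial.constantCoeff_eq, ← this]
      | succ a => rw [Finsupp.single_add]; exact hc a i
    · change E k _ ∈ _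
      rw [hE.apply_aeval]
      refine key _ fun a => ?_
      rw [MvPolynomial.coeff_pderiv, hc a k, zero_mul]
  exact pow_notMem_span hy hE i N (hle (hN (Ideal.pow_mem_pow (hy.1 i) N)))

/-- Weighted homogeneous isolated singularities with respect to complex weights are
quasihomogeneous, provided that the degree is not the sum of the weights. -/
theorem isQuasihomogeneous_of_complex_weights {f : Hol n} (hsq : f ∈ 𝔪 n ^ 2) {N : ℕ}
    (hN : 𝔪 n ^ N ≤ tjurina f) {z : Fin (n + 1) → Hol n} (hz : IsCoordinateSystem z)
    {w : Fin (n + 1) → ℂ} {c : ℂ} {G : MvPolynomial (Fin (n + 1)) ℂ}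
    (hG : G.IsWeightedHomogeneous w c) (hfG : Associated f (MvPolynomial.aeval z G))
    (hc : c ≠ ∑ i, w i) : IsQuasihomogeneous f := by
  classical
  have hG2 : MvPolynomial.aeval z G ∈ 𝔪 n ^ 2 := Ideal.mem_of_dvd _ hfG.dvd hsq
  obtain ⟨P, y, g, S, hy, hg, hgP, hg3, hP, hass⟩ :=
    exists_splitting hz hG hG2 (tjurina_eq_of_associated hfG ▸ hN)
  rw [← quadric] at hass
  have hF2 : MvPolynomial.aeval y (g + quadric P S) ∈ 𝔪 n ^ 2 := Ideal.mem_of_dvd _ hass.dvd hG2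
  have hfF := hfG.trans hass
  -- Homogeneity relations have natural number coefficients, so a `ℚ`-linear functional carries them
  -- to rational weights; this one keeps `c ≠ ∑ wᵢ` visible.
  obtain ⟨φ, hφ⟩ : ∃ φ : Module.Dual ℚ ℂ, φ (c - ∑ i, w i) ≠ 0 := by
    by_contra! h
    exact hc (sub_eq_zero.1 ((Module.forall_dual_apply_eq_zero_iff ℚ _).1 h))
  have hrel : ∀ i ∈ Pᶜ, ∃ j ∈ Pᶜ, ∃ a : ℕ, 2 ≤ a ∧ a * φ (w i) + φ (w j) = φ c := by
    intro i hi
    have hi' := Finset.mem_compl.1 hi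
    obtain ⟨a, k, hak⟩ := exists_coeff_ne_zero hy hF2 (tjurina_eq_of_associated hfF ▸ hN) i
    rw [MvPolynomial.coeff_add, coeff_quadric_eq_zero S hi', add_zero] at hak
    refine ⟨k, ?_, a, ?_, ?_⟩
    · rw [Finset.mem_compl]
      intro hk
      simpa using hgP _ hak k hk
    · by_contra ha
      exact hak (hg3 i k a (by omega))
    · rw [← exponent_eq_of_mem_support hg hak, map_add, ← nsmul_eq_mul, ← nsmul_eq_mul, map_nsmul]
  have hPφ : 2 * ∑ k ∈ P, φ (w k) = P.card * φ c := by
    have := congrArg φ hP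
    rwa [two_mul, map_add, map_sum, ← two_mul, ← nsmul_eq_mul, map_nsmul, nsmul_eq_mul] at this
  -- If `φ c = 0`, the weights outside `P` vanish by `hrel` and those in `P` sum to zero by `hPφ`,
  -- contradicting the choice of `φ`.
  have hρ : φ c ≠ 0 := by
    intro h0
    rw [h0] at hrel hPφ
    have h1 := eq_zero_of_weight_relations hrel
    apply hφ
    rw [map_sub, map_sum, h0, ← Finset.sum_add_sum_compl P, Finset.sum_eq_zero h1]
    linarith
  have hpos := pos_of_weight_relations (Z := Pᶜ) (r := fun i => φ (w i) / φ c) fun i hi => by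
    obtain ⟨j, hj, a, ha, h⟩ := hrel i hi
    refine ⟨j, hj, a, ha, ?_⟩
    field_simp
    exact h
  -- The weights in `P` may be reset to one half of the degree, since these variables occur only in
  -- the quadratic form.
  obtain ⟨M, W, hW, hWv⟩ := exists_natural_multiple
    (v := fun i => if i ∈ P then 1 / 2 else φ (w i) / φ c) fun i => by
      by_cases hi : i ∈ P
      · simp [hi]
      · simpa [hi] using hpos i (Finset.mem_compl.2 hi)
  refine ⟨y, hy, W, hW, M, g + quadric P S, ?_, hfF⟩
  have hg' : g.IsWeightedHomogeneous W M := by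
    intro m hm
    have h1 := congrArg φ (hg hm)
    rw [Finsupp.weight_apply, Finsupp.sum, map_sum] at h1
    have h2 : ((Finsupp.weight W m : ℕ) : ℚ) = M := by
      rw [Finsupp.weight_apply, Finsupp.sum, Nat.cast_sum]
      have h3 : ∀ i ∈ m.support, ((m i • W i : ℕ) : ℚ) = M / φ c * φ (m i • w i) := by
        intro i hi
        have hiP : i ∉ P := fun h => Finsupp.mem_support_iff.1 hi (hgP m hm i h)
        rw [map_nsmul, smul_eq_mul, nsmul_eq_mul, Nat.cast_mul, hWv, if_neg hiP]
        ring
      rw [Finset.sum_congr rfl h3, ← Finset.mul_sum, h1]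
      field_simp
    exact_mod_cast h2
  have hq' : (quadric P S).IsWeightedHomogeneous W M := by
    rw [quadric, ← MvPolynomial.mem_weightedHomogeneousSubmodule]
    refine Submodule.sum_mem _ fun i hi => Submodule.sum_mem _ fun j hj => ?_
    rw [MvPolynomial.mem_weightedHomogeneousSubmodule]
    have hij : 0 + (W i + W j) = M := by
      have h1 := hWv i
      have h2 := hWv j
      rw [if_pos hi] at h1
      rw [if_pos hj] at h2
      have : ((0 + (W i + W j) : ℕ) : ℚ) = M := by push_cast; rw [h1, h2]; ring
      exact_mod_cast this
    rw [← hij]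
    exact (MvPolynomial.isWeightedHomogeneous_C W _).mul
      ((MvPolynomial.isWeightedHomogeneous_X ℂ W i).mul (MvPolynomial.isWeightedHomogeneous_X ℂ W j))
  exact hg'.add hq'

/-- If a vector field `η` satisfies `η f = h f` and `f` is not quasihomogeneous, then the
divergence of `η` and `h` agree at the origin. -/
theorem value_eq_divergence {f : Hol n} (hf : IsIsolatedSingularity f) (hq : ¬ IsQuasihomogeneous f)
    {η : Derivation ℂ (Hol n) (Hol n)} (hη : η ∈ vectorFields n) {h : Hol n} (hηf : η f = h * f) :
    value n h = ∑ i, value n (pderiv i (η (coordX i))) := by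
  by_contra hne
  obtain ⟨k, hk⟩ := exists_pow_le_tjurina hf
  obtain ⟨z, w, G, hz, hG, hw, hass⟩ := exists_complex_weights hη hηf hf.mem_sq hk
  rw [← hw] at hne
  exact hq (isQuasihomogeneous_of_complex_weights hf.mem_sq hk hz hG hass hne)

end Quasihomogeneity

/-! ### Logarithmic forms as tangent vector fields -/

section LogarithmicForms

variable {n : ℕ}

lemma IsIsolatedSingularity.ne_zero {f : Hol n} (hf : IsIsolatedSingularity f) : f ≠ 0 := by
  rintro rfl
  obtain ⟨k, hk⟩ := exists_pow_le_tjurina hf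
  have h1 : tjurina (0 : Hol n) = ⊥ := by
    rw [tjurina, Ideal.span_eq_bot]
    rintro _ (rfl | ⟨i, rfl⟩)
    · rfl
    · exact map_zero _
  have h2 : coordX (n := n) 0 ^ k = 0 := by
    have := hk (Ideal.pow_mem_pow (coordX_mem 0) k)
    rwa [h1] at this
  have h3 := pderiv_coordX (n := n) 0 0
  rw [eq_zero_of_pow_eq_zero h2, map_zero, if_pos rfl] at h3
  exact zero_ne_one h3

lemma algebraMap_mero_injective {f : Hol n} (hf : f ≠ 0) :
    Function.Injective (algebraMap (Hol n) (Mero f)) :=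
  IsLocalization.injective (Mero f) (powers_le_nonZeroDivisors_of_noZeroDivisors hf)

lemma isUnit_algebraMap_mero (f : Hol n) : IsUnit (algebraMap (Hol n) (Mero f) f) :=
  IsLocalization.Away.algebraMap_isUnit f

/-- The standard basis of the tangent space. -/
def stdFrame (n : ℕ) : Fin (n + 1) → Space n := fun i => Pi.single i 1

lemma form_ext {f : Hol n} {ω ω' : MeroForm f (n + 1)} (h : ω (stdFrame n) = ω' (stdFrame n)) :
    ω = ω' := by
  refine Module.Basis.ext_alternating (Pi.basisFun ℂ (Fin (n + 1))) fun v hv => ?_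
  let σ : Equiv.Perm (Fin (n + 1)) := Equiv.ofBijective v (Finite.injective_iff_bijective.1 hv)
  have h1 : (fun i => Pi.basisFun ℂ (Fin (n + 1)) (v i)) = stdFrame n ∘ σ := by
    funext i
    simp [stdFrame, σ]
  rw [h1, AlternatingMap.map_perm, AlternatingMap.map_perm, h]

lemma smul_volOver_stdFrame (f u : Hol n) :
    f • volOver f u (stdFrame n) = algebraMap (Hol n) (Mero f) u := by
  have h1 : volForm f (stdFrame n) = 1 := by
    have : stdFrame n = Pi.basisFun ℂ (Fin (n + 1)) := by
      funext i
      simp [stdFrame]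
    rw [this]
    change Algebra.linearMap ℂ (Mero f) ((Pi.basisFun ℂ (Fin (n + 1))).det _) = 1
    rw [Module.Basis.det_self, Algebra.linearMap_apply, map_one]
  change f • (IsLocalization.mk' (Mero f) u (⟨f, Submonoid.mem_powers f⟩ : Submonoid.powers f) •
    volForm f (stdFrame n)) = _
  rw [h1, smul_eq_mul, mul_one, Algebra.smul_def]
  exact IsLocalization.mk'_spec' (Mero f) u ⟨f, Submonoid.mem_powers f⟩

lemma eq_volOver_iff {f u : Hol n} {ω : MeroForm f (n + 1)} :
    ω = volOver f u ↔ f • ω (stdFrame n) = algebraMap (Hol n) (Mero f) u := by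
  refine ⟨fun h => h ▸ smul_volOver_stdFrame f u, fun h => form_ext ?_⟩
  rw [← smul_volOver_stdFrame, Algebra.smul_def, Algebra.smul_def] at h
  exact (isUnit_algebraMap_mero f).mul_left_cancel h

lemma volOver_eq_smul (f u : Hol n) : volOver f u = u • volOver f 1 := by
  symm
  rw [eq_volOver_iff, AlternatingMap.smul_apply, smul_comm, smul_volOver_stdFrame, map_one,
    Algebra.smul_def, mul_one]

lemma volOver_injective {f : Hol n} (hf : f ≠ 0) {u v : Hol n} (h : volOver f u = volOver f v) :
    u = v :=
  algebraMap_mero_injective hf (by rw [← smul_volOver_stdFrame, h, smul_volOver_stdFrame])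

lemma dirDeriv_stdFrame (f : Hol n) (i : Fin (n + 1)) (r : Mero f) :
    dirDeriv f (stdFrame n i) r = mderiv f i r := by
  rw [dirDeriv_apply, Finset.sum_eq_single i]
  · simp [stdFrame]
  · intro j _ hj
    simp [stdFrame, hj]
  · simp

/-- A logarithmic `n`-form gives a vector field tangent to `f = 0`, and its differential measures
the divergence of that vector field. -/
theorem exists_vectorField_of_mem_logForms {f : Hol n} (hf : f ≠ 0) {ω : MeroForm f n}
    (hω : ω ∈ logForms f n) : ∃ η ∈ vectorFields n, ∃ h : Hol n, η f = h * f ∧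
      extD f n ω = volOver f (∑ i, pderiv i (η (coordX i)) - h) := by
  have ha : ∀ i : Fin (n + 1), ∃ a : Hol n,
      algebraMap (Hol n) (Mero f) a = f • ω (i.removeNth (stdFrame n)) := fun i => hω.1 _
  choose a ha using ha
  obtain ⟨g, hg⟩ : ∃ g : Hol n, algebraMap (Hol n) (Mero f) g = f • extD f n ω (stdFrame n) :=
    hω.2 _
  -- The signs make `ω` the contraction of `dx / f` with `η`.
  let η : Derivation ℂ (Hol n) (Hol n) := ∑ i : Fin (n + 1), ((-1) ^ (i : ℕ) * a i) • pderiv i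
  have hη : ∀ b, η b = ∑ i : Fin (n + 1), (-1) ^ (i : ℕ) * a i * pderiv i b :=
    fun b => sum_smul_derivation_apply _ _ _ b
  have hηx : ∀ i : Fin (n + 1), η (coordX i) = (-1) ^ (i : ℕ) * a i := fun i => by
    rw [hη]
    simp [pderiv_coordX]
  have hdiv : ∑ i, pderiv i (η (coordX i)) =
      ∑ i : Fin (n + 1), (-1) ^ (i : ℕ) * pderiv i (a i) := by
    refine Finset.sum_congr rfl fun i _ => ?_
    rw [hηx]
    rcases neg_one_pow_eq_or (Hol n) (i : ℕ) with h | h <;> simp [h]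
  have hstep : ∀ i : Fin (n + 1), algebraMap (Hol n) (Mero f) f *
      (f • mderiv f i (ω (i.removeNth (stdFrame n)))) =
        algebraMap (Hol n) (Mero f) (f * pderiv i (a i) - a i * pderiv i f) := fun i => by
    have h1 := congrArg (mderiv f i) (ha i)
    rw [Algebra.smul_def, Derivation.leibniz, mderiv, locDer_algebraMap, locDer_algebraMap,
      smul_eq_mul, smul_eq_mul] at h1
    rw [map_sub, map_mul, map_mul, h1, ha i, Algebra.smul_def, Algebra.smul_def, mderiv]
    ring
  -- The quotient rule for `∂ᵢ (aᵢ / f)`, with denominators cleared. Holomorphy of `g` makes `η f`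
  -- divisible by `f`, with quotient `div η - g`.
  have hfg : f * g = f * (∑ i, pderiv i (η (coordX i))) - η f := by
    apply algebraMap_mero_injective hf
    rw [map_mul, hg, extD_apply, Finset.smul_sum, Finset.mul_sum, hdiv, hη, Finset.mul_sum,
      ← Finset.sum_sub_distrib, map_sum]
    refine Finset.sum_congr rfl fun i _ => ?_
    rw [dirDeriv_stdFrame, smul_comm f, mul_smul_comm, hstep,
      show f * ((-1) ^ (i : ℕ) * pderiv i (a i)) - (-1) ^ (i : ℕ) * a i * pderiv i f =
        (-1) ^ (i : ℕ) * (f * pderiv i (a i) - a i * pderiv i f) by ring,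
      map_mul _ ((-1) ^ (i : ℕ)), map_pow, map_neg, map_one]
    rcases Nat.even_or_odd (i : ℕ) with h | h <;> simp [h]
  refine ⟨η, Submodule.sum_mem _ fun i _ => Submodule.smul_mem _ _ (pderiv_mem_vectorFields i),
    ∑ i, pderiv i (η (coordX i)) - g, ?_, ?_⟩
  · rw [sub_mul, mul_comm g, hfg]
    ring
  · rw [sub_sub_cancel, eq_volOver_iff, hg]

theorem exists_extD_eq_volOver {f : Hol n} (hf : IsIsolatedSingularity f)
    (hq : ¬ IsQuasihomogeneous f) {ω : MeroForm f n} (hω : ω ∈ logForms f n) :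
    ∃ u ∈ 𝔪 n, extD f n ω = volOver f u := by
  obtain ⟨η, hη, h, hηf, hd⟩ := exists_vectorField_of_mem_logForms hf.ne_zero hω
  refine ⟨_, ?_, hd⟩
  rw [mem_𝔪, map_sub, map_sum, value_eq_divergence hf hq hη hηf, sub_self]

end LogarithmicForms

end LogSing
end

theorem mainTheorem2 (n : ℕ) (f : LogSing.Hol n) (hf : LogSing.IsIsolatedSingularity f)
    (hq : ¬ LogSing.IsQuasihomogeneous f) :
    (∀ u : LogSing.Hol n, IsUnit u →
      LogSing.logClass f (n + 1) (LogSing.volCocycle f u) ≠ 0) ∧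
    (∀ ω ∈ LogSing.logForms f n,
      LogSing.extD f n ω ∈ LogSing.𝔪 n • LogSing.logForms f (n + 1)) := by
  refine ⟨fun u hu h => ?_, fun ω hω => ?_⟩
  · obtain ⟨ω, hω⟩ : LogSing.volCocycle f u ∈ (LogSing.logCoboundaries f (n + 1)).submoduleOf
        (LogSing.logCocycles f (n + 1)) := (Submodule.Quotient.mk_eq_zero _).1 h
    obtain ⟨v, hv, hd⟩ := LogSing.exists_extD_eq_volOver hf hq ω.2
    have h1 : LogSing.extD f n ω = LogSing.volOver f u := congrArg Subtype.val hω
    have h2 : u = v := LogSing.volOver_injective hf.ne_zero (h1.symm.trans hd)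
    exact LogSing.isUnit_iff_value.1 hu (LogSing.mem_𝔪.1 (h2 ▸ hv))
  · obtain ⟨v, hv, hd⟩ := LogSing.exists_extD_eq_volOver hf hq hω
    rw [hd, LogSing.volOver_eq_smul]
    exact Submodule.smul_mem_smul hv (LogSing.volOver_mem f 1)
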